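/- Let $\mathcal A$ be a compact set of real $2\times 2$ matrices whose members have no common invariant subspace other than $\{0\}$ and $\mathbb R^2$. A switching law for $\mathcal A$ is a measurable function $A:[0,\infty)\to\mathcal A$; a trajectory of the system with control set $\mathcal A$ is a (Carathéodory) solution $x:[0,\infty)\to\mathbb R^2$ of $\dot x(t)=A(t)x(t)$ for some switching law $A$. Let $\sigma$ be the Lyapunov exponent of $\mathcal A$, i.e. the infimum of the numbers $s$ such that for every trajectory $x$ there is a constant $C=C(x)$ with $\|x(t)\|\le Ce^{st}$ for all $t\ge 0$, and assume that $\sigma I\notin\mathcal A$. A Barabanov norm of $\mathcal A$ is a norm $f$ on $\mathbb R^2$ such that $f(x(t))\le e^{\sigma t}f(x(0))$, $t\ge0$, for every trajectory $x$ of $\mathcal A$, and such that through every initial point there is an extremal trajectory, i.e. a trajectory $\bar x$ of the system with control set $\mathrm{co}(\mathcal A)$ with $f(\bar x(t))=e^{\sigma t}f(\bar x(0))$ for all $t\ge 0$. A matrix $A\in\mathrm{co}(\mathcal A)$, $A\ne\sigma I$, is dominant if the largest real part of its eigenvalues equals $\sigma$; $\mathcal A$ has real (complex) dominance if there is a dominant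 matrix with real (non-real) eigenvalues. Suppose that $\mathcal A$ does not have real dominance. Then $\mathcal A$ has a Barabanov norm, this norm is unique up to multiplication by a positive constant, and its unit sphere $S$ is a $C^1$ closed curve (it has a regular periodic $C^1$ parametrization that is injective on a period). Suppose in addition that $\mathcal A$ does not have complex dominance, and let $f$ be a Barabanov norm with unit sphere $S$. Then there is an extremal trajectory $\bar x$ which is generated by a periodic switching law $A:[0,\infty)\to\mathcal A$ and such that, with $T>0$ the minimal period of $A$, the map $t\mapsto e^{-\sigma t}\bar x(t)$ is a bijection of $[0,2T)$ onto $S$. This extremal trajectory is unique in the following sense: for every extremal trajectory $y$ with $y(0)\ne0$ there are $c>0$ and a continuous strictly increasing function $\tau:[0,\infty)\to[0,\infty)$ with $\tau(t)\to\infty$ as $t\to\infty$ such that $e^{-\sigma t}y(t)=c\,e^{-\sigma\tau(t)}\bar x(\tau(t))$ for all $t\ge0$. -/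

import Mathlib

open Set Filter Topology MeasureTheory

namespace PlanarSwitching

/-- The plane `ℝ²`. All notions below are independent of the choice of a reference norm on it. -/
abbrev Plane : Type := Fin 2 → ℝ

/-- Real `2 × 2` matrices. -/
abbrev Mat : Type := Matrix (Fin 2) (Fin 2) ℝ

/-- The matrices of the family have no common invariant subspace except `0` and the plane. -/
def IsIrreducible (𝒜 : Set Mat) : Prop :=
  ∀ W : Submodule ℝ Plane, (∀ A ∈ 𝒜, ∀ v ∈ W, A.mulVec v ∈ W) → W = ⊥ ∨ W = ⊤

/-- A switching law for the control set `𝒜`: a measurable `𝒜`-valued function of the time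
`t ≥ 0` (the values at negative times play no role). -/
def IsSwitchingLaw (𝒜 : Set Mat) (A : ℝ → Mat) : Prop :=
  (∀ i j, Measurable fun t => A t i j) ∧ ∀ t, 0 ≤ t → A t ∈ 𝒜

/-- `x` solves `ẋ(t) = A(t) x(t)`, `t ≥ 0`, in the sense of Carathéodory. -/
def IsSolution (A : ℝ → Mat) (x : ℝ → Plane) : Prop :=
  ContinuousOn x (Ici 0) ∧ ∀ t, 0 ≤ t → x t = x 0 + ∫ s in (0 : ℝ)..t, (A s).mulVec (x s)

/-- `x` is a trajectory of the linear switching system with control set `𝒜`. -/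
def IsTrajectory (𝒜 : Set Mat) (x : ℝ → Plane) : Prop :=
  ∃ A : ℝ → Mat, IsSwitchingLaw 𝒜 A ∧ IsSolution A x

/-- The Lyapunov exponent: the infimum of the `s` such that every trajectory satisfies
`‖x(t)‖ ≤ C e^{s t}`, with a constant `C` that may depend on the trajectory. -/
noncomputable def lyapunovExponent (𝒜 : Set Mat) : ℝ :=
  sInf {s : ℝ | ∀ x, IsTrajectory 𝒜 x → ∃ C : ℝ, ∀ t, 0 ≤ t → ‖x t‖ ≤ C * Real.exp (s * t)}

/-- `x` is an extremal trajectory with respect to `f`: a trajectory of the system with control set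
`co(𝒜)` along which `f` grows exactly as `e^{σ t}`. -/
def IsExtremalTrajectory (𝒜 : Set Mat) (f : Seminorm ℝ Plane) (x : ℝ → Plane) : Prop :=
  IsTrajectory (convexHull ℝ 𝒜) x ∧
    ∀ t, 0 ≤ t → f (x t) = Real.exp (lyapunovExponent 𝒜 * t) * f (x 0)

/-- `f` is a Barabanov (invariant) norm of the system with control set `𝒜`. -/
structure IsBarabanovNorm (𝒜 : Set Mat) (f : Seminorm ℝ Plane) : Prop where
  /-- `f` is a norm. -/
  definite : ∀ v, f v = 0 → v = 0
  growth_le : ∀ x, IsTrajectory 𝒜 x →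
    ∀ t, 0 ≤ t → f (x t) ≤ Real.exp (lyapunovExponent 𝒜 * t) * f (x 0)
  exists_extremal : ∀ v : Plane, ∃ x, IsExtremalTrajectory 𝒜 f x ∧ x 0 = v

/-- The complex eigenvalues of a real matrix. -/
def eigenvalues (A : Mat) : Set ℂ :=
  spectrum ℂ (A.map (fun a : ℝ => (a : ℂ)))

/-- `A` is dominant for `𝒜`: it lies in `co(𝒜)`, differs from `σI`, and the largest real part of
its eigenvalues is equal to `σ`. -/
def IsDominant (𝒜 : Set Mat) (A : Mat) : Prop :=
  A ∈ convexHull ℝ 𝒜 ∧ A ≠ lyapunovExponent 𝒜 • (1 : Mat) ∧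
    IsGreatest (Complex.re '' eigenvalues A) (lyapunovExponent 𝒜)

/-- Some dominant matrix has only real eigenvalues. -/
def HasRealDominance (𝒜 : Set Mat) : Prop :=
  ∃ A, IsDominant 𝒜 A ∧ ∀ z ∈ eigenvalues A, z.im = 0

/-- Some dominant matrix has non-real eigenvalues. -/
def HasComplexDominance (𝒜 : Set Mat) : Prop :=
  ∃ A, IsDominant 𝒜 A ∧ ∃ z ∈ eigenvalues A, z.im ≠ 0

/-- The unit sphere of `f`. -/
def unitSphere (f : Seminorm ℝ Plane) : Set Plane := {v | f v = 1}

/-- `S` is a simple closed curve of class `C¹`: it has a regular periodic `C¹` parametrization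
that is injective on a period. -/
def IsC1ClosedCurve (S : Set Plane) : Prop :=
  ∃ (L : ℝ) (γ : ℝ → Plane), 0 < L ∧ ContDiff ℝ 1 γ ∧ Function.Periodic γ L ∧
    (∀ t, deriv γ t ≠ 0) ∧ BijOn γ (Ico 0 L) S

/-- `T` is the (minimal positive) period of the switching law `A` on `[0, ∞)`. -/
def IsMinimalPeriod (A : ℝ → Mat) (T : ℝ) : Prop :=
  IsLeast {P : ℝ | 0 < P ∧ ∀ t, 0 ≤ t → A (t + P) = A t} T

/-- After removing the factor `e^{s t}`, the function `y` runs along the same curve as `x`: they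
agree up to a positive factor, the choice of the starting point on the curve, and an
orientation-preserving change of the speed. -/
def SameTrajectory (s : ℝ) (y x : ℝ → Plane) : Prop :=
  ∃ (c : ℝ) (τ : ℝ → ℝ), 0 < c ∧ 0 ≤ τ 0 ∧ ContinuousOn τ (Ici 0) ∧ StrictMonoOn τ (Ici 0) ∧
    Tendsto τ atTop atTop ∧
    ∀ t, 0 ≤ t → Real.exp (-s * t) • y t = c • (Real.exp (-s * τ t) • x (τ t))

end PlanarSwitching

open scoped Matrix NNReal

namespace PlanarSwitching

/-! ### Seminorms on the plane and their subgradients -/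

/-! Write `σ` for the Lyapunov exponent and pass to `𝓑 = 𝒜 - σI` (`shiftSet`). Norms are studied
infinitesimally: `f` does not increase along trajectories when `p ⬝ᵥ (B *ᵥ x) ≤ 0` for all
subgradients `p` of `f` at `x` and all `B ∈ 𝓑` (`IsInvariantFor`), and extremal motion requires
tangency, `p ⬝ᵥ (B *ᵥ x) = 0`.

Adapted norm (`exists_adapted_norm`). The least growth rate `ρ` of a nonzero seminorm under constant
laws is attained (`exists_minimal_rate`). After subtracting `ρI`, the suprema of an invariant norm
over all transitions of length `t` decrease in `t`. Minimality of `ρ` keeps their limit from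
vanishing, and limits of transitions preserve it (`exists_preserved_norm`); hence some velocity is
tangent at every point. Following tangent velocities on a fine time grid gives growth close to
`e^{ρt}`, so `ρ = σ` (`lyapunovExponent_eq`).

Complex dominance. The hull of `𝓑` contains a rotation `b • J`. An invariant norm is constant on its
closed orbits, so the sphere is an ellipse and the norm is determined
(`barabanov_of_complexDominance`).

No dominance. All matrices in the hull of `𝓑` have negative trace and are invertible
(`hull_trace_neg`, `hull_mulVec_ne_zero`), so a tangent velocity points strictly forward or strictly
backward around the origin. A direction with both is a corner. From a corner, forwardness spreads to
the right through a whole turn and meets the same corner from the left, where it is impossible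
(`not_forward_and_backward`). By connectedness all tangent velocities have one orientation
(`IsOriented`). Tangent velocities at directions approaching from the left then force the
subgradient to be unique (`subgrad_unique`), so the sphere is `C¹`. A measurable choice of tangent
matrices, `π`-periodic by central symmetry, drives a point around the sphere (`exists_motion`).
Every Barabanov norm is constant along this closed motion, whence uniqueness. A half turn takes a
time `T`; a law of smaller period would give two solutions of one equation that both change sign
after `T`, against the decay of area caused by negative traces (`not_period`). Finally, every
extremal trajectory turns strictly forward and hence runs along the same curve
(`exists_polar_angle`). -/

lemma plane_decomp (v : Plane) : v = v 0 • ![1, 0] + v 1 • ![0, 1] := by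
  ext i; fin_cases i <;> simp

lemma seminorm_le_norm (f : Seminorm ℝ Plane) :
    ∀ v, f v ≤ (f ![1, 0] + f ![0, 1]) * ‖v‖ := by
  intro v
  calc f v = f (v 0 • ![1, 0] + v 1 • ![0, 1]) := by rw [← plane_decomp]
    _ ≤ f (v 0 • ![1, 0]) + f (v 1 • ![0, 1]) := map_add_le_add f _ _
    _ = ‖v 0‖ * f ![1, 0] + ‖v 1‖ * f ![0, 1] := by rw [map_smul_eq_mul, map_smul_eq_mul]
    _ ≤ ‖v‖ * f ![1, 0] + ‖v‖ * f ![0, 1] := by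
        have h0 := norm_le_pi_norm v 0
        have h1 := norm_le_pi_norm v 1
        have := apply_nonneg f ![1, 0]
        have := apply_nonneg f ![0, 1]
        gcongr
    _ = _ := by ring

lemma seminorm_sub_le (f : Seminorm ℝ Plane) (v w : Plane) :
    |f v - f w| ≤ (f ![1, 0] + f ![0, 1]) * ‖v - w‖ :=
  (abs_sub_map_le_sub f v w).trans (seminorm_le_norm f _)

lemma seminorm_continuous (f : Seminorm ℝ Plane) : Continuous f := by
  have : LipschitzWith (Real.toNNReal (f ![1, 0] + f ![0, 1])) f := by
    apply LipschitzWith.of_dist_le_mul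
    intro v w
    have h : 0 ≤ f ![1, 0] + f ![0, 1] := by positivity
    rw [Real.coe_toNNReal _ h, Real.dist_eq, dist_eq_norm]
    exact seminorm_sub_le f v w
  exact this.continuous

lemma seminorm_lower (f : Seminorm ℝ Plane) (hf : ∀ v, f v = 0 → v = 0) :
    ∃ c > 0, ∀ v, c * ‖v‖ ≤ f v := by
  have hne : (Metric.sphere (0 : Plane) 1).Nonempty := by
    refine ⟨fun _ => 1, ?_⟩
    simp
  obtain ⟨u, hu, hmin⟩ := (isCompact_sphere (0 : Plane) 1).exists_isMinOn hne
    (seminorm_continuous f).continuousOn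
  have hu1 : ‖u‖ = 1 := by simpa using hu
  have hpos : 0 < f u := by
    rcases (apply_nonneg f u).lt_or_eq with h | h
    · exact h
    · have := hf u h.symm
      rw [this] at hu1; simp at hu1
  refine ⟨f u, hpos, fun v => ?_⟩
  rcases eq_or_ne v 0 with rfl | hv
  · simp
  have hv' : 0 < ‖v‖ := norm_pos_iff.2 hv
  have h1 : f u ≤ f (‖v‖⁻¹ • v) := hmin (by simp [norm_smul, hv'.ne'])
  rw [map_smul_eq_mul, norm_inv, norm_norm] at h1
  calc f u * ‖v‖ ≤ ‖v‖⁻¹ * f v * ‖v‖ := by gcongr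
    _ = f v := by field_simp

/-- The subdifferential of a seminorm, functionals being represented by dot products. -/
def Subgrad (f : Seminorm ℝ Plane) (x : Plane) : Set Plane :=
  {p | p ⬝ᵥ x = f x ∧ ∀ v, p ⬝ᵥ v ≤ f v}

/-- Hahn–Banach: the functional `c • x ↦ c * f x` on the line through `x` is dominated by `f`; its
extension is recorded by the values on the basis vectors. -/
lemma subgrad_nonempty (f : Seminorm ℝ Plane) (x : Plane) : (Subgrad f x).Nonempty := by
  rcases eq_or_ne x 0 with rfl | hx
  · exact ⟨0, by simp, fun v => by simp⟩
  obtain ⟨g, hg, hgf⟩ := exists_extension_of_le_sublinear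
    (LinearPMap.mkSpanSingleton (K := ℝ) x (f x) hx) f
    (fun c hc v => by rw [map_smul_eq_mul, Real.norm_of_nonneg hc.le])
    (fun v w => map_add_le_add f v w) (by
      rintro ⟨v, hv⟩
      obtain ⟨c, rfl⟩ := Submodule.mem_span_singleton.1 hv
      rw [LinearPMap.mkSpanSingleton'_apply]
      rw [map_smul_eq_mul, smul_eq_mul]
      exact mul_le_mul_of_nonneg_right (le_abs_self c) (apply_nonneg f x))
  have hrep : ∀ v, ![g ![1, 0], g ![0, 1]] ⬝ᵥ v = g v := by
    intro v
    conv_rhs => rw [plane_decomp v, map_add, map_smul, map_smul]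
    simp [dotProduct, Fin.sum_univ_two, mul_comm]
  refine ⟨![g ![1, 0], g ![0, 1]], ?_, fun v => ?_⟩
  · rw [hrep]
    have h := hg ⟨x, Submodule.mem_span_singleton_self x⟩
    have h2 := LinearPMap.mkSpanSingleton_apply ℝ ℝ (σ := RingHom.id ℝ) hx (f x)
    simp only at h
    rw [h]
    exact h2
  · rw [hrep]; exact hgf v

/-- Closedness in both variables lets limits of tangent velocities be tangent velocities; the
compactness arguments on subgradients rest on it. -/
lemma isClosed_subgrad (f : Seminorm ℝ Plane) :
    IsClosed {q : Plane × Plane | q.2 ∈ Subgrad f q.1} := by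
  have hc := seminorm_continuous f
  have h1 : IsClosed {q : Plane × Plane | q.2 ⬝ᵥ q.1 = f q.1} :=
    isClosed_eq (by simp only [dotProduct]; fun_prop) (hc.comp continuous_fst)
  have h2 : IsClosed {q : Plane × Plane | ∀ v, q.2 ⬝ᵥ v ≤ f v} := by
    simp only [ofPred_forall]
    refine isClosed_iInter fun v => isClosed_le ?_ continuous_const
    simp only [dotProduct]; fun_prop
  exact h1.inter h2

/-- A common bound for all subgradients. -/
def subgradBound (f : Seminorm ℝ Plane) : ℝ := f ![1, 0] + f ![0, 1]

lemma subgradBound_nonneg (f : Seminorm ℝ Plane) : 0 ≤ subgradBound f := by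
  unfold subgradBound; positivity

lemma subgrad_norm_le {f : Seminorm ℝ Plane} {x p : Plane} (hp : p ∈ Subgrad f x) :
    p ∈ Metric.closedBall (0 : Plane) (subgradBound f) := by
  have h0 := hp.2 ![1, 0]
  have h1 := hp.2 ![0, 1]
  have h2 := hp.2 (-![1, 0])
  have h3 := hp.2 (-![0, 1])
  rw [map_neg_eq_map, dotProduct_neg] at h2 h3
  have := apply_nonneg f ![1, 0]
  have := apply_nonneg f ![0, 1]
  simp [dotProduct, Fin.sum_univ_two] at h0 h1 h2 h3
  rw [mem_closedBall_zero_iff, pi_norm_le_iff_of_nonneg (subgradBound_nonneg f)]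
  unfold subgradBound
  intro i
  rw [Real.norm_eq_abs, abs_le]
  fin_cases i <;> simp <;> constructor <;> linarith

lemma subgrad_smul {f : Seminorm ℝ Plane} {x p : Plane} {c : ℝ} (hc : 0 ≤ c)
    (hp : p ∈ Subgrad f x) : p ∈ Subgrad f (c • x) :=
  ⟨by rw [dotProduct_smul, hp.1, map_smul_eq_mul, Real.norm_of_nonneg hc, smul_eq_mul], hp.2⟩

lemma subgrad_neg {f : Seminorm ℝ Plane} {x p : Plane}
    (hp : p ∈ Subgrad f x) : -p ∈ Subgrad f (-x) :=
  ⟨by rw [neg_dotProduct_neg, hp.1, map_neg_eq_map],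
    fun v => by
      have := hp.2 (-v)
      rwa [map_neg_eq_map, dotProduct_neg, ← neg_dotProduct] at this⟩

/-- Subgradients and matrices from compact sets form a compact graph. -/
lemma isCompact_subgrad_graph (f : Seminorm ℝ Plane) {𝓑 : Set Mat} (hB : IsCompact 𝓑)
    {K : Set Plane} (hK : IsCompact K) :
    IsCompact {q : Plane × Plane × Mat | q.1 ∈ K ∧ q.2.1 ∈ Subgrad f q.1 ∧ q.2.2 ∈ 𝓑} := by
  have h := hK.prod ((isCompact_closedBall (0 : Plane) (subgradBound f)).prod hB)
  have h2 : IsClosed {q : Plane × Plane × Mat | q.2.1 ∈ Subgrad f q.1} :=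
    (isClosed_subgrad f).preimage
      (show Continuous fun q : Plane × Plane × Mat => (q.1, q.2.1) by fun_prop)
  convert h.inter_right h2 using 1
  ext ⟨x, p, B⟩
  simp only [mem_ofPred_eq, mem_inter_iff, mem_prod]
  constructor
  · rintro ⟨a, b, c⟩; exact ⟨⟨a, subgrad_norm_le b, c⟩, b⟩
  · rintro ⟨⟨a, -, c⟩, b⟩; exact ⟨a, b, c⟩

lemma continuous_pairing :
    Continuous fun q : Plane × Plane × Mat => q.2.1 ⬝ᵥ (q.2.2 *ᵥ q.1) := by
  simp only [dotProduct, Matrix.mulVec]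
  fun_prop


/-! ### Carathéodory solutions as Lipschitz curves with an almost everywhere derivative -/

/-- `z` is locally Lipschitz on `[0, ∞)` and solves `ż = B z` almost everywhere. -/
def IsFlow (B : ℝ → Mat) (z : ℝ → Plane) : Prop :=
  (∀ T : ℝ, ∃ K : ℝ≥0, LipschitzOnWith K z (Icc 0 T)) ∧
    ∀ᵐ t : ℝ, 0 < t → HasDerivAt z (B t *ᵥ z t) t

/-- Measurable matrix functions which are bounded on `[0, ∞)`. -/
def IsBddLaw (A : ℝ → Mat) : Prop :=
  (∀ i j, Measurable fun t => A t i j) ∧ ∃ M : ℝ, ∀ t, 0 ≤ t → ∀ i j, |A t i j| ≤ M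

/-- Entrywise bounds are convex constraints, so they pass from `𝒜` to its hull. -/
lemma isBounded_entries {𝒜 : Set Mat} (h : IsCompact 𝒜) :
    ∃ M : ℝ, 0 ≤ M ∧ ∀ A ∈ convexHull ℝ 𝒜, ∀ i j, |A i j| ≤ M := by
  have h1 : ∀ i j, ∃ M : ℝ, ∀ A ∈ 𝒜, |A i j| ≤ M := fun i j => by
    obtain ⟨M, hM⟩ := h.exists_bound_of_continuousOn (f := fun A : Mat => A i j)
      (by fun_prop)
    exact ⟨M, hM⟩
  choose M hM using h1
  refine ⟨∑ i, ∑ j, |M i j|, by positivity, ?_⟩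
  have hconv : Convex ℝ {A : Mat | ∀ i j, |A i j| ≤ ∑ i, ∑ j, |M i j|} := by
    intro A hA B hB a b ha hb hab i j
    simp only [Matrix.add_apply, Matrix.smul_apply, smul_eq_mul]
    calc |a * A i j + b * B i j| ≤ |a * A i j| + |b * B i j| := abs_add_le _ _
      _ = a * |A i j| + b * |B i j| := by rw [abs_mul, abs_mul, abs_of_nonneg ha, abs_of_nonneg hb]
      _ ≤ a * (∑ i, ∑ j, |M i j|) + b * (∑ i, ∑ j, |M i j|) := by
          gcongr
          · exact hA i j
          · exact hB i j
      _ = _ := by rw [← add_mul, hab, one_mul]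
  have hsub : 𝒜 ⊆ {A : Mat | ∀ i j, |A i j| ≤ ∑ i, ∑ j, |M i j|} := by
    intro A hA i j
    calc |A i j| ≤ M i j := hM i j A hA
      _ ≤ |M i j| := le_abs_self _
      _ ≤ ∑ j, |M i j| := Finset.single_le_sum (f := fun j => |M i j|)
          (fun _ _ => abs_nonneg _) (Finset.mem_univ j)
      _ ≤ _ := Finset.single_le_sum (f := fun i => ∑ j, |M i j|)
          (fun _ _ => by positivity) (Finset.mem_univ i)
  exact fun A hA => convexHull_min hsub hconv hA

lemma IsSwitchingLaw.isBddLaw {𝒜 : Set Mat} (h : IsCompact 𝒜) {A : ℝ → Mat}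
    (hA : IsSwitchingLaw (convexHull ℝ 𝒜) A) : IsBddLaw A := by
  obtain ⟨M, -, hM⟩ := isBounded_entries h
  exact ⟨hA.1, M, fun t ht => hM _ (hA.2 t ht)⟩

lemma norm_mulVec_le {A : Mat} {M : ℝ} (hA : ∀ i j, |A i j| ≤ M) (v : Plane) :
    ‖A *ᵥ v‖ ≤ 2 * M * ‖v‖ := by
  have hM : 0 ≤ M := (abs_nonneg _).trans (hA 0 0)
  rw [pi_norm_le_iff_of_nonneg (by positivity)]
  intro i
  simp only [Matrix.mulVec, dotProduct, Fin.sum_univ_two, Real.norm_eq_abs]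
  have h0 : |v 0| ≤ ‖v‖ := norm_le_pi_norm v 0
  have h1 : |v 1| ≤ ‖v‖ := norm_le_pi_norm v 1
  calc |A i 0 * v 0 + A i 1 * v 1| ≤ |A i 0 * v 0| + |A i 1 * v 1| := abs_add_le _ _
    _ = |A i 0| * |v 0| + |A i 1| * |v 1| := by rw [abs_mul, abs_mul]
    _ ≤ M * ‖v‖ + M * ‖v‖ := by
        gcongr
        · exact hA i 0
        · exact hA i 1
    _ = _ := by ring

lemma intervalIntegrable_law {A : ℝ → Mat} (hA : IsBddLaw A) {x : ℝ → Plane}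
    (hx : ContinuousOn x (Ici 0)) {T : ℝ} (hT : 0 ≤ T) :
    IntervalIntegrable (fun s => A s *ᵥ x s) volume 0 T := by
  obtain ⟨hm, M, hM⟩ := hA
  have hxT : ContinuousOn x (Icc 0 T) := hx.mono Icc_subset_Ici_self
  obtain ⟨R, hR⟩ := isCompact_Icc.exists_bound_of_continuousOn hxT
  rw [intervalIntegrable_iff_integrableOn_Icc_of_le hT]
  refine Integrable.of_bound (μ := volume.restrict (Icc 0 T)) ?_ (2 * M * R) ?_
  · have hxm : AEMeasurable x (volume.restrict (Icc 0 T)) := hxT.aemeasurable measurableSet_Icc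
    refine AEMeasurable.aestronglyMeasurable ?_
    rw [aemeasurable_pi_iff]
    intro i
    simp only [Matrix.mulVec, dotProduct, Fin.sum_univ_two]
    rw [aemeasurable_pi_iff] at hxm
    exact ((hm i 0).aemeasurable.mul (hxm 0)).add ((hm i 1).aemeasurable.mul (hxm 1))
  · refine (ae_restrict_iff' measurableSet_Icc).2 (Eventually.of_forall fun t ht => ?_)
    have hM0 : 0 ≤ M := (abs_nonneg _).trans (hM t ht.1 0 0)
    exact (norm_mulVec_le (hM t ht.1) _).trans
      (mul_le_mul_of_nonneg_left (hR t ht) (by positivity))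

/-- Almost everywhere derivatives allow pointwise work with seminorms, polar angles and changes of
time; `IsFlow.isSolution` is the way back. -/
lemma IsSolution.isFlow {A : ℝ → Mat} (hA : IsBddLaw A) {x : ℝ → Plane}
    (h : IsSolution A x) : IsFlow A x := by
  obtain ⟨hx, hint⟩ := h
  have hI : ∀ {T : ℝ}, 0 ≤ T → IntervalIntegrable (fun s => A s *ᵥ x s) volume 0 T :=
    fun hT => intervalIntegrable_law hA hx hT
  constructor
  · intro T
    obtain ⟨R, hR⟩ := isCompact_Icc.exists_bound_of_continuousOn
      (hx.mono (fun _ hs => hs.1 : Icc 0 T ⊆ Ici 0))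
    obtain ⟨M, hM⟩ := hA.2
    refine ⟨Real.toNNReal (2 * M * R), LipschitzOnWith.of_dist_le_mul fun s hs t ht => ?_⟩
    have hM0 : 0 ≤ M := (abs_nonneg _).trans (hM s hs.1 0 0)
    have hR0 : 0 ≤ R := (norm_nonneg _).trans (hR s hs)
    rw [Real.coe_toNNReal _ (by positivity), dist_eq_norm, hint s hs.1, hint t ht.1,
      add_sub_add_left_eq_sub, intervalIntegral.integral_interval_sub_left (hI hs.1) (hI ht.1),
      Real.dist_eq]
    refine intervalIntegral.norm_integral_le_of_norm_le_const fun u hu => ?_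
    have hu' : u ∈ Icc 0 T := by
      have := uIoc_subset_uIcc hu
      exact (uIcc_subset_Icc ht hs) this
    exact (norm_mulVec_le (hM u hu'.1) _).trans
      (mul_le_mul_of_nonneg_left (hR u hu') (by positivity))
  · have h1 : ∀ᵐ t : ℝ, ∀ n : ℕ, t ∈ uIcc (0 : ℝ) n → ∀ c ∈ uIcc (0 : ℝ) n,
        HasDerivAt (fun y => ∫ s in c..y, A s *ᵥ x s) (A t *ᵥ x t) t :=
      ae_all_iff.2 fun n => (hI (Nat.cast_nonneg n)).ae_hasDerivAt_integral
    filter_upwards [h1] with t ht htp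
    obtain ⟨n, hn⟩ := exists_nat_gt t
    have h2 := ht n (by rw [uIcc_of_le (by linarith)]; exact ⟨htp.le, hn.le⟩) 0 left_mem_uIcc
    refine (h2.const_add (x 0)).congr_of_eventuallyEq ?_
    filter_upwards [Ioi_mem_nhds htp] with s hs
    exact hint s (le_of_lt hs)

lemma IsFlow.continuousOn {B : ℝ → Mat} {z : ℝ → Plane} (h : IsFlow B z) :
    ContinuousOn z (Ici 0) := by
  intro t ht
  obtain ⟨K, hK⟩ := h.1 (t + 1)
  refine (hK.continuousOn t ⟨ht, by linarith⟩).mono_of_mem_nhdsWithin ?_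
  rw [← Ici_inter_Iic]
  exact inter_mem_nhdsWithin _ (Iic_mem_nhds (by linarith))

lemma LipschitzOnWith.coord {K : ℝ≥0} {z : ℝ → Plane} {s : Set ℝ} (h : LipschitzOnWith K z s)
    (i : Fin 2) : LipschitzOnWith K (fun t => z t i) s :=
  LipschitzOnWith.of_dist_le_mul fun a ha b hb =>
    (dist_le_pi_dist (z a) (z b) i).trans (h.dist_le_mul a ha b hb)

lemma IsFlow.integral_eq {B : ℝ → Mat} (hB : IsBddLaw B) {z : ℝ → Plane} (h : IsFlow B z) {t : ℝ}
    (ht : 0 ≤ t) : z t = z 0 + ∫ s in (0 : ℝ)..t, B s *ᵥ z s := by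
  have hI := intervalIntegrable_law hB h.continuousOn ht
  obtain ⟨K, hK⟩ := h.1 t
  ext i
  have hac : AbsolutelyContinuousOnInterval (fun s => z s i) 0 t := by
    apply LipschitzOnWith.absolutelyContinuousOnInterval (K := K)
    rw [uIcc_of_le ht]
    exact LipschitzOnWith.coord hK i
  have h1 := hac.integral_deriv_eq_sub
  have h2 : ∫ s in (0 : ℝ)..t, deriv (fun s => z s i) s = ∫ s in (0 : ℝ)..t, (B s *ᵥ z s) i := by
    apply intervalIntegral.integral_congr_ae
    filter_upwards [h.2] with s hs hs'
    rw [uIoc_of_le ht] at hs'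
    exact (hasDerivAt_pi.1 (hs hs'.1) i).deriv
  have h3 := (ContinuousLinearMap.proj (R := ℝ) (φ := fun _ : Fin 2 => ℝ) i).intervalIntegral_comp_comm hI
  simp only [ContinuousLinearMap.proj_apply] at h3
  rw [Pi.add_apply, ← h3, ← h2, h1]
  ring

lemma IsFlow.isSolution {B : ℝ → Mat} (hB : IsBddLaw B) {z : ℝ → Plane} (h : IsFlow B z) :
    IsSolution B z :=
  ⟨h.continuousOn, fun _ ht => h.integral_eq hB ht⟩

/-- Multiplication by `e^{-s t}` shifts the law by `s`. -/
lemma IsFlow.shift {A : ℝ → Mat} {x : ℝ → Plane} (h : IsFlow A x) (s : ℝ) :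
    IsFlow (fun t => A t - s • (1 : Mat)) (fun t => Real.exp (-s * t) • x t) := by
  constructor
  · intro T
    obtain ⟨K, hK⟩ := h.1 T
    have hsm : ContDiffOn ℝ 1 (fun t : ℝ => Real.exp (-s * t)) (Icc 0 T) := by fun_prop
    obtain ⟨K', hK'⟩ := hsm.exists_lipschitzOnWith (by decide) (convex_Icc _ _) isCompact_Icc
    obtain ⟨R, hR⟩ := isCompact_Icc.exists_bound_of_continuousOn
      (h.continuousOn.mono (fun _ hs => hs.1 : Icc 0 T ⊆ Ici 0))
    obtain ⟨R', hR'⟩ := isCompact_Icc.exists_bound_of_continuousOn hsm.continuousOn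
    refine ⟨Real.toNNReal (R' * K + K' * R), LipschitzOnWith.of_dist_le_mul fun a ha b hb => ?_⟩
    have hR0 : 0 ≤ R := (norm_nonneg _).trans (hR a ha)
    have hR0' : 0 ≤ R' := (norm_nonneg _).trans (hR' a ha)
    rw [Real.coe_toNNReal _ (by positivity), dist_eq_norm]
    have e : Real.exp (-s * a) • x a - Real.exp (-s * b) • x b
        = Real.exp (-s * a) • (x a - x b) + (Real.exp (-s * a) - Real.exp (-s * b)) • x b := by
      module
    rw [e]
    refine (norm_add_le _ _).trans ?_
    rw [norm_smul, norm_smul, add_mul]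
    refine add_le_add ?_ ?_
    · rw [mul_assoc, ← dist_eq_norm]
      exact mul_le_mul (hR' a ha) (hK.dist_le_mul a ha b hb) dist_nonneg hR0'
    · rw [mul_right_comm, ← dist_eq_norm]
      exact mul_le_mul (hK'.dist_le_mul a ha b hb) (hR b hb) (norm_nonneg _) (by positivity)
  · filter_upwards [h.2] with t ht htp
    have h1 : HasDerivAt (fun t : ℝ => Real.exp (-s * t)) (Real.exp (-s * t) * (-s)) t := by
      simpa using ((hasDerivAt_id t).const_mul (-s)).exp
    have h2 := h1.smul (ht htp)
    refine h2.congr_deriv ?_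
    rw [Matrix.sub_mulVec, Matrix.smul_mulVec, Matrix.one_mulVec, Matrix.mulVec_smul]
    module

/-! ### Seminorms along curves -/

lemma hasDerivAt_dot {z : ℝ → Plane} {v : Plane} {t : ℝ} (hz : HasDerivAt z v t) (p : Plane) :
    HasDerivAt (fun s => p ⬝ᵥ z s) (p ⬝ᵥ v) t := by
  simp only [dotProduct, Fin.sum_univ_two]
  exact ((hasDerivAt_pi.1 hz 0).const_mul _).add ((hasDerivAt_pi.1 hz 1).const_mul _)

/-- The function `f ∘ z - p ⬝ᵥ z` is minimal at time `t`. Thus `f` itself need not be differentiable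
at `z t`, and all subgradients give the same value. -/
lemma deriv_seminorm_comp {f : Seminorm ℝ Plane} {z : ℝ → Plane} {v : Plane} {t : ℝ}
    (hz : HasDerivAt z v t) (hf : DifferentiableAt ℝ (fun s => f (z s)) t) {p : Plane}
    (hp : p ∈ Subgrad f (z t)) : deriv (fun s => f (z s)) t = p ⬝ᵥ v := by
  have h1 := hf.hasDerivAt.sub (hasDerivAt_dot hz p)
  have hmin : IsLocalMin (fun s => f (z s) - p ⬝ᵥ z s) t := by
    refine Eventually.of_forall fun s => ?_
    simp only [hp.1, sub_self]
    linarith [hp.2 (z s)]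
  exact sub_eq_zero.1 (hmin.hasDerivAt_eq_zero h1)

/-- Near `t` the function `p ⬝ᵥ z` is bounded by the constant value of `f ∘ z`, which it attains at
`t`. Extremal motion is therefore tangent with respect to every subgradient. -/
lemma dot_eq_zero_of_const {f : Seminorm ℝ Plane} {z : ℝ → Plane} {v : Plane} {t : ℝ}
    (hz : HasDerivAt z v t) (hf : ∀ᶠ s in 𝓝 t, f (z s) = f (z t)) {p : Plane}
    (hp : p ∈ Subgrad f (z t)) : p ⬝ᵥ v = 0 := by
  have hmax : IsLocalMax (fun s => p ⬝ᵥ z s) t := by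
    filter_upwards [hf] with s hs
    rw [hp.1, ← hs]
    exact hp.2 _
  exact hmax.hasDerivAt_eq_zero (hasDerivAt_dot hz p)

lemma seminorm_descent {f : Seminorm ℝ Plane} {B : ℝ → Mat} {z : ℝ → Plane} (h : IsFlow B z)
    {a b ε : ℝ} (ha : 0 ≤ a) (hab : a ≤ b)
    (hd : ∀ᵐ t : ℝ, t ∈ Ioc a b → ∃ p ∈ Subgrad f (z t), p ⬝ᵥ (B t *ᵥ z t) ≤ -ε) :
    f (z b) ≤ f (z a) - ε * (b - a) := by
  obtain ⟨K, hK⟩ := h.1 b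
  have hac : AbsolutelyContinuousOnInterval (fun s => f (z s)) a b := by
    apply LipschitzOnWith.absolutelyContinuousOnInterval (K := Real.toNNReal (subgradBound f) * K)
    rw [uIcc_of_le hab]
    refine LipschitzOnWith.of_dist_le_mul fun s hs t ht => ?_
    have := hK.dist_le_mul s ⟨ha.trans hs.1, hs.2⟩ t ⟨ha.trans ht.1, ht.2⟩
    rw [NNReal.coe_mul, Real.coe_toNNReal _ (subgradBound_nonneg f), mul_assoc, Real.dist_eq]
    refine (seminorm_sub_le f _ _).trans ?_
    rw [← dist_eq_norm]
    exact mul_le_mul_of_nonneg_left this (subgradBound_nonneg f)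
  have h1 := hac.integral_deriv_eq_sub
  have h2 : ∫ s in a..b, deriv (fun s => f (z s)) s ≤ ∫ s in a..b, -ε := by
    apply intervalIntegral.integral_mono_ae_restrict hab hac.intervalIntegrable_deriv (by simp)
    rw [EventuallyLE, ae_restrict_iff' measurableSet_Icc]
    have hne : ∀ᵐ t : ℝ, t ≠ a := by simp [ae_iff]
    filter_upwards [h.2, hac.ae_differentiableAt, hd, hne] with t ht1 ht2 ht3 ht4 ht
    have hta : a < t := lt_of_le_of_ne ht.1 (Ne.symm ht4)
    obtain ⟨p, hp, hpB⟩ := ht3 ⟨hta, ht.2⟩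
    rw [deriv_seminorm_comp (ht1 (ha.trans_lt hta)) (ht2 (by rwa [uIcc_of_le hab])) hp]
    exact hpB
  rw [intervalIntegral.integral_const, smul_eq_mul] at h2
  linarith

lemma isFlow_of_hasDerivAt {B : ℝ → Mat} {z : ℝ → Plane} (hz : ContDiff ℝ 1 z)
    (h : ∀ t, HasDerivAt z (B t *ᵥ z t) t) : IsFlow B z := by
  refine ⟨fun T => ?_, Eventually.of_forall fun t _ => h t⟩
  exact hz.contDiffOn.exists_lipschitzOnWith (by decide) (convex_Icc _ _) isCompact_Icc


/-! ### Constant laws -/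

/-- A matrix as a continuous linear map of the plane. -/
noncomputable def toCLM (A : Mat) : Plane →L[ℝ] Plane :=
  LinearMap.toContinuousLinearMap (Matrix.mulVecLin A)

@[simp] lemma toCLM_apply (A : Mat) (x : Plane) : toCLM A x = A *ᵥ x := rfl

/-- The flow of the constant law `A`. -/
noncomputable def expFlow (A : Mat) (t : ℝ) : Plane →L[ℝ] Plane := NormedSpace.exp (t • toCLM A)

@[simp] lemma expFlow_zero (A : Mat) : expFlow A 0 = 1 := by
  simp [expFlow, NormedSpace.exp_zero]

lemma expFlow_add (A : Mat) (s t : ℝ) : expFlow A (s + t) = expFlow A s * expFlow A t := by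
  let +nondep : NormedAlgebra ℚ (Plane →L[ℝ] Plane) := .restrictScalars ℚ ℝ _
  rw [expFlow, add_smul, NormedSpace.exp_add_of_commute, expFlow, expFlow]
  exact ((Commute.refl (toCLM A)).smul_left s).smul_right t

lemma expFlow_hasDerivAt (A : Mat) (x : Plane) (t : ℝ) :
    HasDerivAt (fun t => expFlow A t x) (A *ᵥ expFlow A t x) t := by
  have h := hasDerivAt_exp_smul_const' (𝕂 := ℝ) (toCLM A) t
  exact (h.clm_apply (hasDerivAt_const t x)).congr_deriv (by simp [expFlow])

lemma expFlow_continuous (A : Mat) (x : Plane) : Continuous fun t => expFlow A t x :=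
  continuous_iff_continuousAt.2 fun t => (expFlow_hasDerivAt A x t).continuousAt

lemma expFlow_isFlow (A : Mat) (x : Plane) : IsFlow (fun _ => A) (fun t => expFlow A t x) := by
  refine isFlow_of_hasDerivAt ?_ fun t => expFlow_hasDerivAt A x t
  rw [contDiff_one_iff_deriv]
  refine ⟨fun t => (expFlow_hasDerivAt A x t).differentiableAt, ?_⟩
  have : deriv (fun t => expFlow A t x) = fun t => toCLM A (expFlow A t x) := by
    ext1 t; exact (expFlow_hasDerivAt A x t).deriv
  rw [this]
  exact (toCLM A).continuous.comp (expFlow_continuous A x)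

lemma expFlow_shift (A : Mat) (s t : ℝ) :
    expFlow (A - s • (1 : Mat)) t = Real.exp (-s * t) • expFlow A t := by
  have h1 : t • toCLM (A - s • (1 : Mat))
      = algebraMap ℝ (Plane →L[ℝ] Plane) (-s * t) + t • toCLM A := by
    ext1 x
    simp only [smul_apply, add_apply, toCLM_apply, Algebra.algebraMap_eq_smul_one,
      one_apply_eq_self, Matrix.sub_mulVec, Matrix.smul_mulVec, Matrix.one_mulVec]
    module
  let +nondep : NormedAlgebra ℚ (Plane →L[ℝ] Plane) := .restrictScalars ℚ ℝ _
  rw [expFlow, h1, NormedSpace.exp_add_of_commute (Algebra.commute_algebraMap_left _ _),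
    ← NormedSpace.algebraMap_exp_comm, ← Real.exp_eq_exp_ℝ, ← Algebra.smul_def, expFlow]

lemma expFlow_norm_le {A : Mat} {M : ℝ} (hA : ∀ i j, |A i j| ≤ M) (t : ℝ) (x : Plane) :
    ‖expFlow A t x‖ ≤ Real.exp (2 * M * |t|) * ‖x‖ := by
  -- The sign `e` reverses time, so that one Grönwall estimate also covers `t < 0`, where it bounds
  -- the forward flow from below.
  have key : ∀ e : ℝ, |e| = 1 → ∀ u, 0 ≤ u →
      ‖expFlow A (e * u) x‖ ≤ Real.exp (2 * M * u) * ‖x‖ := by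
    intro e he u hu
    have hd : ∀ v, HasDerivAt (fun v => expFlow A (e * v) x) (e • (A *ᵥ expFlow A (e * v) x)) v := by
      intro v
      have h1 : HasDerivAt (fun v => e * v) e v := by
        simpa using (hasDerivAt_id v).const_mul e
      exact (expFlow_hasDerivAt A x (e * v)).scomp v h1
    have := norm_le_gronwallBound_of_norm_deriv_right_le (f := fun v => expFlow A (e * v) x)
      (f' := fun v => e • (A *ᵥ expFlow A (e * v) x)) (δ := ‖x‖) (K := 2 * M) (ε := 0)
      (a := 0) (b := u) (fun v _ => (hd v).continuousAt.continuousWithinAt)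
      (fun v _ => (hd v).hasDerivWithinAt) (by simp)
      (fun v _ => by
        rw [norm_smul, Real.norm_eq_abs, he, one_mul, add_zero]
        exact norm_mulVec_le hA _) u ⟨hu, le_rfl⟩
    rwa [gronwallBound_ε0, sub_zero, mul_comm ‖x‖] at this
  rcases le_total 0 t with h | h
  · have := key 1 (by simp) t h
    rw [abs_of_nonneg h]
    rwa [one_mul] at this
  · have := key (-1) (by simp) (-t) (by linarith)
    rwa [neg_one_mul, neg_neg, ← abs_of_nonpos h] at this

/-! ### Growth rates of seminorms under constant laws -/

/-- The seminorm `N` grows at rate at most `s` under all constant laws from `𝒜`. -/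
def HasRate (𝒜 : Set Mat) (s : ℝ) (N : Seminorm ℝ Plane) : Prop :=
  ∀ A ∈ 𝒜, ∀ t, 0 ≤ t → ∀ x, N (expFlow A t x) ≤ Real.exp (s * t) * N x

lemma right_deriv_nonpos {g : ℝ → ℝ} {d : ℝ} (h : HasDerivAt g d 0)
    (hg : ∀ u, 0 ≤ u → g u ≤ g 0) : d ≤ 0 := by
  have h1 := h.tendsto_slope.mono_left (nhdsGT_le_nhdsNE (0 : ℝ))
  refine le_of_tendsto h1 ?_
  filter_upwards [self_mem_nhdsWithin] with u hu
  have hu' : (0 : ℝ) < u := hu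
  rw [slope_def_field, sub_zero]
  exact div_nonpos_of_nonpos_of_nonneg (by linarith [hg u hu'.le]) hu'.le

/-- The kernel of `N` is invariant under `𝒜`: flows started in it stay in it, and testing the
derivative at time `0` with a subgradient at `A *ᵥ v` gives `N (A *ᵥ v) ≤ 0`. Irreducibility leaves
only the trivial kernel. -/
lemma HasRate.definite {𝒜 : Set Mat} (hirr : IsIrreducible 𝒜) {s : ℝ} {N : Seminorm ℝ Plane}
    (h : HasRate 𝒜 s N) (hN : ∃ v, N v ≠ 0) : ∀ v, N v = 0 → v = 0 := by
  let W : Submodule ℝ Plane :=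
    { carrier := {v | N v = 0}
      zero_mem' := map_zero N
      add_mem' := fun {a b} ha hb => by
        have h1 := map_add_le_add N a b
        rw [show N a = 0 from ha, show N b = 0 from hb, add_zero] at h1
        exact le_antisymm h1 (apply_nonneg N _)
      smul_mem' := fun c v hv => by
        change N (c • v) = 0
        rw [map_smul_eq_mul, show N v = 0 from hv, mul_zero] }
  have hW : ∀ A ∈ 𝒜, ∀ v ∈ W, A.mulVec v ∈ W := by
    intro A hA v hv
    have hv0 : N v = 0 := hv
    obtain ⟨p, hp⟩ := subgrad_nonempty N (A *ᵥ v)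
    have hle : ∀ u, 0 ≤ u → p ⬝ᵥ expFlow A u v ≤ p ⬝ᵥ expFlow A 0 v := by
      intro u hu
      have h1 := (hp.2 (expFlow A u v)).trans (h A hA u hu v)
      have h2 := hp.2 (-v)
      have h3 := hp.2 v
      rw [map_neg_eq_map, hv0, dotProduct_neg] at h2
      rw [hv0] at h3
      rw [hv0, mul_zero] at h1
      rw [expFlow_zero, one_apply_eq_self]
      linarith
    have hd := right_deriv_nonpos (hasDerivAt_dot (expFlow_hasDerivAt A v 0) p) hle
    rw [expFlow_zero, one_apply_eq_self, hp.1] at hd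
    exact le_antisymm hd (apply_nonneg N _)
  rcases hirr W hW with h1 | h1
  · intro v hv
    have : v ∈ W := hv
    rwa [h1, Submodule.mem_bot] at this
  · obtain ⟨v, hv⟩ := hN
    have : v ∈ W := by rw [h1]; trivial
    exact absurd this hv

/-- The right derivative at `u = 0` of `p ⬝ᵥ expFlow B u x ≤ exp (s * u) * f x`, where equality
holds at `u = 0`. -/
lemma HasRate.subgrad_le {𝓑 : Set Mat} {f : Seminorm ℝ Plane} {s : ℝ} (h : HasRate 𝓑 s f) {B : Mat}
    (hB : B ∈ 𝓑) {x p : Plane} (hp : p ∈ Subgrad f x) : p ⬝ᵥ (B *ᵥ x) ≤ s * f x := by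
  have h1 := hasDerivAt_dot (expFlow_hasDerivAt B x 0) p
  have h2 : HasDerivAt (fun u => Real.exp (s * u) * f x) (s * f x) 0 := by
    have : HasDerivAt (fun u => Real.exp (s * u)) (Real.exp (s * 0) * s) 0 := by
      simpa using ((hasDerivAt_id (0 : ℝ)).const_mul s).exp
    simpa using this.mul_const (f x)
  have h3 := right_deriv_nonpos (h1.sub h2) (fun u hu => by
    have h4 := (hp.2 (expFlow B u x)).trans (h B hB u hu x)
    have h5 := hp.1
    simp only [Pi.sub_apply, expFlow_zero, one_apply_eq_self, mul_zero, Real.exp_zero,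
      one_mul]
    linarith)
  rw [expFlow_zero, one_apply_eq_self] at h3
  linarith

lemma exists_seminorm_of_tendsto {ι : Type*} {l : Filter ι} [l.NeBot] {N : ι → Seminorm ℝ Plane}
    {g : Plane → ℝ} (h : ∀ v, Tendsto (fun n => N n v) l (𝓝 (g v))) :
    ∃ f : Seminorm ℝ Plane, ∀ v, f v = g v := by
  refine ⟨Seminorm.of g ?_ ?_, fun v => rfl⟩
  · intro x y
    exact le_of_tendsto_of_tendsto' (h (x + y)) ((h x).add (h y)) fun n => map_add_le_add _ _ _
  · intro a x
    refine tendsto_nhds_unique (h (a • x)) ?_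
    simp only [map_smul_eq_mul]
    exact (h x).const_mul _

/-- Rates do not change under scaling, and the normalization bounds the seminorm by `‖·‖` while
preventing limits from vanishing. -/
lemma exists_normalized {𝒜 : Set Mat} {s : ℝ} {N : Seminorm ℝ Plane} (h : HasRate 𝒜 s N)
    (hN : ∃ v, N v ≠ 0) : ∃ N' : Seminorm ℝ Plane, HasRate 𝒜 s N' ∧ N' ![1, 0] + N' ![0, 1] = 1 := by
  obtain ⟨v, hv⟩ := hN
  have hpos : 0 < N ![1, 0] + N ![0, 1] := by
    have h1 := seminorm_le_norm N v
    have h2 : 0 < N v := lt_of_le_of_ne (apply_nonneg N v) (Ne.symm hv)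
    by_contra hc
    have := mul_nonpos_of_nonpos_of_nonneg (not_lt.1 hc) (norm_nonneg v)
    linarith
  set c := (N ![1, 0] + N ![0, 1])⁻¹ with hc
  have hcp : 0 < c := inv_pos.2 hpos
  have happ : ∀ x, (c.toNNReal • N) x = c * N x := fun x => by
    change (c.toNNReal : ℝ) * N x = _
    rw [Real.coe_toNNReal _ hcp.le]
  refine ⟨c.toNNReal • N, fun A hA t ht x => ?_, ?_⟩
  · rw [happ, happ, mul_left_comm]
    exact mul_le_mul_of_nonneg_left (h A hA t ht x) hcp.le
  · rw [happ, happ, ← mul_add, hc, inv_mul_cancel₀ hpos.ne']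

/-- The smallest growth rate of a norm is attained. -/
lemma exists_minimal_rate {𝒜 : Set Mat} (hc : IsCompact 𝒜) (hirr : IsIrreducible 𝒜)
    (hne : 𝒜.Nonempty) :
    ∃ (ρ : ℝ) (N : Seminorm ℝ Plane), (∃ v, N v ≠ 0) ∧ HasRate 𝒜 ρ N ∧
      ∀ s < ρ, ∀ N' : Seminorm ℝ Plane, HasRate 𝒜 s N' → ∀ v, N' v = 0 := by
  obtain ⟨M, hM0, hM'⟩ := isBounded_entries hc
  have hM : ∀ A ∈ 𝒜, ∀ i j, |A i j| ≤ M := fun A hA => hM' A (subset_convexHull ℝ 𝒜 hA)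
  set R : Set ℝ := {s | ∃ N : Seminorm ℝ Plane, HasRate 𝒜 s N ∧ N ![1, 0] + N ![0, 1] = 1} with hR
  have hRne : R.Nonempty := by
    refine ⟨2 * M, exists_normalized (N := normSeminorm ℝ Plane) ?_ ⟨![1, 0], ?_⟩⟩
    · intro A hA t ht x
      have := expFlow_norm_le (hM A hA) t x
      rwa [abs_of_nonneg ht] at this
    · rw [coe_normSeminorm, norm_ne_zero_iff]
      intro h
      have := congrFun h 0
      simp at this
  have hRbdd : BddBelow R := by
    refine ⟨-(2 * M), ?_⟩
    rintro s ⟨N, hN, hN1⟩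
    have hN0 : ∃ v, N v ≠ 0 := by
      by_contra! h
      rw [h, h] at hN1; norm_num at hN1
    obtain ⟨c, hcp, hcN⟩ := seminorm_lower N (hN.definite hirr hN0)
    obtain ⟨A, hA⟩ := hne
    by_contra! hlt
    -- Running the flow of `A` backwards shows that it contracts at most like `exp (-2 * M * t)`; a
    -- rate below `-(2 * M)` would force the positive constant `c` to be at most `0`.
    have hb : ∀ t : ℝ, 0 ≤ t → c ≤ Real.exp ((2 * M + s) * t) := by
      intro t ht
      have h1 : ‖(![1, 0] : Plane)‖ ≤ Real.exp (2 * M * t) * ‖expFlow A t ![1, 0]‖ := by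
        have := expFlow_norm_le (hM A hA) (-t) (expFlow A t ![1, 0])
        rwa [← mul_apply_eq_comp, ← expFlow_add, neg_add_cancel, expFlow_zero,
          one_apply_eq_self, abs_neg, abs_of_nonneg ht] at this
      have h2 := hN A hA t ht ![1, 0]
      have h3 := hcN (expFlow A t ![1, 0])
      have h4 : N ![1, 0] ≤ 1 := by linarith [apply_nonneg N ![0, 1]]
      have h5 : (1 : ℝ) ≤ ‖(![1, 0] : Plane)‖ := by
        simpa using norm_le_pi_norm (![1, 0] : Plane) 0
      rw [add_mul, Real.exp_add]
      have e1 := Real.exp_pos (2 * M * t)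
      have e2 := Real.exp_pos (s * t)
      calc c ≤ c * ‖(![1, 0] : Plane)‖ := by nlinarith
        _ ≤ c * (Real.exp (2 * M * t) * ‖expFlow A t ![1, 0]‖) := by gcongr
        _ = Real.exp (2 * M * t) * (c * ‖expFlow A t ![1, 0]‖) := by ring
        _ ≤ Real.exp (2 * M * t) * (Real.exp (s * t) * 1) := by
            exact mul_le_mul_of_nonneg_left
              (h3.trans (h2.trans (mul_le_mul_of_nonneg_left h4 e2.le))) e1.le
        _ = _ := by ring
    have hlim : Tendsto (fun t : ℝ => Real.exp ((2 * M + s) * t)) atTop (𝓝 0) :=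
      Real.tendsto_exp_atBot.comp
        (tendsto_id.const_mul_atTop_of_neg (by linarith))
    have := ge_of_tendsto hlim ((eventually_ge_atTop 0).mono fun t ht => hb t ht)
    linarith
  obtain ⟨s, -, hs, hsR⟩ := exists_seq_tendsto_sInf hRne hRbdd
  choose N hNrate hN1 using hsR
  have hbd : ∀ n v, N n v ∈ Icc 0 ‖v‖ := fun n v => by
    refine ⟨apply_nonneg _ _, ?_⟩
    have := seminorm_le_norm (N n) v
    rwa [hN1, one_mul] at this
  -- Along a nonprincipal ultrafilter the bounded values converge for all `v` simultaneously, and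
  -- the normalization survives in the limit.
  have hlim : ∀ v, ∃ a, Tendsto (fun n => N n v) (hyperfilter ℕ : Filter ℕ) (𝓝 a) := by
    intro v
    obtain ⟨a, -, ha⟩ := (isCompact_Icc (a := (0 : ℝ)) (b := ‖v‖)).ultrafilter_le_nhds
      ((hyperfilter ℕ).map fun n => N n v)
      (le_principal_iff.2 (Eventually.of_forall (f := (hyperfilter ℕ : Filter ℕ)) fun n => hbd n v))
    exact ⟨a, ha⟩
  choose g hg using hlim
  obtain ⟨f, hf⟩ := exists_seminorm_of_tendsto hg
  have hs' : Tendsto s (hyperfilter ℕ : Filter ℕ) (𝓝 (sInf R)) := hs.mono_left Nat.hyperfilter_le_atTop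
  refine ⟨sInf R, f, ?_, ?_, ?_⟩
  · by_contra! h
    have h1 := (hg ![1, 0]).add (hg ![0, 1])
    simp only [hN1] at h1
    have h2 := tendsto_nhds_unique h1 tendsto_const_nhds
    rw [← hf, ← hf, h, h] at h2
    norm_num at h2
  · intro A hA t ht x
    rw [hf, hf]
    refine le_of_tendsto_of_tendsto' (hg _) ?_ fun n => hNrate n A hA t ht x
    exact ((Real.continuous_exp.tendsto _).comp (hs'.mul_const t)).mul (hg x)
  · intro r hr N' hN' 
    by_contra! hcon
    have : r ∈ R := exists_normalized hN' hcon
    exact absurd (csInf_le hRbdd this) (not_le.2 hr)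


/-! ### Suprema of seminorms along families of linear maps -/

/-- The supremum of `N ∘ X` over a nonempty family of linear maps, dominated by `C * N`. -/
noncomputable def supSeminorm (N : Seminorm ℝ Plane) (𝒳 : Set (Plane →L[ℝ] Plane)) (C : ℝ)
    (hne : 𝒳.Nonempty) (h : ∀ X ∈ 𝒳, ∀ x, N (X x) ≤ C * N x) : Seminorm ℝ Plane :=
  have hb : ∀ x, BddAbove ((fun X : Plane →L[ℝ] Plane => N (X x)) '' 𝒳) := fun x =>
    ⟨C * N x, by rintro _ ⟨X, hX, rfl⟩; exact h X hX x⟩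
  Seminorm.of (fun x => sSup ((fun X : Plane →L[ℝ] Plane => N (X x)) '' 𝒳))
    (fun x y => csSup_le (hne.image _) (by
      rintro _ ⟨X, hX, rfl⟩
      simp only [map_add]
      exact (map_add_le_add N _ _).trans (add_le_add (le_csSup (hb x) ⟨X, hX, rfl⟩)
        (le_csSup (hb y) ⟨X, hX, rfl⟩))))
    (fun a x => by
      rw [← smul_eq_mul, ← Real.sSup_smul_of_nonneg (norm_nonneg a), ← image_smul, image_image]
      congr 1
      ext r
      simp only [map_smul, map_smul_eq_mul, smul_eq_mul])

lemma le_supSeminorm {N : Seminorm ℝ Plane} {𝒳 : Set (Plane →L[ℝ] Plane)} {C : ℝ}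
    (hne : 𝒳.Nonempty) (h : ∀ X ∈ 𝒳, ∀ x, N (X x) ≤ C * N x) {X : Plane →L[ℝ] Plane} (hX : X ∈ 𝒳)
    (x : Plane) : N (X x) ≤ supSeminorm N 𝒳 C hne h x :=
  le_csSup ⟨C * N x, by rintro _ ⟨X, hX, rfl⟩; exact h X hX x⟩ ⟨X, hX, rfl⟩

lemma supSeminorm_le {N : Seminorm ℝ Plane} {𝒳 : Set (Plane →L[ℝ] Plane)} {C : ℝ}
    (hne : 𝒳.Nonempty) (h : ∀ X ∈ 𝒳, ∀ x, N (X x) ≤ C * N x) {x : Plane} {a : ℝ}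
    (ha : ∀ X ∈ 𝒳, N (X x) ≤ a) : supSeminorm N 𝒳 C hne h x ≤ a :=
  csSup_le (hne.image _) (by rintro _ ⟨X, hX, rfl⟩; exact ha X hX)

lemma exists_lt_of_lt_supSeminorm {N : Seminorm ℝ Plane} {𝒳 : Set (Plane →L[ℝ] Plane)} {C : ℝ}
    (hne : 𝒳.Nonempty) (h : ∀ X ∈ 𝒳, ∀ x, N (X x) ≤ C * N x) {x : Plane} {a : ℝ}
    (ha : a < supSeminorm N 𝒳 C hne h x) : ∃ X ∈ 𝒳, a < N (X x) := by
  obtain ⟨_, ⟨X, hX, rfl⟩, hlt⟩ := exists_lt_of_lt_csSup (hne.image _) ha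
  exact ⟨X, hX, hlt⟩

/-! ### The semigroup of piecewise constant laws -/

/-- `X` is the transition map over a time interval of length `t` of a piecewise constant law. -/
inductive Reach (𝓑 : Set Mat) : ℝ → (Plane →L[ℝ] Plane) → Prop
  | one : Reach 𝓑 0 1
  | step {t s : ℝ} {X : Plane →L[ℝ] Plane} {B : Mat} :
      Reach 𝓑 t X → B ∈ 𝓑 → 0 ≤ s → Reach 𝓑 (s + t) (expFlow B s * X)

variable {𝓑 : Set Mat}

lemma Reach.nonneg {t : ℝ} {X : Plane →L[ℝ] Plane} (h : Reach 𝓑 t X) : 0 ≤ t := by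
  induction h with
  | one => exact le_rfl
  | step _ _ hs ih => linarith

lemma Reach.single {B : Mat} (hB : B ∈ 𝓑) {s : ℝ} (hs : 0 ≤ s) : Reach 𝓑 s (expFlow B s) := by
  simpa using Reach.step Reach.one hB hs

lemma Reach.comp {s t : ℝ} {X Y : Plane →L[ℝ] Plane} (hY : Reach 𝓑 s Y) (hX : Reach 𝓑 t X) :
    Reach 𝓑 (s + t) (Y * X) := by
  induction hY with
  | one => simpa using hX
  | step _ hB hs ih => rw [add_assoc, mul_assoc]; exact Reach.step ih hB hs

lemma Reach.split {r : ℝ} {Z : Plane →L[ℝ] Plane} (h : Reach 𝓑 r Z) :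
    ∀ s t : ℝ, 0 ≤ s → 0 ≤ t → s + t = r →
      ∃ Y X, Reach 𝓑 s Y ∧ Reach 𝓑 t X ∧ Z = Y * X := by
  induction h with
  | one =>
    intro s t hs ht hst
    have hs0 : s = 0 := by linarith
    have ht0 : t = 0 := by linarith
    subst hs0 ht0
    exact ⟨1, 1, Reach.one, Reach.one, by simp⟩
  | @step t' s' X B hX hB hs' ih =>
    intro s t hs ht hst
    rcases le_total t t' with hle | hle
    · obtain ⟨Y0, X0, hY0, hX0, rfl⟩ := ih (t' - t) t (by linarith) ht (by ring)
      refine ⟨expFlow B s' * Y0, X0, ?_, hX0, by rw [mul_assoc]⟩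
      have := Reach.step hY0 hB hs'
      rwa [show s' + (t' - t) = s by linarith] at this
    · refine ⟨expFlow B s, expFlow B (t - t') * X, Reach.single hB hs, ?_, ?_⟩
      · have := Reach.step hX hB (show 0 ≤ t - t' by linarith)
        rwa [sub_add_cancel] at this
      · rw [← mul_assoc, ← expFlow_add, show s + (t - t') = s' by linarith]

lemma Reach.seminorm_le {N : Seminorm ℝ Plane} (hN : HasRate 𝓑 0 N) {t : ℝ}
    {X : Plane →L[ℝ] Plane} (h : Reach 𝓑 t X) (x : Plane) : N (X x) ≤ N x := by
  induction h with
  | one => simp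
  | step _ hB hs ih =>
    have := hN _ hB _ hs
    simp only [zero_mul, Real.exp_zero, one_mul] at this
    exact (this _).trans ih

/-- Boundedness of the semigroup and its continuity at time zero. -/
lemma Reach.bounds (hc : IsCompact 𝓑) {N : Seminorm ℝ Plane} (hN : HasRate 𝓑 0 N)
    (hdef : ∀ v, N v = 0 → v = 0) :
    ∃ C : ℝ, 0 ≤ C ∧ ∀ t X, Reach 𝓑 t X → ∀ x, ‖X x‖ ≤ C * ‖x‖ ∧ ‖X x - x‖ ≤ C * ‖x‖ * t := by
  obtain ⟨c, hcp, hcN⟩ := seminorm_lower N hdef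
  obtain ⟨M, hM0, hM'⟩ := isBounded_entries hc
  have hM : ∀ A ∈ 𝓑, ∀ i j, |A i j| ≤ M := fun A hA => hM' A (subset_convexHull ℝ 𝓑 hA)
  set K := subgradBound N / c with hK
  have hK0 : 0 ≤ K := div_nonneg (subgradBound_nonneg N) hcp.le
  have hb : ∀ t X, Reach 𝓑 t X → ∀ x, ‖X x‖ ≤ K * ‖x‖ := by
    intro t X hX x
    rw [hK, div_mul_eq_mul_div, le_div_iff₀ hcp, mul_comm]
    exact (hcN _).trans ((hX.seminorm_le hN x).trans (seminorm_le_norm N x))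
  have hd : ∀ t X, Reach 𝓑 t X → ∀ x, ‖X x - x‖ ≤ 2 * M * K * ‖x‖ * t := by
    intro t X hX
    induction hX with
    | one => simp
    | @step t' s X B hX hB hs ih =>
      intro x
      have h1 : ‖expFlow B s (X x) - expFlow B 0 (X x)‖ ≤ 2 * M * (K * ‖x‖) * (s - 0) := by
        refine norm_image_sub_le_of_norm_deriv_le_segment'
          (f := fun u => expFlow B u (X x)) (f' := fun u => B *ᵥ expFlow B u (X x))
          (fun u _ => (expFlow_hasDerivAt B (X x) u).hasDerivWithinAt) ?_ s ⟨hs, le_rfl⟩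
        intro u hu
        refine (norm_mulVec_le (hM B hB) _).trans ?_
        gcongr
        exact hb _ _ (Reach.step hX hB hu.1) x
      rw [expFlow_zero, one_apply_eq_self, sub_zero] at h1
      have h2 := ih x
      calc ‖(expFlow B s * X) x - x‖ = ‖(expFlow B s (X x) - X x) + (X x - x)‖ := by
            rw [mul_apply_eq_comp]; simp
        _ ≤ _ := (norm_add_le _ _).trans (add_le_add h1 h2)
        _ = _ := by ring
  refine ⟨max K (2 * M * K), le_max_of_le_left hK0, fun t X hX x => ⟨?_, ?_⟩⟩
  · exact (hb t X hX x).trans (by gcongr; exact le_max_left _ _)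
  · have := hX.nonneg
    exact (hd t X hX x).trans (by gcongr; exact le_max_right _ _)

/-- If no seminorm decays exponentially, then no invariant norm is contracted over a period. -/
lemma no_contraction {N : Seminorm ℝ Plane} (hN : HasRate 𝓑 0 N)
    (hmin : ∀ s < 0, ∀ N' : Seminorm ℝ Plane, HasRate 𝓑 s N' → ∀ v, N' v = 0) {n : ℕ} (hn1 : 1 ≤ n)
    (hn : ∀ X, Reach 𝓑 n X → ∀ x, N (X x) ≤ 1 / 2 * N x) (v : Plane) : N v = 0 := by
  have hn0 : (0 : ℝ) < n := by exact_mod_cast hn1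
  have hpow : ∀ k : ℕ, ∀ t X, Reach 𝓑 t X → k * (n : ℝ) ≤ t →
      ∀ x, N (X x) ≤ (1 / 2) ^ k * N x := by
    intro k
    induction k with
    | zero => intro t X hX _ x; simpa using hX.seminorm_le hN x
    | succ k ih =>
      intro t X hX ht x
      push_cast at ht
      have hk : 0 ≤ (k : ℝ) * n := by positivity
      obtain ⟨Y, X', hY, hX', rfl⟩ := hX.split n (t - n) hn0.le (by nlinarith) (by ring)
      have h1 := hn Y hY (X' x)
      have h2 := ih _ _ hX' (by linarith) x
      rw [mul_apply_eq_comp, pow_succ]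
      linarith
  -- Since `exp (ε * n) = 2`, transitions of length `t` stay bounded when weighted by `exp (ε * t)`.
  -- The supremum of `N` over the weighted family has rate `-ε < 0`, so it vanishes by `hmin`, and
  -- it dominates `N`.
  set ε := Real.log 2 / n with hε
  have hεp : 0 < ε := div_pos (Real.log_pos (by norm_num)) hn0
  set 𝒳 : Set (Plane →L[ℝ] Plane) := {Z | ∃ t X, Reach 𝓑 t X ∧ Z = Real.exp (ε * t) • X} with h𝒳
  have h𝒳ne : 𝒳.Nonempty := ⟨_, 0, 1, Reach.one, rfl⟩
  have h𝒳le : ∀ Z ∈ 𝒳, ∀ x, N (Z x) ≤ 2 * N x := by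
    rintro _ ⟨t, X, hX, rfl⟩ x
    have ht := hX.nonneg
    have hk1 := Nat.floor_le (div_nonneg ht hn0.le)
    have hk2 := Nat.lt_floor_add_one (t / n)
    set k := ⌊t / n⌋₊
    have h1 := hpow k t X hX (by rwa [le_div_iff₀ hn0] at hk1) x
    rw [smul_apply, map_smul_eq_mul, Real.norm_of_nonneg (Real.exp_pos _).le]
    have h2 : Real.exp (ε * t) ≤ 2 ^ (k + 1) := by
      rw [← Real.exp_log (show (0 : ℝ) < 2 ^ (k + 1) by positivity), Real.exp_le_exp, Real.log_pow,
        hε, div_mul_eq_mul_div, mul_div_assoc, mul_comm]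
      have := Real.log_pos (show (1 : ℝ) < 2 by norm_num)
      gcongr
      push_cast; exact hk2.le
    calc Real.exp (ε * t) * N (X x) ≤ 2 ^ (k + 1) * ((1 / 2) ^ k * N x) := by gcongr
      _ = 2 * N x * (2 * (1 / 2)) ^ k := by rw [mul_pow, pow_succ]; ring
      _ = 2 * N x := by norm_num
  have hrate : HasRate 𝓑 (-ε) (supSeminorm N 𝒳 2 h𝒳ne h𝒳le) := by
    intro B hB t ht x
    refine supSeminorm_le _ _ ?_
    rintro _ ⟨τ, X, hX, rfl⟩
    have h1 : Real.exp (ε * (τ + t)) • (X * expFlow B t) ∈ 𝒳 :=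
      ⟨τ + t, _, Reach.comp hX (Reach.single hB ht), rfl⟩
    have h2 := le_supSeminorm h𝒳ne h𝒳le h1 x
    rw [smul_apply, map_smul_eq_mul, Real.norm_of_nonneg (Real.exp_pos _).le] at h2 ⊢
    rw [mul_add, Real.exp_add, mul_apply_eq_comp] at h2
    have e1 : Real.exp (-ε * t) * Real.exp (ε * t) = 1 := by
      rw [← Real.exp_add]; simp
    calc Real.exp (ε * τ) * N (X (expFlow B t x))
        = Real.exp (-ε * t) * (Real.exp (ε * τ) * Real.exp (ε * t) * N (X (expFlow B t x))) := by
          linear_combination (-(Real.exp (ε * τ) * N (X (expFlow B t x)))) * e1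
      _ ≤ _ := mul_le_mul_of_nonneg_left h2 (Real.exp_pos _).le
  have h3 := hmin (-ε) (by linarith) _ hrate v
  have h4 : (1 : Plane →L[ℝ] Plane) ∈ 𝒳 := ⟨0, 1, Reach.one, by simp⟩
  have h5 := le_supSeminorm h𝒳ne h𝒳le h4 v
  rw [h3, one_apply_eq_self] at h5
  exact le_antisymm h5 (apply_nonneg _ _)

/-- If no seminorm decays exponentially, then the limit of the transition suprema of an invariant
norm is a norm which is preserved by some transition over any time interval. -/
lemma exists_preserved_norm (hirr : IsIrreducible 𝓑) (hne : 𝓑.Nonempty)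
    {N : Seminorm ℝ Plane} (hN : HasRate 𝓑 0 N) (hdef : ∀ v, N v = 0 → v = 0)
    (hmin : ∀ s < 0, ∀ N' : Seminorm ℝ Plane, HasRate 𝓑 s N' → ∀ v, N' v = 0) :
    ∃ f : Seminorm ℝ Plane, (∀ v, f v = 0 → v = 0) ∧ HasRate 𝓑 0 f ∧
      ∀ t, 0 ≤ t → t ≤ 1 → ∀ x, ∃ y ∈ closure ((fun X : Plane →L[ℝ] Plane => X x) '' {X | Reach 𝓑 t X}),
        f x ≤ f y := by
  obtain ⟨B₀, hB₀⟩ := hne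
  have hRne : ∀ t, 0 ≤ t → {X | Reach 𝓑 t X}.Nonempty := fun t ht => ⟨_, Reach.single hB₀ ht⟩
  have hle : ∀ t, ∀ X ∈ {X | Reach 𝓑 t X}, ∀ x, N (X x) ≤ 1 * N x := fun t X hX x => by
    rw [one_mul]; exact Reach.seminorm_le hN hX x
  -- `F t` is the most that `N` can retain after time `t`; it decreases in `t` because the last
  -- stretch of a transition can only lower `N`.
  set F : ℝ≥0 → Seminorm ℝ Plane := fun t =>
    supSeminorm N {X | Reach 𝓑 t X} 1 (hRne t t.2) (hle t) with hF
  have hFle : ∀ (t : ℝ≥0) {X : Plane →L[ℝ] Plane}, Reach 𝓑 t X → ∀ x, N (X x) ≤ F t x :=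
    fun t X hX x => le_supSeminorm (hRne t t.2) (hle t) hX x
  have hFanti : ∀ (s t : ℝ≥0) x, F (s + t) x ≤ F t x := by
    intro s t x
    refine supSeminorm_le _ _ fun Z hZ => ?_
    obtain ⟨Y, X, hY, hX, rfl⟩ := Reach.split hZ s t s.2 t.2 (by simp)
    exact (hY.seminorm_le hN _).trans (hFle t hX x)
  have hFN : ∀ t x, F t x ≤ N x := fun t x =>
    supSeminorm_le _ _ fun X hX => Reach.seminorm_le hN hX x
  have hFmono : ∀ x, Antitone fun n : ℕ => F n x := fun x => antitone_nat_of_succ_le fun n => by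
    have := hFanti 1 n x
    rwa [add_comm, ← Nat.cast_succ] at this
  have hlim : ∀ x, Tendsto (fun n : ℕ => F n x) atTop (𝓝 (⨅ n : ℕ, F n x)) := fun x =>
    tendsto_atTop_ciInf (hFmono x) ⟨0, by rintro _ ⟨n, rfl⟩; exact apply_nonneg _ _⟩
  obtain ⟨f, hf⟩ := exists_seminorm_of_tendsto hlim
  replace hlim : ∀ x, Tendsto (fun n : ℕ => F n x) atTop (𝓝 (f x)) := fun x => by
    rw [hf]; exact hlim x
  have hfle : ∀ (n : ℕ) x, f x ≤ F n x := fun n x => (hFmono x).le_of_tendsto (hlim x) n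
  have hfrate : HasRate 𝓑 0 f := by
    intro B hB t ht x
    rw [zero_mul, Real.exp_zero, one_mul]
    refine le_of_tendsto_of_tendsto' (hlim _) (hlim x) fun n => ?_
    lift t to ℝ≥0 using ht
    have ht := t.2
    refine (supSeminorm_le _ _ fun X hX => ?_ : F n (expFlow B t x) ≤ F (t + n) x).trans
      (hFanti _ _ x)
    have h1 : Reach 𝓑 ((t + n : ℝ≥0) : ℝ) (X * expFlow B t) := by
      have := Reach.comp hX (Reach.single hB ht)
      rw [add_comm] at this
      simpa using this
    exact hFle _ h1 x
  obtain ⟨c, hcp, hcN⟩ := seminorm_lower N hdef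
  have hf0 : ∃ v, f v ≠ 0 := by
    by_contra! hzero
    -- all transitions over a suitable time contract by the factor one half
    obtain ⟨n, hn1, hn⟩ : ∃ n : ℕ, 1 ≤ n ∧ ∀ x, F n x ≤ 1 / 2 * N x := by
      have h1 := (hlim ![1, 0]).add (hlim ![0, 1])
      rw [hzero, hzero, add_zero] at h1
      obtain ⟨n, hn, hn1⟩ := ((h1.eventually (gt_mem_nhds (show 0 < c / 2 by positivity))).and
        (eventually_ge_atTop 1)).exists
      refine ⟨n, hn1, fun x => ?_⟩
      calc F n x ≤ (F n ![1, 0] + F n ![0, 1]) * ‖x‖ := seminorm_le_norm _ x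
        _ ≤ c / 2 * ‖x‖ := by gcongr
        _ = 1 / 2 * (c * ‖x‖) := by ring
        _ ≤ _ := by gcongr; exact hcN x
    have h3 := no_contraction hN hmin hn1 (fun X hX x =>
      (hFle n (by simpa using hX) x).trans (hn x)) ![1, 0]
    have h6 := congrFun (hdef _ h3) 0
    simp at h6
  refine ⟨f, hfrate.definite hirr hf0, hfrate, ?_⟩
  intro t ht ht1 x
  lift t to ℝ≥0 using ht
  have ht := t.2
  -- A nearly optimal transition of length `n + t` is cut after time `t`: its first piece must leave
  -- almost all of `f x` to be retained for a further time `n`. The bound `t ≤ 1` gives `f x ≤ F (n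
  -- + 1) x ≤ F (n + t) x`.
  have hsel : ∀ n : ℕ, ∃ X, Reach 𝓑 t X ∧ f x - 1 / ((n : ℝ) + 1) ≤ F n (X x) := by
    intro n
    have h1 : f x - 1 / ((n : ℝ) + 1) < F ((n : ℝ≥0) + t) x := by
      have h2 : f x ≤ F ((n + 1 : ℕ) : ℝ≥0) x := hfle (n + 1) x
      have h3 : F ((n + 1 : ℕ) : ℝ≥0) x ≤ F ((n : ℝ≥0) + t) x := by
        have h4 := hFanti (1 - t) ((n : ℝ≥0) + t) x
        have h5 : (1 - t) + ((n : ℝ≥0) + t) = ((n + 1 : ℕ) : ℝ≥0) := by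
          have h6 : t ≤ 1 := by exact_mod_cast ht1
          rw [add_left_comm, tsub_add_cancel_of_le h6, Nat.cast_add, Nat.cast_one]
        rwa [h5] at h4
      have : 0 < 1 / ((n : ℝ) + 1) := by positivity
      linarith
    obtain ⟨Z, hZ, hlt⟩ := exists_lt_of_lt_supSeminorm _ _ h1
    obtain ⟨Y, X, hY, hX, rfl⟩ := Reach.split hZ n t (Nat.cast_nonneg n) ht (by simp)
    exact ⟨X, hX, hlt.le.trans (hFle n (by simpa using hY) (X x))⟩
  choose X hX hXn using hsel
  have hbd : ∀ n, X n x ∈ Metric.closedBall (0 : Plane) (N x / c) := by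
    intro n
    rw [mem_closedBall_zero_iff, le_div_iff₀ hcp, mul_comm]
    exact (hcN _).trans ((hX n).seminorm_le hN x)
  obtain ⟨y, -, φ, hφ, hy⟩ := (isCompact_closedBall _ _).tendsto_subseq hbd
  refine ⟨y, mem_closure_of_tendsto hy (Eventually.of_forall fun n => ⟨X (φ n), hX _, rfl⟩), ?_⟩
  -- With `m` fixed, `F m ≥ F n` for `n ≥ m`, so the lower bounds pass to the limit point `y` before
  -- `m` tends to infinity.
  refine ge_of_tendsto' (hlim y) fun m => ?_
  have h1 : Tendsto (fun n => F m (X (φ n) x)) atTop (𝓝 (F m y)) :=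
    ((seminorm_continuous _).tendsto y).comp hy
  have h2 : Tendsto (fun n : ℕ => f x - 1 / ((φ n : ℝ) + 1)) atTop (𝓝 (f x - 0)) :=
    tendsto_const_nhds.sub (tendsto_one_div_add_atTop_nhds_zero_nat.comp hφ.tendsto_atTop)
  rw [sub_zero] at h2
  refine le_of_tendsto_of_tendsto h2 h1 ?_
  filter_upwards [eventually_ge_atTop m] with n hn
  exact (hXn (φ n)).trans (hFmono _ (hn.trans (hφ.id_le n)))

/-- Near a point at which all velocities strictly decrease `f`, they do so uniformly. -/
lemma exists_uniform_decrease (hc : IsCompact 𝓑) {f : Seminorm ℝ Plane} {x : Plane}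
    (h : ∀ B ∈ 𝓑, ∀ p ∈ Subgrad f x, p ⬝ᵥ (B *ᵥ x) < 0) :
    ∃ r > 0, ∃ ε > 0, ∀ y, ‖y - x‖ < r → ∀ B ∈ 𝓑, ∀ p ∈ Subgrad f y, p ⬝ᵥ (B *ᵥ y) ≤ -ε := by
  have h1 : ∃ ε > 0, ∀ B ∈ 𝓑, ∀ p ∈ Subgrad f x, p ⬝ᵥ (B *ᵥ x) < -ε := by
    have hK := isCompact_subgrad_graph f hc (isCompact_singleton (x := x))
    rcases eq_empty_or_nonempty
      {q : Plane × Plane × Mat | q.1 ∈ ({x} : Set Plane) ∧ q.2.1 ∈ Subgrad f q.1 ∧ q.2.2 ∈ 𝓑}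
      with he | hne
    · refine ⟨1, one_pos, fun B hB p hp => ?_⟩
      have : (x, p, B) ∈ (∅ : Set (Plane × Plane × Mat)) := by rw [← he]; exact ⟨rfl, hp, hB⟩
      exact absurd this (notMem_empty _)
    · obtain ⟨⟨x', p', B'⟩, ⟨hx', hp', hB'⟩, hmax⟩ :=
        hK.exists_isMaxOn hne continuous_pairing.continuousOn
      simp only [mem_singleton_iff] at hx' hp' hB'
      subst hx'
      have h2 := h B' hB' p' hp'
      refine ⟨-(p' ⬝ᵥ (B' *ᵥ x')) / 2, by linarith, fun B hB p hp => ?_⟩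
      have h3 : p ⬝ᵥ (B *ᵥ x') ≤ p' ⬝ᵥ (B' *ᵥ x') :=
        hmax (show (x', p, B) ∈ _ from ⟨rfl, hp, hB⟩)
      linarith
  obtain ⟨ε, hε, h1⟩ := h1
  have hG := isCompact_subgrad_graph f hc (isCompact_closedBall x 1)
  -- The points near `x` where some pairing is at least `-ε` form the projection of a compact set,
  -- and `x` lies in its open complement.
  have hG2 : IsClosed ((fun q : Plane × Plane × Mat => q.1) ''
      ({q : Plane × Plane × Mat | q.1 ∈ Metric.closedBall x 1 ∧ q.2.1 ∈ Subgrad f q.1 ∧ q.2.2 ∈ 𝓑} ∩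
        {q | -ε ≤ q.2.1 ⬝ᵥ (q.2.2 *ᵥ q.1)})) :=
    ((hG.inter_right (isClosed_le continuous_const continuous_pairing)).image
      continuous_fst).isClosed
  have hx : x ∈ ((fun q : Plane × Plane × Mat => q.1) ''
      ({q : Plane × Plane × Mat | q.1 ∈ Metric.closedBall x 1 ∧ q.2.1 ∈ Subgrad f q.1 ∧ q.2.2 ∈ 𝓑} ∩
        {q | -ε ≤ q.2.1 ⬝ᵥ (q.2.2 *ᵥ q.1)}))ᶜ := by
    rintro ⟨⟨x', p, B⟩, ⟨⟨-, hp, hB⟩, hle⟩, rfl⟩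
    exact absurd (h1 B hB p hp) (not_lt.2 hle)
  obtain ⟨r, hr, hball⟩ := Metric.isOpen_iff.1 hG2.isOpen_compl x hx
  refine ⟨min r 1, lt_min hr one_pos, ε, hε, fun y hy B hB p hp => ?_⟩
  by_contra! hlt
  refine hball (show y ∈ Metric.ball x r by
    rw [mem_ball_iff_norm]; exact hy.trans_le (min_le_left _ _)) ⟨(y, p, B), ⟨⟨?_, hp, hB⟩, hlt.le⟩, rfl⟩
  rw [mem_closedBall_iff_norm]
  exact hy.le.trans (min_le_right _ _)

/-- If all velocities at `x` were strictly decreasing, they would be uniformly so near `x`. Every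
transition over a short time `t₀` would then lower `f x` by `ε * t₀`, against the preservation
property of `exists_preserved_norm`. -/
lemma exists_norm_with_tangent_velocity (hc : IsCompact 𝓑) (hirr : IsIrreducible 𝓑)
    (hne : 𝓑.Nonempty) {N : Seminorm ℝ Plane} (hN : HasRate 𝓑 0 N) (hdef : ∀ v, N v = 0 → v = 0)
    (hmin : ∀ s < 0, ∀ N' : Seminorm ℝ Plane, HasRate 𝓑 s N' → ∀ v, N' v = 0) :
    ∃ f : Seminorm ℝ Plane, (∀ v, f v = 0 → v = 0) ∧
      (∀ x, ∀ B ∈ 𝓑, ∀ p ∈ Subgrad f x, p ⬝ᵥ (B *ᵥ x) ≤ 0) ∧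
      ∀ x, ∃ B ∈ 𝓑, ∃ p ∈ Subgrad f x, p ⬝ᵥ (B *ᵥ x) = 0 := by
  obtain ⟨f, hfdef, hfrate, hpres⟩ := exists_preserved_norm hirr hne hN hdef hmin
  have hle : ∀ x, ∀ B ∈ 𝓑, ∀ p ∈ Subgrad f x, p ⬝ᵥ (B *ᵥ x) ≤ 0 := fun x B hB p hp => by
    have := hfrate.subgrad_le hB hp
    rwa [zero_mul] at this
  refine ⟨f, hfdef, hle, fun x => ?_⟩
  by_contra! hcon
  obtain ⟨r, hr, ε, hε, hdec⟩ := exists_uniform_decrease hc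
    (fun B hB p hp => lt_of_le_of_ne (hle x B hB p hp) (hcon B hB p hp))
  obtain ⟨C, hC0, hC⟩ := Reach.bounds hc hN hdef
  -- Transitions of length at most `t₀` move `x` by at most `C * ‖x‖ * t₀ < r`; the summand `1`
  -- avoids division by zero, and the factor `2` yields strictness.
  set t₀ := min 1 (r / (2 * (C * ‖x‖ + 1))) with ht₀
  have hCx : 0 < C * ‖x‖ + 1 := by positivity
  have ht₀p : 0 < t₀ := lt_min one_pos (by positivity)
  have hnear : ∀ t X, Reach 𝓑 t X → t ≤ t₀ → ‖X x - x‖ < r := by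
    intro t X hX ht
    have h1 := (hC t X hX x).2
    have h2 : t ≤ r / (2 * (C * ‖x‖ + 1)) := ht.trans (min_le_right _ _)
    rw [le_div_iff₀ (by positivity)] at h2
    have := hX.nonneg
    nlinarith
  have hdesc : ∀ t X, Reach 𝓑 t X → t ≤ t₀ → f (X x) ≤ f x - ε * t := by
    intro t X hX
    induction hX with
    | one => intro _; simp
    | @step t' s X B hX hB hs ih =>
      intro ht
      have h1 := ih (by linarith)
      have h2 := seminorm_descent (f := f) (ε := ε) (expFlow_isFlow B (X x)) le_rfl hs
        (Eventually.of_forall fun u hu => by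
          obtain ⟨p, hp⟩ := subgrad_nonempty f (expFlow B u (X x))
          exact ⟨p, hp, hdec _ (hnear _ _ (Reach.step hX hB hu.1.le) (by linarith [hu.2])) B hB p hp⟩)
      rw [expFlow_zero, one_apply_eq_self] at h2
      rw [mul_apply_eq_comp]
      linarith
  obtain ⟨y, hy, hfy⟩ := hpres t₀ ht₀p.le (min_le_left _ _) x
  have : f y ≤ f x - ε * t₀ := by
    refine closure_minimal (t := {y | f y ≤ f x - ε * t₀}) ?_
      (isClosed_le (seminorm_continuous f) continuous_const) hy
    rintro _ ⟨X, hX, rfl⟩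
    exact hdesc t₀ X hX le_rfl
  have := mul_pos hε ht₀p
  linarith


/-! ### Translating the control set -/

/-- The control set `𝒜 - s I`. -/
def shiftSet (𝒜 : Set Mat) (s : ℝ) : Set Mat := (fun A => A - s • (1 : Mat)) '' 𝒜

lemma mem_shiftSet {𝒜 : Set Mat} {s : ℝ} {B : Mat} :
    B ∈ shiftSet 𝒜 s ↔ B + s • (1 : Mat) ∈ 𝒜 := by
  constructor
  · rintro ⟨A, hA, rfl⟩; simpa using hA
  · intro h; exact ⟨_, h, by simp⟩

lemma isCompact_shiftSet {𝒜 : Set Mat} (h : IsCompact 𝒜) (s : ℝ) : IsCompact (shiftSet 𝒜 s) :=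
  h.image (by fun_prop)

lemma mem_convexHull_shiftSet {𝒜 : Set Mat} {s : ℝ} {B : Mat} :
    B ∈ convexHull ℝ (shiftSet 𝒜 s) ↔ B + s • (1 : Mat) ∈ convexHull ℝ 𝒜 := by
  have key : ∀ (𝒞 : Set Mat) (D : Mat), Convex ℝ {A : Mat | A + D ∈ convexHull ℝ 𝒞} := by
    intro 𝒞 D A hA B hB a b ha hb hab
    have := convex_convexHull ℝ 𝒞 hA hB ha hb hab
    have e : a • (A + D) + b • (B + D) = a • A + b • B + D := by
      rw [smul_add, smul_add, add_add_add_comm, ← add_smul, hab, one_smul]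
    rwa [e] at this
  constructor
  · intro h
    refine convexHull_min (t := {A : Mat | A + s • (1 : Mat) ∈ convexHull ℝ 𝒜}) ?_ (key _ _) h
    intro A hA
    exact subset_convexHull ℝ 𝒜 (mem_shiftSet.1 hA)
  · intro h
    have : B + s • (1 : Mat) ∈ {A : Mat | A + -(s • (1 : Mat)) ∈ convexHull ℝ (shiftSet 𝒜 s)} := by
      refine convexHull_min ?_ (key _ _) h
      intro A hA
      exact subset_convexHull ℝ _ ⟨A, hA, sub_eq_add_neg _ _⟩
    simpa using this

lemma IsIrreducible.shiftSet {𝒜 : Set Mat} (h : IsIrreducible 𝒜) (s : ℝ) :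
    IsIrreducible (shiftSet 𝒜 s) := by
  intro W hW
  refine h W fun A hA v hv => ?_
  have h1 := hW _ ⟨A, hA, rfl⟩ v hv
  have h2 := W.add_mem h1 (W.smul_mem s hv)
  rw [Matrix.sub_mulVec, Matrix.smul_mulVec, Matrix.one_mulVec, sub_add_cancel] at h2
  exact h2

lemma IsIrreducible.nonempty {𝒜 : Set Mat} (h : IsIrreducible 𝒜) : 𝒜.Nonempty := by
  by_contra hne
  rw [not_nonempty_iff_eq_empty] at hne
  subst hne
  rcases h (Submodule.span ℝ {![1, 0]}) (by simp) with h1 | h1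
  · rw [Submodule.span_singleton_eq_bot] at h1
    have := congrFun h1 0
    simp at this
  · have : (![0, 1] : Plane) ∈ Submodule.span ℝ {![1, 0]} := by rw [h1]; trivial
    obtain ⟨c, hc⟩ := Submodule.mem_span_singleton.1 this
    have := congrFun hc 1
    simp at this

lemma HasRate.shiftSet_iff {𝒜 : Set Mat} {s r : ℝ} {N : Seminorm ℝ Plane} :
    HasRate (shiftSet 𝒜 s) r N ↔ HasRate 𝒜 (r + s) N := by
  have key : ∀ (A : Mat) (t : ℝ) (x : Plane), N (expFlow (A - s • (1 : Mat)) t x)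
      = Real.exp (-s * t) * N (expFlow A t x) := fun A t x => by
    rw [expFlow_shift, smul_apply, map_smul_eq_mul, Real.norm_of_nonneg (Real.exp_pos _).le]
  have e : ∀ t : ℝ, Real.exp ((r + s) * t) = Real.exp (s * t) * Real.exp (r * t) := fun t => by
    rw [← Real.exp_add]; ring_nf
  have e2 : ∀ t : ℝ, Real.exp (s * t) * Real.exp (-s * t) = 1 := fun t => by
    rw [← Real.exp_add]; simp
  constructor
  · intro h A hA t ht x
    have h1 := h _ ⟨A, hA, rfl⟩ t ht x
    simp only [key] at h1
    have h2 := mul_le_mul_of_nonneg_left h1 (Real.exp_pos (s * t)).le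
    rwa [← mul_assoc, e2, one_mul, ← mul_assoc, ← e] at h2
  · rintro h _ ⟨A, hA, rfl⟩ t ht x
    have h1 := h A hA t ht x
    simp only [key]
    have h2 := mul_le_mul_of_nonneg_left h1 (Real.exp_pos (-s * t)).le
    rw [e, ← mul_assoc, ← mul_assoc, mul_comm (Real.exp (-s * t)) (Real.exp (s * t)), e2, one_mul] at h2
    exact h2

/-! ### Growth along trajectories -/

lemma convexHull_pairing_le {𝓑 : Set Mat} {x p : Plane} (h : ∀ B ∈ 𝓑, p ⬝ᵥ (B *ᵥ x) ≤ 0) :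
    ∀ B ∈ convexHull ℝ 𝓑, p ⬝ᵥ (B *ᵥ x) ≤ 0 := by
  refine fun B hB => convexHull_min (t := {B : Mat | p ⬝ᵥ (B *ᵥ x) ≤ 0}) h ?_ hB
  intro A hA B hB a b ha hb hab
  have hA' : p ⬝ᵥ (A *ᵥ x) ≤ 0 := hA
  have hB' : p ⬝ᵥ (B *ᵥ x) ≤ 0 := hB
  change p ⬝ᵥ ((a • A + b • B) *ᵥ x) ≤ 0
  rw [Matrix.add_mulVec, Matrix.smul_mulVec, Matrix.smul_mulVec, dotProduct_add, dotProduct_smul,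
    dotProduct_smul, smul_eq_mul, smul_eq_mul]
  nlinarith

/-- `f` does not increase in the directions of the velocities from `𝓑`. -/
def IsInvariantFor (𝓑 : Set Mat) (f : Seminorm ℝ Plane) : Prop :=
  ∀ x, ∀ B ∈ 𝓑, ∀ p ∈ Subgrad f x, p ⬝ᵥ (B *ᵥ x) ≤ 0

lemma IsInvariantFor.hull {𝓑 : Set Mat} {f : Seminorm ℝ Plane} (h : IsInvariantFor 𝓑 f) :
    IsInvariantFor (convexHull ℝ 𝓑) f :=
  fun x B hB p hp => convexHull_pairing_le (fun B hB => h x B hB p hp) B hB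

lemma IsInvariantFor.antitone {𝓑 : Set Mat} {f : Seminorm ℝ Plane} (h : IsInvariantFor 𝓑 f)
    {B : ℝ → Mat} {z : ℝ → Plane} (hz : IsFlow B z) (hB : ∀ t, 0 ≤ t → B t ∈ convexHull ℝ 𝓑) :
    AntitoneOn (fun t => f (z t)) (Ici 0) := by
  intro a ha b hb hab
  have := seminorm_descent (f := f) (ε := 0) hz ha hab (Eventually.of_forall fun t ht => by
    obtain ⟨p, hp⟩ := subgrad_nonempty f (z t)
    exact ⟨p, hp, by rw [neg_zero]; exact h.hull _ _ (hB t (ha.trans ht.1.le)) p hp⟩)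
  simpa using this

/-- The trajectories of `co 𝒜`, after removing the factor `e^{s t}`, are flows of `co (𝒜 - s I)`. -/
lemma IsTrajectory.shift_flow {𝒜 : Set Mat} (hc : IsCompact 𝒜) {x : ℝ → Plane}
    (h : IsTrajectory (convexHull ℝ 𝒜) x) (s : ℝ) :
    ∃ B : ℝ → Mat, (∀ t, 0 ≤ t → B t ∈ convexHull ℝ (shiftSet 𝒜 s)) ∧
      IsFlow B (fun t => Real.exp (-s * t) • x t) := by
  obtain ⟨A, hA, hx⟩ := h
  refine ⟨fun t => A t - s • (1 : Mat), fun t ht => ?_, (hx.isFlow (hA.isBddLaw hc)).shift s⟩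
  rw [mem_convexHull_shiftSet, sub_add_cancel]
  exact hA.2 t ht

lemma IsTrajectory.mono {𝒜 : Set Mat} {x : ℝ → Plane} (h : IsTrajectory 𝒜 x) :
    IsTrajectory (convexHull ℝ 𝒜) x := by
  obtain ⟨A, hA, hx⟩ := h
  exact ⟨A, ⟨hA.1, fun t ht => subset_convexHull ℝ 𝒜 (hA.2 t ht)⟩, hx⟩

lemma seminorm_exp_smul (f : Seminorm ℝ Plane) (a : ℝ) (x : Plane) :
    f (Real.exp a • x) = Real.exp a * f x := by
  rw [map_smul_eq_mul, Real.norm_of_nonneg (Real.exp_pos _).le]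

lemma le_exp_mul_of_exp_neg_mul_le {a b c : ℝ} (h : Real.exp (-a) * b ≤ c) : b ≤ Real.exp a * c := by
  have := mul_le_mul_of_nonneg_left h (Real.exp_pos a).le
  rwa [← mul_assoc, ← Real.exp_add, add_neg_cancel, Real.exp_zero, one_mul] at this

lemma IsInvariantFor.growth {𝒜 : Set Mat} (hc : IsCompact 𝒜) {s : ℝ} {f : Seminorm ℝ Plane}
    (h : IsInvariantFor (shiftSet 𝒜 s) f) {x : ℝ → Plane} (hx : IsTrajectory (convexHull ℝ 𝒜) x)
    {t : ℝ} (ht : 0 ≤ t) : f (x t) ≤ Real.exp (s * t) * f (x 0) := by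
  obtain ⟨B, hB, hz⟩ := hx.shift_flow hc s
  have h1 := h.antitone hz hB (mem_Ici.2 le_rfl) ht ht
  simp only [seminorm_exp_smul, mul_zero, Real.exp_zero, one_smul, neg_mul] at h1
  exact le_exp_mul_of_exp_neg_mul_le h1

/-! ### Trajectories of laws which are constant on the cells of a grid -/

/-- The remainder of an Euler step, uniform over matrices with bounded entries; it controls the
sampled feedback law in `lyapunovExponent_eq`. -/
lemma expFlow_second_order {M : ℝ} (hM : 0 ≤ M) : ∃ C : ℝ, 0 ≤ C ∧ ∀ A : Mat, (∀ i j, |A i j| ≤ M) →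
    ∀ δ, 0 ≤ δ → δ ≤ 1 → ∀ x, ‖expFlow A δ x - x - δ • (A *ᵥ x)‖ ≤ C * ‖x‖ * δ ^ 2 := by
  set K := Real.exp (2 * M) with hK
  refine ⟨2 * M * (2 * M * K), by positivity, fun A hA δ hδ hδ1 x => ?_⟩
  have h1 : ∀ u, 0 ≤ u → u ≤ 1 → ‖expFlow A u x - x‖ ≤ 2 * M * K * ‖x‖ * u := by
    intro u hu hu1
    have := norm_image_sub_le_of_norm_deriv_le_segment'
      (f := fun u => expFlow A u x) (f' := fun u => A *ᵥ expFlow A u x) (a := 0) (b := u)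
      (C := 2 * M * (K * ‖x‖))
      (fun u _ => (expFlow_hasDerivAt A x u).hasDerivWithinAt) (fun v hv => by
        refine (norm_mulVec_le hA _).trans ?_
        refine mul_le_mul_of_nonneg_left ((expFlow_norm_le hA v x).trans ?_) (by positivity)
        refine mul_le_mul_of_nonneg_right ?_ (norm_nonneg _)
        rw [hK, Real.exp_le_exp, abs_of_nonneg hv.1]
        have : v ≤ 1 := hv.2.le.trans hu1
        nlinarith) u ⟨hu, le_rfl⟩
    simp only [expFlow_zero, one_apply_eq_self, sub_zero] at this
    linarith
  have h2 := norm_image_sub_le_of_norm_deriv_le_segment'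
    (f := fun u => expFlow A u x - u • (A *ᵥ x)) (f' := fun u => A *ᵥ expFlow A u x - A *ᵥ x)
    (a := 0) (b := δ) (C := 2 * M * (2 * M * K * ‖x‖ * δ))
    (fun u _ => by
      have h3 : HasDerivAt (fun u : ℝ => u • (A *ᵥ x)) (A *ᵥ x) u := by
        simpa using (hasDerivAt_id u).smul_const (A *ᵥ x)
      exact ((expFlow_hasDerivAt A x u).sub h3).hasDerivWithinAt) (fun v hv => by
      rw [← Matrix.mulVec_sub]
      refine (norm_mulVec_le hA _).trans ?_
      refine mul_le_mul_of_nonneg_left ((h1 v hv.1 (hv.2.le.trans hδ1)).trans ?_) (by positivity)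
      exact mul_le_mul_of_nonneg_left hv.2.le (by positivity)) δ ⟨hδ, le_rfl⟩
  simp only [expFlow_zero, one_apply_eq_self, zero_smul, sub_zero] at h2
  calc ‖expFlow A δ x - x - δ • (A *ᵥ x)‖ = ‖expFlow A δ x - δ • (A *ᵥ x) - x‖ := by
        rw [sub_right_comm]
    _ ≤ _ := h2
    _ = _ := by ring

/-- A feedback law sampled at the multiples of `δ` generates a trajectory. -/
lemma exists_grid_trajectory {𝒜 : Set Mat} (sel : Plane → Mat) (hsel : ∀ x, sel x ∈ 𝒜) {δ : ℝ}
    (hδ : 0 < δ) (X : ℕ → Plane) (hX : ∀ k, X (k + 1) = expFlow (sel (X k)) δ (X k)) :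
    ∃ x, IsTrajectory 𝒜 x ∧ ∀ k : ℕ, x (k * δ) = X k := by
  set A : ℝ → Mat := fun t => sel (X ⌊t / δ⌋₊) with hA
  set x : ℝ → Plane := fun t => expFlow (A t) (t - ⌊t / δ⌋₊ * δ) (X ⌊t / δ⌋₊) with hx
  have hfl : ∀ (k : ℕ) t, k * δ ≤ t → t < (k + 1) * δ → ⌊t / δ⌋₊ = k := by
    intro k t h1 h2
    rw [Nat.floor_eq_iff (div_nonneg ((by positivity : (0 : ℝ) ≤ k * δ).trans h1) hδ.le),
      le_div_iff₀ hδ, div_lt_iff₀ hδ]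
    exact ⟨h1, h2⟩
  have hxk : ∀ k : ℕ, x (k * δ) = X k := by
    intro k
    simp only [hx]
    rw [hfl k (k * δ) le_rfl (by nlinarith), sub_self, expFlow_zero, one_apply_eq_self]
  have hxt : ∀ (k : ℕ) t, k * δ ≤ t → t ≤ (k + 1) * δ →
      x t = expFlow (sel (X k)) (t - k * δ) (X k) := by
    intro k t h1 h2
    rcases h2.lt_or_eq with h2 | h2
    · simp only [hx, hA]
      rw [hfl k t h1 h2]
    · have := hxk (k + 1)
      rw [h2]
      push_cast at this
      rw [this, hX, show (k + 1) * δ - k * δ = δ by ring]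
  have hpiece : ∀ (k : ℕ) t, k * δ ≤ t → t ≤ (k + 1) * δ →
      IntervalIntegrable (fun s => A s *ᵥ x s) volume (k * δ) t ∧
        ∫ s in (k * δ)..t, A s *ᵥ x s = x t - x (k * δ) := by
    intro k t h1 h2
    have hcont : Continuous fun s => sel (X k) *ᵥ expFlow (sel (X k)) (s - k * δ) (X k) :=
      (toCLM (sel (X k))).continuous.comp
        ((expFlow_continuous (sel (X k)) (X k)).comp (by fun_prop))
    have hae : ∀ᵐ s : ℝ, s ∈ uIoc (k * δ) t →
        sel (X k) *ᵥ expFlow (sel (X k)) (s - k * δ) (X k) = A s *ᵥ x s := by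
      have hne : ∀ᵐ s : ℝ, s ≠ (k + 1) * δ := by simp [ae_iff]
      filter_upwards [hne] with s hs hs'
      rw [uIoc_of_le h1] at hs'
      have h3 : s < (k + 1) * δ := lt_of_le_of_ne (hs'.2.trans h2) hs
      rw [hxt k s hs'.1.le h3.le]
      simp only [hA]
      rw [hfl k s hs'.1.le h3]
    refine ⟨(hcont.intervalIntegrable _ _).congr_ae
      ((ae_restrict_iff' measurableSet_uIoc).2 hae), ?_⟩
    rw [← intervalIntegral.integral_congr_ae hae, hxt k t h1 h2, hxk k]
    rw [intervalIntegral.integral_eq_sub_of_hasDerivAt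
      (f := fun s => expFlow (sel (X k)) (s - k * δ) (X k)) (fun s _ =>
        (expFlow_hasDerivAt (sel (X k)) (X k) (s - k * δ)).comp_sub_const s (k * δ))
      (hcont.intervalIntegrable _ _)]
    rw [sub_self, expFlow_zero, one_apply_eq_self]
  have hgrid : ∀ k : ℕ, IntervalIntegrable (fun s => A s *ᵥ x s) volume 0 (k * δ) ∧
      ∫ s in (0 : ℝ)..(k * δ), A s *ᵥ x s = x (k * δ) - x 0 := by
    intro k
    induction k with
    | zero => simp
    | succ k ih =>
      have hp := hpiece k ((k + 1) * δ) (by nlinarith) le_rfl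
      push_cast
      refine ⟨ih.1.trans hp.1, ?_⟩
      rw [← intervalIntegral.integral_add_adjacent_intervals ih.1 hp.1, ih.2, hp.2]
      abel
  have hfloor : ∀ t, 0 ≤ t → (⌊t / δ⌋₊ : ℝ) * δ ≤ t ∧ t ≤ (⌊t / δ⌋₊ + 1) * δ := by
    intro t ht
    have h1 := Nat.floor_le (div_nonneg ht hδ.le)
    have h2 := Nat.lt_floor_add_one (t / δ)
    rw [le_div_iff₀ hδ] at h1
    rw [div_lt_iff₀ hδ] at h2
    exact ⟨h1, h2.le⟩
  have hall : ∀ t, 0 ≤ t → IntervalIntegrable (fun s => A s *ᵥ x s) volume 0 t ∧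
      ∫ s in (0 : ℝ)..t, A s *ᵥ x s = x t - x 0 := by
    intro t ht
    obtain ⟨h1, h2⟩ := hfloor t ht
    have hg := hgrid ⌊t / δ⌋₊
    have hp := hpiece ⌊t / δ⌋₊ t h1 h2
    refine ⟨hg.1.trans hp.1, ?_⟩
    rw [← intervalIntegral.integral_add_adjacent_intervals hg.1 hp.1, hg.2, hp.2]
    abel
  have heq : ∀ t, 0 ≤ t → x t = x 0 + ∫ s in (0 : ℝ)..t, A s *ᵥ x s := by
    intro t ht
    rw [(hall t ht).2]; abel
  refine ⟨x, ⟨A, ⟨fun i j => ?_, fun t _ => hsel _⟩, ?_, heq⟩, hxk⟩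
  · have h1 : Measurable fun k : ℕ => sel (X k) i j := measurable_from_top
    exact h1.comp (Nat.measurable_floor.comp (measurable_id.div_const δ))
  · intro t ht
    have ht1 : (0 : ℝ) ≤ t + 1 := by have : (0 : ℝ) ≤ t := ht; linarith
    have hc : ContinuousOn (fun t => x 0 + ∫ s in (0 : ℝ)..t, A s *ᵥ x s) (Icc 0 (t + 1)) := by
      refine continuousOn_const.add ?_
      have h1 := (hall (t + 1) ht1).1
      rw [intervalIntegrable_iff_integrableOn_Icc_of_le ht1] at h1
      have h2 := intervalIntegral.continuousOn_primitive_interval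
        (f := fun s => A s *ᵥ x s) (μ := volume) (a := 0) (b := t + 1) (by rwa [uIcc_of_le ht1])
      rwa [uIcc_of_le ht1] at h2
    have hc2 : ContinuousOn x (Icc 0 (t + 1)) := hc.congr fun s hs => heq s hs.1
    refine (hc2 t ⟨ht, by linarith⟩).mono_of_mem_nhdsWithin ?_
    rw [← Ici_inter_Iic]
    exact inter_mem_nhdsWithin _ (Iic_mem_nhds (by linarith))

/-! ### The norm adapted to the Lyapunov exponent -/

/-- Invariance gives `σ ≤ ρ`. Conversely, the feedback law that picks tangent matrices, sampled with
step `δ`, multiplies `f` by at least `1 + ρ * δ - C' * δ ^ 2` per step. An admissible `s` thus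
satisfies `1 + ρ * δ - C' * δ ^ 2 ≤ exp (s * δ)` for all small `δ`. -/
lemma lyapunovExponent_eq {𝒜 : Set Mat} (hc : IsCompact 𝒜) {ρ : ℝ} {f : Seminorm ℝ Plane}
    (hdef : ∀ v, f v = 0 → v = 0) (hinv : IsInvariantFor (shiftSet 𝒜 ρ) f)
    (hext : ∀ x, ∃ B ∈ shiftSet 𝒜 ρ, ∃ p ∈ Subgrad f x, p ⬝ᵥ (B *ᵥ x) = 0) :
    lyapunovExponent 𝒜 = ρ := by
  obtain ⟨c, hcp, hcN⟩ := seminorm_lower f hdef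
  have hmem : ρ ∈ {s : ℝ | ∀ x, IsTrajectory 𝒜 x →
      ∃ C : ℝ, ∀ t, 0 ≤ t → ‖x t‖ ≤ C * Real.exp (s * t)} := by
    intro x hx
    refine ⟨f (x 0) / c, fun t ht => ?_⟩
    rw [div_mul_eq_mul_div, le_div_iff₀ hcp, mul_comm, mul_comm (f (x 0))]
    exact (hcN _).trans (hinv.growth hc hx.mono ht)
  have hlow : ∀ s ∈ {s : ℝ | ∀ x, IsTrajectory 𝒜 x →
      ∃ C : ℝ, ∀ t, 0 ≤ t → ‖x t‖ ≤ C * Real.exp (s * t)}, ρ ≤ s := by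
    intro s hs
    obtain ⟨M, hM0, hM'⟩ := isBounded_entries hc
    have hM : ∀ A ∈ 𝒜, ∀ i j, |A i j| ≤ M := fun A hA => hM' A (subset_convexHull ℝ 𝒜 hA)
    obtain ⟨C, hC0, hC⟩ := expFlow_second_order hM0
    choose Bs hBs ps hps hpB using hext
    set sel : Plane → Mat := fun x => Bs x + ρ • (1 : Mat) with hsel
    have hselA : ∀ x, sel x ∈ 𝒜 := fun x => mem_shiftSet.1 (hBs x)
    have hselp : ∀ x, ps x ⬝ᵥ (sel x *ᵥ x) = ρ * f x := fun x => by
      rw [hsel, Matrix.add_mulVec, dotProduct_add, hpB, Matrix.smul_mulVec, Matrix.one_mulVec,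
        dotProduct_smul, (hps x).1, smul_eq_mul, zero_add]
    set C' := subgradBound f * C / c with hC'
    -- The subgradient at `x` is tested on the endpoint of the step: tangency makes the first order
    -- term equal to `ρ * δ * f x`, and the remainder is quadratic in `δ`.
    have hstep : ∀ δ, 0 ≤ δ → δ ≤ 1 → ∀ x,
        (1 + ρ * δ - C' * δ ^ 2) * f x ≤ f (expFlow (sel x) δ x) := by
      intro δ hδ hδ1 x
      set e := expFlow (sel x) δ x - x - δ • (sel x *ᵥ x) with he
      have h1 : ps x ⬝ᵥ expFlow (sel x) δ x = f x + δ * (ρ * f x) + ps x ⬝ᵥ e := by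
        have : expFlow (sel x) δ x = x + δ • (sel x *ᵥ x) + e := by rw [he]; abel
        rw [this, dotProduct_add, dotProduct_add, (hps x).1, dotProduct_smul, hselp, smul_eq_mul]
      have h2 : -(subgradBound f * (C * ‖x‖ * δ ^ 2)) ≤ ps x ⬝ᵥ e := by
        have h3 := (hps x).2 (-e)
        rw [dotProduct_neg] at h3
        have h4 := seminorm_le_norm f (-e)
        rw [norm_neg] at h4
        have h5 := mul_le_mul_of_nonneg_left (hC _ (hM _ (hselA x)) δ hδ hδ1 x)
          (subgradBound_nonneg f)
        have h6 : f (-e) ≤ subgradBound f * ‖e‖ := h4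
        linarith
      have h3 : subgradBound f * (C * ‖x‖ * δ ^ 2) ≤ C' * δ ^ 2 * f x := by
        rw [hC']
        have h7 : ‖x‖ ≤ f x / c := by rw [le_div_iff₀ hcp, mul_comm]; exact hcN x
        have h8 : 0 ≤ subgradBound f := subgradBound_nonneg f
        calc subgradBound f * (C * ‖x‖ * δ ^ 2) ≤ subgradBound f * (C * (f x / c) * δ ^ 2) := by
              gcongr
          _ = _ := by ring
      have h4 := (hps x).2 (expFlow (sel x) δ x)
      nlinarith
    have hmain : ∀ δ, 0 < δ → δ ≤ 1 → 1 + ρ * δ - C' * δ ^ 2 ≤ Real.exp (s * δ) := by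
      intro δ hδ hδ1
      set q := 1 + ρ * δ - C' * δ ^ 2 with hq
      rcases le_or_gt q 0 with hq0 | hq0
      · exact hq0.trans (Real.exp_pos _).le
      set X : ℕ → Plane := fun k => Nat.rec ![1, 0] (fun _ x => expFlow (sel x) δ x) k with hXdef
      obtain ⟨x, hx, hxX⟩ := exists_grid_trajectory sel hselA hδ X (fun k => rfl)
      obtain ⟨D, hD⟩ := hs x hx
      have hgrow : ∀ k, q ^ k * f ![1, 0] ≤ f (X k) := by
        intro k
        induction k with
        | zero => simp [hXdef]
        | succ k ih =>
          have h1 := hstep δ hδ.le hδ1 (X k)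
          rw [pow_succ]
          have h2 := mul_le_mul_of_nonneg_left ih hq0.le
          calc q ^ k * q * f ![1, 0] = q * (q ^ k * f ![1, 0]) := by ring
            _ ≤ q * f (X k) := h2
            _ ≤ _ := h1
      have hf1 : 0 < f ![1, 0] := lt_of_le_of_ne (apply_nonneg f _) fun h => by
        have := congrFun (hdef _ h.symm) 0
        simp at this
      by_contra! hlt
      set r := q / Real.exp (s * δ) with hr
      have hr1 : 1 < r := by rwa [hr, one_lt_div (Real.exp_pos _)]
      have hbound : ∀ k : ℕ, r ^ k ≤ subgradBound f * D / f ![1, 0] := by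
        intro k
        have h1 := hD (k * δ) (by positivity)
        rw [hxX] at h1
        have h2 := (hgrow k).trans ((seminorm_le_norm f _).trans
          (mul_le_mul_of_nonneg_left h1 (subgradBound_nonneg f)))
        rw [hr, div_pow, ← Real.exp_nat_mul, div_le_div_iff₀ (Real.exp_pos _) hf1]
        refine h2.trans (le_of_eq ?_)
        rw [show s * (k * δ) = k * (s * δ) by ring]
        unfold subgradBound
        ring
      obtain ⟨k, hk⟩ := pow_unbounded_of_one_lt (subgradBound f * D / f ![1, 0]) hr1
      exact absurd (hbound k) (not_le.2 hk)
    -- Both sides of `hmain` equal `1` at `δ = 0`, so comparing right derivatives there gives `ρ ≤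
    -- s`.
    have hd : HasDerivAt (fun δ : ℝ => 1 + ρ * δ - C' * δ ^ 2 - Real.exp (s * δ)) (ρ - s) 0 := by
      have h1 : HasDerivAt (fun δ : ℝ => 1 + ρ * δ) ρ 0 := by
        simpa using ((hasDerivAt_id (0 : ℝ)).const_mul ρ).const_add 1
      have h2 : HasDerivAt (fun δ : ℝ => C' * δ ^ 2) 0 0 := by
        simpa using ((hasDerivAt_id (0 : ℝ)).pow 2).const_mul C'
      have h3 : HasDerivAt (fun δ : ℝ => Real.exp (s * δ)) s 0 := by
        simpa using ((hasDerivAt_id (0 : ℝ)).const_mul s).exp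
      have h4 := (h1.sub h2).sub h3
      rw [sub_zero] at h4
      exact h4
    have h1 := hd.tendsto_slope.mono_left (nhdsGT_le_nhdsNE (0 : ℝ))
    have h2 : ρ - s ≤ 0 := by
      refine le_of_tendsto h1 ?_
      filter_upwards [Ioc_mem_nhdsGT (show (0 : ℝ) < 1 by norm_num)] with δ hδ
      rw [slope_def_field, sub_zero]
      refine div_nonpos_of_nonpos_of_nonneg ?_ hδ.1.le
      have := hmain δ hδ.1 hδ.2
      simp
      linarith
    linarith
  exact le_antisymm (csInf_le ⟨ρ, hlow⟩ hmem) (le_csInf ⟨ρ, hmem⟩ hlow)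

theorem exists_adapted_norm {𝒜 : Set Mat} (hc : IsCompact 𝒜) (hirr : IsIrreducible 𝒜) :
    ∃ f : Seminorm ℝ Plane, (∀ v, f v = 0 → v = 0) ∧
      IsInvariantFor (shiftSet 𝒜 (lyapunovExponent 𝒜)) f ∧
      ∀ x, ∃ B ∈ shiftSet 𝒜 (lyapunovExponent 𝒜), ∃ p ∈ Subgrad f x, p ⬝ᵥ (B *ᵥ x) = 0 := by
  obtain ⟨ρ, N, hN0, hN, hmin⟩ := exists_minimal_rate hc hirr hirr.nonempty
  obtain ⟨f, hdef, hinv, hext⟩ := exists_norm_with_tangent_velocity (isCompact_shiftSet hc ρ)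
    (hirr.shiftSet ρ) (hirr.nonempty.image _) (N := N)
    (HasRate.shiftSet_iff.2 (by rwa [zero_add])) (hN.definite hirr hN0)
    (fun s hs N' hN' => hmin (s + ρ) (by linarith) N' (HasRate.shiftSet_iff.1 hN'))
  have := lyapunovExponent_eq hc hdef hinv hext
  rw [this]
  exact ⟨f, hdef, hinv, hext⟩


/-! ### Eigenvalues of planar matrices and dominance -/

lemma mem_eigenvalues {A : Mat} {z : ℂ} :
    z ∈ eigenvalues A ↔ z ^ 2 - (A.trace : ℂ) * z + (A.det : ℂ) = 0 := by
  rw [eigenvalues, spectrum.mem_iff, Matrix.isUnit_iff_isUnit_det, isUnit_iff_ne_zero, not_not,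
    Matrix.det_fin_two, Matrix.det_fin_two, Matrix.trace_fin_two]
  simp [Matrix.algebraMap_matrix_apply]
  constructor <;> intro h <;> linear_combination h

lemma trace_add_smul_one (B : Mat) (s : ℝ) : (B + s • (1 : Mat)).trace = B.trace + 2 * s := by
  simp [Matrix.trace_fin_two]; ring

lemma det_add_smul_one (B : Mat) (s : ℝ) :
    (B + s • (1 : Mat)).det = B.det + s * B.trace + s ^ 2 := by
  simp [Matrix.trace_fin_two, Matrix.det_fin_two]; ring

lemma mem_eigenvalues_add {B : Mat} {s : ℝ} {z : ℂ} :
    z ∈ eigenvalues (B + s • (1 : Mat)) ↔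
      (z - s) ^ 2 - (B.trace : ℂ) * (z - s) + (B.det : ℂ) = 0 := by
  rw [mem_eigenvalues, trace_add_smul_one, det_add_smul_one]
  push_cast
  constructor <;> intro h <;> linear_combination h

lemma mul_self_eq (B : Mat) : B * B = B.trace • B - B.det • (1 : Mat) := by
  ext i j
  fin_cases i <;> fin_cases j <;>
    simp [Matrix.mul_apply, Fin.sum_univ_two, Matrix.trace_fin_two, Matrix.det_fin_two] <;> ring

/-! ### Consequences of dominance and its absence for the shifted hull -/

section Dominance

variable {𝒜 : Set Mat} {f : Seminorm ℝ Plane}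

/-- Real eigenvalues of velocities of an invariant norm are nonpositive. -/
lemma IsInvariantFor.eigenvalue_nonpos {𝓑 : Set Mat} (hinv : IsInvariantFor 𝓑 f)
    (hdef : ∀ v, f v = 0 → v = 0) {B : Mat} (hB : B ∈ convexHull ℝ 𝓑) {y : Plane} (hy : y ≠ 0)
    {μ : ℝ} (hBy : B *ᵥ y = μ • y) : μ ≤ 0 := by
  obtain ⟨p, hp⟩ := subgrad_nonempty f y
  have h1 := hinv.hull y B hB p hp
  rw [hBy, dotProduct_smul, hp.1, smul_eq_mul] at h1
  have h2 : 0 < f y := lt_of_le_of_ne (apply_nonneg f y) fun h => hy (hdef y h.symm)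
  exact nonpos_of_mul_nonpos_left h1 h2

/-- If `det B = 0`, Cayley–Hamilton makes any `B *ᵥ u ≠ 0` an eigenvector for the trace, which is
then nonpositive. The eigenvalues `0` and `B.trace` of `B` make `B + σI` dominant with real
eigenvalues. -/
lemma det_ne_zero_of_not_realDominance (hreal : ¬ HasRealDominance 𝒜)
    (hdef : ∀ v, f v = 0 → v = 0) (hinv : IsInvariantFor (shiftSet 𝒜 (lyapunovExponent 𝒜)) f)
    {B : Mat} (hB : B ∈ convexHull ℝ (shiftSet 𝒜 (lyapunovExponent 𝒜))) (hB0 : B ≠ 0) :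
    B.det ≠ 0 := by
  intro hdet
  set σ := lyapunovExponent 𝒜
  have htr : B.trace ≤ 0 := by
    have h1 : ∃ u, B *ᵥ u ≠ 0 := by
      by_contra! h
      apply hB0
      ext i j
      have := congrFun (h (Pi.single j 1)) i
      simpa using this
    obtain ⟨u, hu⟩ := h1
    refine hinv.eigenvalue_nonpos hdef hB hu ?_
    rw [Matrix.mulVec_mulVec, mul_self_eq, hdet, zero_smul, sub_zero, Matrix.smul_mulVec]
  have hroots : ∀ z, z ∈ eigenvalues (B + σ • (1 : Mat)) → z = σ ∨ z = (σ + B.trace : ℝ) := by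
    intro z hz
    rw [mem_eigenvalues_add, hdet] at hz
    have : (z - σ) * (z - (σ + B.trace : ℝ)) = 0 := by
      push_cast; push_cast at hz; linear_combination hz
    rcases mul_eq_zero.1 this with h | h
    · left; linear_combination h
    · right; linear_combination h
  refine hreal ⟨B + σ • (1 : Mat), ⟨mem_convexHull_shiftSet.1 hB, ?_, ?_, ?_⟩, ?_⟩
  · change B + σ • (1 : Mat) ≠ σ • (1 : Mat)
    simpa using hB0
  · refine ⟨(σ : ℂ), ?_, Complex.ofReal_re σ⟩
    rw [mem_eigenvalues_add, hdet]; simp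
  · rintro _ ⟨z, hz, rfl⟩
    rcases hroots z hz with rfl | rfl
    · simp [σ]
    · rw [Complex.ofReal_re]; linarith
  · intro z hz
    rcases hroots z hz with rfl | rfl <;> simp

/-- The rotation flow of a complex structure `J`. -/
lemma spiral_isFlow {J : Mat} (hJ : J * J = -1) (a b : ℝ) (x : Plane) :
    IsFlow (fun _ => a • (1 : Mat) + b • J)
      (fun t => Real.exp (a * t) • (Real.cos (b * t) • x + Real.sin (b * t) • (J *ᵥ x))) := by
  refine isFlow_of_hasDerivAt (by fun_prop) fun t => ?_
  have h1 : HasDerivAt (fun t : ℝ => Real.exp (a * t)) (Real.exp (a * t) * a) t := by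
    simpa using ((hasDerivAt_id t).const_mul a).exp
  have h0 : HasDerivAt (fun t : ℝ => b * t) b t := by simpa using (hasDerivAt_id t).const_mul b
  have h2 : HasDerivAt (fun t : ℝ => Real.cos (b * t)) (-Real.sin (b * t) * b) t := h0.cos
  have h3 : HasDerivAt (fun t : ℝ => Real.sin (b * t)) (Real.cos (b * t) * b) t := h0.sin
  refine (h1.smul ((h2.smul_const x).add (h3.smul_const (J *ᵥ x)))).congr_deriv ?_
  have hJJ : J *ᵥ (J *ᵥ x) = -x := by rw [Matrix.mulVec_mulVec, hJ, Matrix.neg_mulVec, Matrix.one_mulVec]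
  rw [Matrix.add_mulVec, Matrix.smul_mulVec, Matrix.smul_mulVec, Matrix.one_mulVec,
    Matrix.mulVec_smul, Matrix.mulVec_add, Matrix.mulVec_smul, Matrix.mulVec_smul, hJJ]
  ext i
  simp only [Pi.add_apply, Pi.smul_apply, Pi.neg_apply, smul_eq_mul]
  ring

/-- Matrices with non-real eigenvalues in terms of a complex structure. -/
lemma exists_complex_structure {B : Mat} (h : B.trace ^ 2 < 4 * B.det) :
    ∃ (J : Mat) (b : ℝ), 0 < b ∧ J * J = -1 ∧ B = (B.trace / 2) • (1 : Mat) + b • J := by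
  set d := B.det - (B.trace / 2) ^ 2 with hd
  have hdp : 0 < d := by rw [hd]; nlinarith
  have hs : Real.sqrt d ≠ 0 := (Real.sqrt_pos.2 hdp).ne'
  set D := B - (B.trace / 2) • (1 : Mat) with hD
  have hDD : D * D = -(d • (1 : Mat)) := by
    have e : D * D = B * B - B.trace • B + (B.trace / 2) ^ 2 • (1 : Mat) := by
      rw [hD]
      simp only [sub_mul, mul_sub, smul_mul_assoc, mul_smul_comm, one_mul, mul_one]
      module
    rw [e, mul_self_eq, hd]
    module
  refine ⟨(Real.sqrt d)⁻¹ • D, Real.sqrt d, Real.sqrt_pos.2 hdp, ?_, ?_⟩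
  · rw [smul_mul_smul_comm, hDD, ← mul_inv, Real.mul_self_sqrt hdp.le, smul_neg, smul_smul,
      inv_mul_cancel₀ hdp.ne', one_smul]
  · rw [smul_smul, mul_inv_cancel₀ hs, one_smul, hD]; abel

/-- After a full turn, at time `2π / b`, the spiral returns to its start multiplied by `exp (2πa /
b)`; an invariant norm does not allow a factor above `1`. -/
lemma spiral_rate_nonpos {𝓑 : Set Mat} (hinv : IsInvariantFor 𝓑 f)
    (hdef : ∀ v, f v = 0 → v = 0) {J : Mat} (hJ : J * J = -1) {a b : ℝ} (hb : 0 < b)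
    (hB : a • (1 : Mat) + b • J ∈ convexHull ℝ 𝓑) : a ≤ 0 := by
  have h1 := hinv.antitone (spiral_isFlow hJ a b ![1, 0]) (fun _ _ => hB)
    (mem_Ici.2 le_rfl) (mem_Ici.2 (show 0 ≤ 2 * Real.pi / b by positivity)) (by positivity)
  have e : b * (2 * Real.pi / b) = 2 * Real.pi := by field_simp
  simp only [e, Real.cos_two_pi, Real.sin_two_pi, one_smul, zero_smul, add_zero, mul_zero,
    Real.cos_zero, Real.sin_zero, seminorm_exp_smul, Real.exp_zero] at h1
  have h2 : 0 < f ![1, 0] := lt_of_le_of_ne (apply_nonneg f _) fun h => by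
    have := congrFun (hdef _ h.symm) 0
    simp at this
  by_contra! ha
  have h3 : 1 < Real.exp (a * (2 * Real.pi / b)) := by
    rw [Real.one_lt_exp_iff]; positivity
  nlinarith

/-- For non-real eigenvalues the real part `B.trace / 2` is nonpositive by `spiral_rate_nonpos`, and
zero would mean complex dominance. For real ones the larger eigenvalue is nonpositive by invariance
and nonzero because `B` is invertible. -/
lemma trace_neg_of_not_dominance (hreal : ¬ HasRealDominance 𝒜) (hcomplex : ¬ HasComplexDominance 𝒜)
    (hdef : ∀ v, f v = 0 → v = 0) (hinv : IsInvariantFor (shiftSet 𝒜 (lyapunovExponent 𝒜)) f)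
    {B : Mat} (hB : B ∈ convexHull ℝ (shiftSet 𝒜 (lyapunovExponent 𝒜))) (hB0 : B ≠ 0) :
    B.trace < 0 := by
  have hdet := det_ne_zero_of_not_realDominance hreal hdef hinv hB hB0
  rcases lt_or_ge (B.trace ^ 2) (4 * B.det) with hdisc | hdisc
  · obtain ⟨J, b, hb, hJ, hBJ⟩ := exists_complex_structure hdisc
    have ha : B.trace / 2 ≤ 0 := spiral_rate_nonpos hinv hdef hJ hb (by rwa [← hBJ])
    rcases ha.lt_or_eq with ha | ha
    · linarith
    exfalso
    have htr : B.trace = 0 := by linarith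
    have hdp : 0 < B.det := by rw [htr] at hdisc; linarith
    set σ := lyapunovExponent 𝒜
    have hsq : ((Real.sqrt B.det : ℝ) : ℂ) ^ 2 = (B.det : ℂ) := by
      rw [← Complex.ofReal_pow, Real.sq_sqrt hdp.le]
    have hmem : (σ : ℂ) + Real.sqrt B.det * Complex.I ∈ eigenvalues (B + σ • (1 : Mat)) := by
      rw [mem_eigenvalues_add, htr]
      push_cast
      linear_combination -hsq + ((Real.sqrt B.det : ℝ) : ℂ) ^ 2 * Complex.I_sq
    have hne : B + σ • (1 : Mat) ≠ σ • (1 : Mat) := by simpa using hB0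
    refine hcomplex ⟨B + σ • (1 : Mat), ⟨mem_convexHull_shiftSet.1 hB, hne,
      ⟨_, hmem, by simp; rfl⟩, ?_⟩, _, hmem, ?_⟩
    · rintro _ ⟨z, hz, rfl⟩
      rw [mem_eigenvalues_add, htr] at hz
      have him := congrArg Complex.im hz
      have hre := congrArg Complex.re hz
      simp [pow_two] at him hre
      have hz0 : (z.re - σ) * z.im = 0 := by linarith
      rcases mul_eq_zero.1 hz0 with h | h
      · linarith
      · rw [h] at hre
        nlinarith [sq_nonneg (z.re - σ)]
    · simpa using (Real.sqrt_pos.2 hdp).ne'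
  · set q := Real.sqrt (B.trace ^ 2 - 4 * B.det) with hq
    have hqq : q ^ 2 = B.trace ^ 2 - 4 * B.det := Real.sq_sqrt (by linarith)
    have hq0 : 0 ≤ q := Real.sqrt_nonneg _
    set μ := (B.trace + q) / 2 with hμ
    have hdetμ : (B - μ • (1 : Mat)).det = 0 := by
      rw [sub_eq_add_neg, ← neg_smul, det_add_smul_one, hμ]
      nlinarith
    obtain ⟨y, hy, hBy⟩ := Matrix.exists_mulVec_eq_zero_iff.2 hdetμ
    rw [Matrix.sub_mulVec, Matrix.smul_mulVec, Matrix.one_mulVec, sub_eq_zero] at hBy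
    have hμ0 := hinv.eigenvalue_nonpos hdef hB hy hBy
    rcases hμ0.lt_or_eq with h | h
    · rw [hμ] at h; linarith
    · exfalso
      rw [h, zero_smul] at hBy
      exact hdet (Matrix.exists_mulVec_eq_zero_iff.1 ⟨y, hy, hBy⟩)

/-- Without dominance, all velocities matrices, relative to the exponent, have negative trace. -/
lemma hull_trace_neg (hscalar : lyapunovExponent 𝒜 • (1 : Mat) ∉ 𝒜)
    (hreal : ¬ HasRealDominance 𝒜) (hcomplex : ¬ HasComplexDominance 𝒜)
    (hdef : ∀ v, f v = 0 → v = 0) (hinv : IsInvariantFor (shiftSet 𝒜 (lyapunovExponent 𝒜)) f) :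
    ∀ B ∈ convexHull ℝ (shiftSet 𝒜 (lyapunovExponent 𝒜)), B.trace < 0 := by
  intro B hB
  -- The generators are nonzero since `σI ∉ 𝒜`. Negativity of the trace is a convex condition, so it
  -- reaches the hull and excludes the zero matrix there too.
  refine convexHull_min (t := {B : Mat | B.trace < 0}) ?_ ?_ hB
  · intro B hB
    refine trace_neg_of_not_dominance hreal hcomplex hdef hinv (subset_convexHull ℝ _ hB) ?_
    rintro rfl
    rw [mem_shiftSet, zero_add] at hB
    exact hscalar hB
  · exact convex_halfSpace_lt (Matrix.traceLinearMap (Fin 2) ℝ ℝ).isLinear 0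

/-- This is the form in which the absence of dominance enters the discussion of orientation: no
velocity of the hull vanishes off the origin. -/
lemma hull_mulVec_ne_zero (hscalar : lyapunovExponent 𝒜 • (1 : Mat) ∉ 𝒜)
    (hreal : ¬ HasRealDominance 𝒜) (hcomplex : ¬ HasComplexDominance 𝒜)
    (hdef : ∀ v, f v = 0 → v = 0) (hinv : IsInvariantFor (shiftSet 𝒜 (lyapunovExponent 𝒜)) f) :
    ∀ B ∈ convexHull ℝ (shiftSet 𝒜 (lyapunovExponent 𝒜)), ∀ x, x ≠ 0 → B *ᵥ x ≠ 0 := by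
  intro B hB x hx hBx
  have htr := hull_trace_neg hscalar hreal hcomplex hdef hinv B hB
  have hB0 : B ≠ 0 := by rintro rfl; simp at htr
  exact det_ne_zero_of_not_realDominance hreal hdef hinv hB hB0
    (Matrix.exists_mulVec_eq_zero_iff.1 ⟨x, hx, hBx⟩)

/-- The non-real eigenvalues of a real `2 × 2` matrix are conjugate, so both have real part `σ`. The
shifted matrix has trace zero and positive determinant, hence is a multiple of a complex structure.
-/
lemma exists_rotation_of_complexDominance (h : HasComplexDominance 𝒜) :
    ∃ (J : Mat) (b : ℝ), 0 < b ∧ J * J = -1 ∧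
      b • J ∈ convexHull ℝ (shiftSet 𝒜 (lyapunovExponent 𝒜)) := by
  obtain ⟨A, ⟨hA, -, ⟨z₀, hz₀, hre⟩, -⟩, z, hz, him⟩ := h
  set σ := lyapunovExponent 𝒜
  set B := A - σ • (1 : Mat) with hBdef
  have hAB : A = B + σ • (1 : Mat) := by rw [hBdef]; abel
  rw [hAB, mem_eigenvalues_add] at hz hz₀
  have e1 := congrArg Complex.re hz
  have e2 := congrArg Complex.im hz
  have e3 := congrArg Complex.re hz₀
  have e4 := congrArg Complex.im hz₀
  simp [pow_two, hre] at e1 e2 e3 e4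
  have e5 : B.trace = 2 * (z.re - σ) := by
    have : (2 * (z.re - σ) - B.trace) * z.im = 0 := by linarith
    rcases mul_eq_zero.1 this with h | h
    · linarith
    · exact absurd h him
  have him2 : 0 < z.im * z.im := mul_self_pos.2 him
  have hdet : 0 < B.det := by
    rw [e5] at e1
    nlinarith [mul_self_nonneg (z.re - σ)]
  have hne : z₀.im ≠ 0 := by
    intro h0
    rw [h0] at e3
    simp at e3
    linarith
  have htr : B.trace = 0 := by
    rcases e4 with h | h
    · exact h
    · exact absurd h hne
  obtain ⟨J, b, hb, hJ, hBJ⟩ := exists_complex_structure (B := B) (by rw [htr]; linarith)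
  refine ⟨J, b, hb, hJ, ?_⟩
  rw [htr, zero_div, zero_smul, zero_add] at hBJ
  rw [← hBJ, mem_convexHull_shiftSet, ← hAB]
  exact hA

end Dominance


/-! ### Polar coordinates in a linear frame -/

/-- The ellipse with conjugate semi-axes `u`, `w`. -/
noncomputable def ellipse (u w : Plane) (θ : ℝ) : Plane := Real.cos θ • u + Real.sin θ • w

/-- The area form. -/
def area (u w : Plane) : ℝ := u 0 * w 1 - u 1 * w 0

lemma frame_coord {u w : Plane} (h : area u w ≠ 0) (v : Plane) : ∃ a b : ℝ, v = a • u + b • w := by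
  refine ⟨area v w / area u w, area u v / area u w, ?_⟩
  ext i
  simp only [Pi.add_apply, Pi.smul_apply, smul_eq_mul]
  field_simp
  unfold area
  fin_cases i <;> simp <;> ring

lemma frame_unique {u w : Plane} (h : area u w ≠ 0) {a b a' b' : ℝ}
    (he : a • u + b • w = a' • u + b' • w) : a = a' ∧ b = b' := by
  have h0 := congrFun he 0
  have h1 := congrFun he 1
  simp only [Pi.add_apply, Pi.smul_apply, smul_eq_mul] at h0 h1
  constructor
  · refine mul_right_cancel₀ h ?_
    unfold area
    linear_combination w 1 * h0 - w 0 * h1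
  · refine mul_right_cancel₀ h ?_
    unfold area
    linear_combination u 0 * h1 - u 1 * h0

lemma ellipse_ne_zero {u w : Plane} (h : area u w ≠ 0) (θ : ℝ) : ellipse u w θ ≠ 0 := by
  intro h0
  have h1 : Real.cos θ • u + Real.sin θ • w = (0 : ℝ) • u + (0 : ℝ) • w := by
    simpa [ellipse] using h0
  obtain ⟨h2, h3⟩ := frame_unique h h1
  have := Real.cos_sq_add_sin_sq θ
  rw [h2, h3] at this
  norm_num at this

lemma exists_polar (a b : ℝ) (h : a ≠ 0 ∨ b ≠ 0) :
    ∃ r > (0 : ℝ), ∃ θ ∈ Ico 0 (2 * Real.pi), a = r * Real.cos θ ∧ b = r * Real.sin θ := by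
  set z : ℂ := ⟨a, b⟩ with hz
  have hz0 : z ≠ 0 := by
    intro h0
    have h1 := congrArg Complex.re h0
    have h2 := congrArg Complex.im h0
    simp [hz] at h1 h2
    rcases h with h | h
    · exact h h1
    · exact h h2
  have hc : a = ‖z‖ * Real.cos z.arg := (Complex.norm_mul_cos_arg z).symm
  have hs : b = ‖z‖ * Real.sin z.arg := (Complex.norm_mul_sin_arg z).symm
  refine ⟨‖z‖, norm_pos_iff.2 hz0, ?_⟩
  rcases le_or_gt 0 z.arg with h0 | h0
  · exact ⟨z.arg, ⟨h0, by linarith [Complex.arg_le_pi z, Real.pi_pos]⟩, hc, hs⟩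
  · refine ⟨z.arg + 2 * Real.pi, ⟨by linarith [Complex.neg_pi_lt_arg z], by linarith⟩, ?_, ?_⟩
    · rwa [Real.cos_add_two_pi]
    · rwa [Real.sin_add_two_pi]

lemma eq_of_cos_sin_eq {θ θ' : ℝ} (h : θ ∈ Ico 0 (2 * Real.pi)) (h' : θ' ∈ Ico 0 (2 * Real.pi))
    (hc : Real.cos θ = Real.cos θ') (hs : Real.sin θ = Real.sin θ') : θ = θ' := by
  have h1 : Real.cos (θ - θ') = 1 := by
    rw [Real.cos_sub, hc, hs]
    have := Real.cos_sq_add_sin_sq θ'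
    nlinarith
  obtain ⟨n, hn⟩ := (Real.cos_eq_one_iff _).1 h1
  have hp := Real.pi_pos
  have h2 : (n : ℝ) < 1 := by
    by_contra! hcon
    nlinarith [h.2, h'.1]
  have h3 : (-1 : ℝ) < n := by
    by_contra! hcon
    nlinarith [h.1, h'.2]
  have h4 : n = 0 := by
    have h5 : n < 1 := by exact_mod_cast h2
    have h6 : -1 < n := by exact_mod_cast h3
    omega
  rw [h4] at hn
  simp at hn
  linarith

lemma exists_ellipse_polar {u w : Plane} (h : area u w ≠ 0) {v : Plane} (hv : v ≠ 0) :
    ∃ r > (0 : ℝ), ∃ θ ∈ Ico 0 (2 * Real.pi), v = r • ellipse u w θ := by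
  obtain ⟨a, b, hab⟩ := frame_coord h v
  have h0 : a ≠ 0 ∨ b ≠ 0 := by
    by_contra! hc
    rw [hc.1, hc.2] at hab
    simp at hab
    exact hv hab
  obtain ⟨r, hr, θ, hθ, ha, hb⟩ := exists_polar a b h0
  refine ⟨r, hr, θ, hθ, ?_⟩
  rw [hab, ha, hb, ellipse]
  module

lemma ellipse_continuous (u w : Plane) : Continuous (ellipse u w) := by
  unfold ellipse; fun_prop

lemma ellipse_periodic (u w : Plane) : Function.Periodic (ellipse u w) (2 * Real.pi) := by
  intro θ; simp [ellipse]

lemma ellipse_add_pi (u w : Plane) (θ : ℝ) : ellipse u w (θ + Real.pi) = -ellipse u w θ := by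
  simp [ellipse, Real.cos_add_pi, Real.sin_add_pi]; module

lemma ellipse_add_half_pi (u w : Plane) (θ : ℝ) :
    ellipse u w (θ + Real.pi / 2) = -Real.sin θ • u + Real.cos θ • w := by
  rw [ellipse, Real.cos_add_pi_div_two, Real.sin_add_pi_div_two]

lemma ellipse_hasDerivAt (u w : Plane) (θ : ℝ) :
    HasDerivAt (ellipse u w) (ellipse u w (θ + Real.pi / 2)) θ := by
  rw [ellipse_add_half_pi]
  exact ((Real.hasDerivAt_cos θ).smul_const u).add ((Real.hasDerivAt_sin θ).smul_const w)

lemma ellipse_contDiff (u w : Plane) : ContDiff ℝ 1 (ellipse u w) := by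
  unfold ellipse; fun_prop

/-- The radial parametrization of the unit sphere of `f`. -/
noncomputable def sphereCurve (f : Seminorm ℝ Plane) (u w : Plane) (θ : ℝ) : Plane :=
  (f (ellipse u w θ))⁻¹ • ellipse u w θ

/-! ### The unit sphere as a radially parametrized closed curve -/

section Curve

variable {f : Seminorm ℝ Plane} {u w : Plane}

lemma seminorm_pos (hdef : ∀ v, f v = 0 → v = 0) {v : Plane} (hv : v ≠ 0) : 0 < f v :=
  lt_of_le_of_ne (apply_nonneg f v) fun h => hv (hdef v h.symm)

lemma seminorm_ellipse_pos (hdef : ∀ v, f v = 0 → v = 0) (h : area u w ≠ 0) (θ : ℝ) :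
    0 < f (ellipse u w θ) := seminorm_pos hdef (ellipse_ne_zero h θ)

lemma seminorm_sphereCurve (hdef : ∀ v, f v = 0 → v = 0) (h : area u w ≠ 0) (θ : ℝ) :
    f (sphereCurve f u w θ) = 1 := by
  have := seminorm_ellipse_pos hdef h θ
  rw [sphereCurve, map_smul_eq_mul, Real.norm_of_nonneg (by positivity), inv_mul_cancel₀ this.ne']

lemma sphereCurve_periodic : Function.Periodic (sphereCurve f u w) (2 * Real.pi) := by
  intro θ; simp only [sphereCurve, ellipse_periodic u w θ]

lemma sphereCurve_add_pi (θ : ℝ) : sphereCurve f u w (θ + Real.pi) = -sphereCurve f u w θ := by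
  simp only [sphereCurve, ellipse_add_pi, map_neg_eq_map, smul_neg]

lemma exists_eq_smul_sphereCurve (hdef : ∀ v, f v = 0 → v = 0) (h : area u w ≠ 0) {v : Plane}
    (hv : v ≠ 0) : ∃ θ ∈ Ico 0 (2 * Real.pi), v = f v • sphereCurve f u w θ := by
  obtain ⟨r, hr, θ, hθ, rfl⟩ := exists_ellipse_polar h hv
  refine ⟨θ, hθ, ?_⟩
  have := seminorm_ellipse_pos hdef h θ
  rw [sphereCurve, map_smul_eq_mul, Real.norm_of_nonneg hr.le, smul_smul, mul_assoc,
    mul_inv_cancel₀ this.ne', mul_one]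

lemma sphereCurve_bijOn (hdef : ∀ v, f v = 0 → v = 0) (h : area u w ≠ 0) :
    BijOn (sphereCurve f u w) (Ico 0 (2 * Real.pi)) (unitSphere f) := by
  refine ⟨fun θ _ => seminorm_sphereCurve hdef h θ, ?_, ?_⟩
  · intro θ hθ θ' hθ' he
    simp only [sphereCurve, ellipse, smul_add, smul_smul] at he
    have hp := seminorm_ellipse_pos hdef h θ
    have hp' := seminorm_ellipse_pos hdef h θ'
    set a := (f (Real.cos θ • u + Real.sin θ • w))⁻¹
    set a' := (f (Real.cos θ' • u + Real.sin θ' • w))⁻¹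
    have ha : 0 < a := inv_pos.2 hp
    have ha' : 0 < a' := inv_pos.2 hp'
    obtain ⟨h1, h2⟩ := frame_unique h he
    have e1 := Real.cos_sq_add_sin_sq θ
    have e2 := Real.cos_sq_add_sin_sq θ'
    have h3 : a ^ 2 = a' ^ 2 := by
      calc a ^ 2 = (a * Real.cos θ) ^ 2 + (a * Real.sin θ) ^ 2 := by
            linear_combination (-(a ^ 2)) * e1
        _ = (a' * Real.cos θ') ^ 2 + (a' * Real.sin θ') ^ 2 := by rw [h1, h2]
        _ = a' ^ 2 := by linear_combination (a' ^ 2) * e2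
    have h4 : a = a' := by
      have := (sq_eq_sq₀ ha.le ha'.le).1 h3
      exact this
    rw [← h4] at h1 h2
    exact eq_of_cos_sin_eq hθ hθ' (mul_left_cancel₀ ha.ne' h1) (mul_left_cancel₀ ha.ne' h2)
  · intro v hv
    have hv1 : f v = 1 := hv
    have hv0 : v ≠ 0 := by rintro rfl; simp at hv1
    obtain ⟨θ, hθ, he⟩ := exists_eq_smul_sphereCurve hdef h hv0
    refine ⟨θ, hθ, ?_⟩
    rw [hv1, one_smul] at he
    exact he.symm

lemma sphereCurve_contDiff (hdef : ∀ v, f v = 0 → v = 0) (h : area u w ≠ 0)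
    (hf : ContDiff ℝ 1 fun θ => f (ellipse u w θ)) : ContDiff ℝ 1 (sphereCurve f u w) :=
  (hf.inv fun θ => (seminorm_ellipse_pos hdef h θ).ne').smul (ellipse_contDiff u w)

/-- Whatever the radial part of the derivative is, its component along `ellipse u w (θ + π / 2)` is
`1 / f (ellipse u w θ) > 0`. -/
lemma sphereCurve_deriv_ne_zero (hdef : ∀ v, f v = 0 → v = 0) (h : area u w ≠ 0)
    (hf : ContDiff ℝ 1 fun θ => f (ellipse u w θ)) (θ : ℝ) : deriv (sphereCurve f u w) θ ≠ 0 := by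
  have hpos := seminorm_ellipse_pos hdef h θ
  have hinv : ContDiff ℝ 1 fun θ => (f (ellipse u w θ))⁻¹ :=
    hf.inv fun θ => (seminorm_ellipse_pos hdef h θ).ne'
  have h1 := (hinv.differentiable one_ne_zero θ).hasDerivAt
  have h2 : HasDerivAt (sphereCurve f u w) _ θ := h1.smul (ellipse_hasDerivAt u w θ)
  rw [h2.deriv, ellipse_add_half_pi]
  set a := (f (ellipse u w θ))⁻¹ with ha
  set d := deriv (fun θ => (f (ellipse u w θ))⁻¹) θ
  intro h0
  have h3 : (d * Real.cos θ - a * Real.sin θ) • u + (d * Real.sin θ + a * Real.cos θ) • w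
      = (0 : ℝ) • u + (0 : ℝ) • w := by
    rw [zero_smul, zero_smul, add_zero, ← h0, ellipse]
    module
  obtain ⟨h4, h5⟩ := frame_unique h h3
  have h6 : a = 0 := by
    have := Real.cos_sq_add_sin_sq θ
    linear_combination (-a) * this - Real.sin θ * h4 + Real.cos θ * h5
  exact (inv_pos.2 hpos).ne' h6

lemma isC1ClosedCurve_unitSphere (hdef : ∀ v, f v = 0 → v = 0) (h : area u w ≠ 0)
    (hf : ContDiff ℝ 1 fun θ => f (ellipse u w θ)) : IsC1ClosedCurve (unitSphere f) :=
  ⟨2 * Real.pi, sphereCurve f u w, by positivity, sphereCurve_contDiff hdef h hf,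
    sphereCurve_periodic, sphereCurve_deriv_ne_zero hdef h hf, sphereCurve_bijOn hdef h⟩

end Curve

/-! ### Barabanov norms -/

section Barabanov

variable {𝒜 : Set Mat}

lemma isBddLaw_const (A : Mat) : IsBddLaw fun _ => A := by
  refine ⟨fun _ _ => measurable_const, |A 0 0| + |A 0 1| + |A 1 0| + |A 1 1|, fun t _ i j => ?_⟩
  have h0 := abs_nonneg (A 0 0)
  have h1 := abs_nonneg (A 0 1)
  have h2 := abs_nonneg (A 1 0)
  have h3 := abs_nonneg (A 1 1)
  fin_cases i <;> fin_cases j <;> simp <;> linarith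

lemma expFlow_isTrajectory {A : Mat} (hA : A ∈ 𝒜) (x : Plane) :
    IsTrajectory 𝒜 (fun t => expFlow A t x) :=
  ⟨fun _ => A, ⟨fun _ _ => measurable_const, fun _ _ => hA⟩,
    (expFlow_isFlow A x).isSolution (isBddLaw_const A)⟩

lemma IsBarabanovNorm.isInvariantFor {f : Seminorm ℝ Plane} (h : IsBarabanovNorm 𝒜 f) :
    IsInvariantFor (shiftSet 𝒜 (lyapunovExponent 𝒜)) f := by
  have hrate : HasRate 𝒜 (lyapunovExponent 𝒜) f := by
    intro A hA t ht x
    have := h.growth_le _ (expFlow_isTrajectory hA x) t ht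
    simpa using this
  rintro x _ ⟨A, hA, rfl⟩ p hp
  have h1 := hrate.subgrad_le hA hp
  rw [Matrix.sub_mulVec, Matrix.smul_mulVec, Matrix.one_mulVec, dotProduct_sub, dotProduct_smul,
    hp.1, smul_eq_mul]
  linarith

/-- Flows of the translated control set give trajectories. -/
lemma IsFlow.unshift (hc : IsCompact 𝒜) {s : ℝ} {B : ℝ → Mat} (hm : ∀ i j, Measurable fun t => B t i j)
    (hB : ∀ t, 0 ≤ t → B t ∈ convexHull ℝ (shiftSet 𝒜 s)) {z : ℝ → Plane} (hz : IsFlow B z) :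
    IsSwitchingLaw (convexHull ℝ 𝒜) (fun t => B t + s • (1 : Mat)) ∧
      IsSolution (fun t => B t + s • (1 : Mat)) (fun t => Real.exp (s * t) • z t) := by
  have h1 : IsSwitchingLaw (convexHull ℝ 𝒜) (fun t => B t + s • (1 : Mat)) := by
    refine ⟨fun i j => ?_, fun t ht => mem_convexHull_shiftSet.1 (hB t ht)⟩
    simp only [Matrix.add_apply]
    exact (hm i j).add_const _
  refine ⟨h1, ?_⟩
  have h2 := hz.shift (-s)
  simp only [neg_neg, neg_smul, sub_neg_eq_add] at h2
  exact h2.isSolution (h1.isBddLaw hc)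

lemma exp_neg_smul_exp_smul (a : ℝ) (v : Plane) : Real.exp (-a) • (Real.exp a • v) = v := by
  rw [smul_smul, ← Real.exp_add, neg_add_cancel, Real.exp_zero, one_smul]

lemma isExtremalTrajectory_of_flow (hc : IsCompact 𝒜) {f : Seminorm ℝ Plane} {B : ℝ → Mat}
    (hm : ∀ i j, Measurable fun t => B t i j)
    (hB : ∀ t, 0 ≤ t → B t ∈ convexHull ℝ (shiftSet 𝒜 (lyapunovExponent 𝒜))) {z : ℝ → Plane}
    (hz : IsFlow B z) (hf : ∀ t, 0 ≤ t → f (z t) = f (z 0)) :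
    IsExtremalTrajectory 𝒜 f (fun t => Real.exp (lyapunovExponent 𝒜 * t) • z t) := by
  obtain ⟨h1, h2⟩ := hz.unshift hc hm hB
  refine ⟨⟨_, h1, h2⟩, fun t ht => ?_⟩
  simp only [seminorm_exp_smul, mul_zero, Real.exp_zero, hf t ht, one_smul]

/-- An invariant norm is constant along periodic flows. -/
lemma IsInvariantFor.const_of_periodic {𝓑 : Set Mat} {g : Seminorm ℝ Plane}
    (hg : IsInvariantFor 𝓑 g) {B : ℝ → Mat} {z : ℝ → Plane} (hz : IsFlow B z)
    (hB : ∀ t, 0 ≤ t → B t ∈ convexHull ℝ 𝓑) {L : ℝ} (hL : 0 < L)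
    (hper : ∀ t, 0 ≤ t → z (t + L) = z t) {t : ℝ} (ht : 0 ≤ t) : g (z t) = g (z 0) := by
  have hanti := hg.antitone hz hB
  refine le_antisymm (hanti (mem_Ici.2 le_rfl) ht ht) ?_
  have hn : ∀ n : ℕ, z (n * L) = z 0 := by
    intro n
    induction n with
    | zero => simp
    | succ n ih =>
      push_cast
      rw [add_mul, one_mul, hper _ (by positivity), ih]
  obtain ⟨n, hn'⟩ := exists_nat_ge (t / L)
  rw [div_le_iff₀ hL] at hn'
  have h1 : g (z (n * L)) ≤ g (z t) := hanti ht (mem_Ici.2 (ht.trans hn')) hn'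
  rwa [hn] at h1

/-- A periodic flow which covers the unit sphere of `f` determines the Barabanov norm. -/
lemma unique_of_periodic {f : Seminorm ℝ Plane} {B : ℝ → Mat}
    {z : ℝ → Plane} (hz : IsFlow B z)
    (hB : ∀ t, 0 ≤ t → B t ∈ convexHull ℝ (shiftSet 𝒜 (lyapunovExponent 𝒜))) {L : ℝ} (hL : 0 < L)
    (hper : ∀ t, 0 ≤ t → z (t + L) = z t)
    (hcov : ∀ v, v ≠ 0 → ∃ t, 0 ≤ t ∧ v = f v • z t)
    {g : Seminorm ℝ Plane} (hg : IsBarabanovNorm 𝒜 g) :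
    ∃ c : ℝ, 0 < c ∧ ∀ v, g v = c * f v := by
  have hconst := fun t (ht : 0 ≤ t) => hg.isInvariantFor.const_of_periodic hz hB hL hper ht
  have hform : ∀ v, g v = g (z 0) * f v := by
    intro v
    rcases eq_or_ne v 0 with rfl | hv
    · simp
    obtain ⟨t, ht, he⟩ := hcov v hv
    conv_lhs => rw [he]
    rw [map_smul_eq_mul, Real.norm_of_nonneg (apply_nonneg f v), hconst t ht, mul_comm]
  refine ⟨g (z 0), ?_, hform⟩
  have h1 : 0 < g ![1, 0] := seminorm_pos hg.definite (by
    intro h; have := congrFun h 0; simp at this)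
  rw [hform] at h1
  exact pos_of_mul_pos_left h1 (apply_nonneg f _)

/-! ### Complex dominance -/

/-- A vanishing area would make `x` a real eigenvector of `J`, which `J * J = -1` excludes; in
coordinates a sum of two squares would vanish. -/
lemma area_complex_structure {J : Mat} (hJ : J * J = -1) {x : Plane} (hx : x ≠ 0) :
    area x (J *ᵥ x) ≠ 0 := by
  have e00 := congrFun (congrFun hJ 0) 0
  have e01 := congrFun (congrFun hJ 0) 1
  have e11 := congrFun (congrFun hJ 1) 1
  simp [Matrix.mul_apply, Fin.sum_univ_two] at e00 e01 e11
  have h01 : J 0 1 ≠ 0 := by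
    intro h
    rw [h] at e00
    nlinarith [mul_self_nonneg (J 0 0)]
  have htr : J 1 1 = -J 0 0 := by
    have : J 0 1 * (J 0 0 + J 1 1) = 0 := by linear_combination e01
    rcases mul_eq_zero.1 this with h | h
    · exact absurd h h01
    · linarith
  intro h0
  simp [area, Matrix.mulVec, dotProduct, Fin.sum_univ_two] at h0
  rw [htr] at h0
  have h1 : (J 1 0 * x 0 - J 0 0 * x 1) ^ 2 + x 1 ^ 2 = 0 := by
    linear_combination J 1 0 * h0 + x 1 ^ 2 * e00
  have h2 : x 1 = 0 := by nlinarith [sq_nonneg (J 1 0 * x 0 - J 0 0 * x 1), sq_nonneg (x 1)]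
  have h3 : J 1 0 * x 0 = 0 := by
    rw [h2] at h1
    simpa using h1
  have h10 : J 1 0 ≠ 0 := by
    intro h
    rw [h] at e00
    nlinarith [mul_self_nonneg (J 0 0)]
  apply hx
  ext i
  fin_cases i
  · exact (mul_eq_zero.1 h3).resolve_left h10
  · exact h2

/-- The orbits of the rotation `b • J` are closed ellipses, and an invariant norm is constant on
each of them. Hence the sphere is one such ellipse, extremal trajectories rotate along them, and
every Barabanov norm is a multiple of `f`. -/
theorem barabanov_of_complexDominance (hc : IsCompact 𝒜) (hcomplex : HasComplexDominance 𝒜)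
    {f : Seminorm ℝ Plane} (hdef : ∀ v, f v = 0 → v = 0)
    (hinv : IsInvariantFor (shiftSet 𝒜 (lyapunovExponent 𝒜)) f) :
    IsBarabanovNorm 𝒜 f ∧
      (∀ g : Seminorm ℝ Plane, IsBarabanovNorm 𝒜 g → ∃ c : ℝ, 0 < c ∧ ∀ v, g v = c * f v) ∧
      IsC1ClosedCurve (unitSphere f) := by
  obtain ⟨J, b, hb, hJ, hB⟩ := exists_rotation_of_complexDominance hcomplex
  have hflow : ∀ x, IsFlow (fun _ => b • J) (fun t => ellipse x (J *ᵥ x) (b * t)) := by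
    intro x
    have := spiral_isFlow hJ 0 b x
    simpa [ellipse] using this
  have hL : 0 < 2 * Real.pi / b := by positivity
  have hper : ∀ x t, ellipse x (J *ᵥ x) (b * (t + 2 * Real.pi / b)) = ellipse x (J *ᵥ x) (b * t) := by
    intro x t
    rw [show b * (t + 2 * Real.pi / b) = b * t + 2 * Real.pi by field_simp, ellipse_periodic]
  have hell0 : ∀ x, ellipse x (J *ᵥ x) (b * 0) = x := fun x => by simp [ellipse]
  have hconst : ∀ x t, 0 ≤ t → f (ellipse x (J *ᵥ x) (b * t)) = f x := by
    intro x t ht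
    have := hinv.const_of_periodic (hflow x) (fun _ _ => hB) hL (fun t _ => hper x t) ht
    rwa [hell0] at this
  -- Negative parameters are reached by adding full turns.
  have hconst' : ∀ x θ, f (ellipse x (J *ᵥ x) θ) = f x := by
    intro x θ
    obtain ⟨n, hn⟩ := exists_nat_ge (-θ / (2 * Real.pi))
    rw [div_le_iff₀ (by positivity)] at hn
    have h1 : ellipse x (J *ᵥ x) (θ + n * (2 * Real.pi)) = ellipse x (J *ᵥ x) θ :=
      (ellipse_periodic x (J *ᵥ x)).nat_mul n θ
    have h2 := hconst x ((θ + n * (2 * Real.pi)) / b) (div_nonneg (by linarith) hb.le)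
    rwa [mul_div_cancel₀ _ hb.ne', h1] at h2
  set e : Plane := ![1, 0]
  have he : e ≠ 0 := by
    intro h; have := congrFun h 0; simp [e] at this
  have hfe : 0 < f e := seminorm_pos hdef he
  set x₀ : Plane := (f e)⁻¹ • e with hx₀
  have hfx₀ : f x₀ = 1 := by
    rw [hx₀, map_smul_eq_mul, Real.norm_of_nonneg (inv_pos.2 hfe).le, inv_mul_cancel₀ hfe.ne']
  have hx₀0 : x₀ ≠ 0 := by rintro h; rw [h] at hfx₀; simp at hfx₀
  have harea := area_complex_structure hJ hx₀0
  refine ⟨⟨hdef, fun x hx t ht => hinv.growth hc hx.mono ht, fun v => ?_⟩, ?_, ?_⟩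
  · refine ⟨_, isExtremalTrajectory_of_flow hc (B := fun _ => b • J)
      (fun _ _ => measurable_const) (fun _ _ => hB) (hflow v) fun t ht => ?_, ?_⟩
    · rw [hconst v t ht, hell0]
    · simp [ellipse]
  · intro g hg
    refine unique_of_periodic (hflow x₀) (fun _ _ => hB) hL (fun t _ => hper x₀ t) ?_ hg
    intro v hv
    obtain ⟨θ, hθ, hvθ⟩ := exists_eq_smul_sphereCurve hdef harea hv
    refine ⟨θ / b, div_nonneg hθ.1 hb.le, ?_⟩
    rw [mul_div_cancel₀ _ hb.ne']
    rwa [sphereCurve, hconst', hfx₀, inv_one, one_smul] at hvθ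
  · refine isC1ClosedCurve_unitSphere hdef harea ?_
    simp only [hconst']
    exact contDiff_const

end Barabanov


/-! ### Tangential velocities on the unit sphere of an invariant norm -/

/-- The angular velocity of `ẋ = B x` at `x`, in the frame `(u, w)`. -/
noncomputable def angRate (u w : Plane) (B : Mat) (x : Plane) : ℝ := area x (B *ᵥ x) / area u w

lemma ellipse_add (u w : Plane) (θ φ : ℝ) : ellipse u w (θ + φ) =
    Real.cos φ • ellipse u w θ + Real.sin φ • ellipse u w (θ + Real.pi / 2) := by
  rw [ellipse_add_half_pi, ellipse, ellipse, Real.cos_add, Real.sin_add]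
  module

lemma area_ellipse (u w : Plane) (θ : ℝ) :
    area (ellipse u w θ) (ellipse u w (θ + Real.pi / 2)) = area u w := by
  rw [ellipse_add_half_pi]
  simp only [area, ellipse, Pi.add_apply, Pi.smul_apply, smul_eq_mul]
  linear_combination (u 0 * w 1 - u 1 * w 0) * Real.cos_sq_add_sin_sq θ

lemma mulVec_ellipse {u w : Plane} (h : area u w ≠ 0) (B : Mat) (θ : ℝ) :
    ∃ r : ℝ, B *ᵥ ellipse u w θ =
      r • ellipse u w θ + angRate u w B (ellipse u w θ) • ellipse u w (θ + Real.pi / 2) := by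
  have ha := area_ellipse u w θ
  set e := ellipse u w θ
  set e' := ellipse u w (θ + Real.pi / 2)
  obtain ⟨r, s, hrs⟩ := frame_coord (u := e) (w := e') (by rwa [ha]) (B *ᵥ e)
  refine ⟨r, ?_⟩
  have : angRate u w B e = s := by
    rw [angRate, hrs, div_eq_iff h, ← ha]
    simp only [area, Pi.add_apply, Pi.smul_apply, smul_eq_mul]
    ring
  rw [this]; exact hrs

lemma angRate_continuous (u w : Plane) :
    Continuous fun q : Plane × Mat => angRate u w q.2 q.1 := by
  have : Continuous fun q : Plane × Mat => area q.1 (q.2 *ᵥ q.1) := by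
    simp only [area, Matrix.mulVec, dotProduct]
    fun_prop
  exact this.div_const _

lemma angRate_combo (u w : Plane) (A B : Mat) (a b : ℝ) (x : Plane) :
    angRate u w (a • A + b • B) x = a * angRate u w A x + b * angRate u w B x := by
  simp only [angRate, area, Matrix.add_mulVec, Matrix.smul_mulVec, Pi.add_apply, Pi.smul_apply,
    smul_eq_mul]
  ring

lemma pairing_combo (A B : Mat) (a b : ℝ) (x p : Plane) :
    p ⬝ᵥ ((a • A + b • B) *ᵥ x) = a * (p ⬝ᵥ (A *ᵥ x)) + b * (p ⬝ᵥ (B *ᵥ x)) := by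
  rw [Matrix.add_mulVec, Matrix.smul_mulVec, Matrix.smul_mulVec, dotProduct_add, dotProduct_smul,
    dotProduct_smul, smul_eq_mul, smul_eq_mul]

/-- At the direction `θ` some velocity from `𝓑` is tangent to the sphere and points forward. -/
def IsForward (𝓑 : Set Mat) (f : Seminorm ℝ Plane) (u w : Plane) (θ : ℝ) : Prop :=
  ∃ p ∈ Subgrad f (ellipse u w θ), ∃ B ∈ 𝓑, p ⬝ᵥ (B *ᵥ ellipse u w θ) = 0 ∧
    0 ≤ angRate u w B (ellipse u w θ)

/-- At the direction `θ` some velocity from `𝓑` is tangent to the sphere and points backward. -/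
def IsBackward (𝓑 : Set Mat) (f : Seminorm ℝ Plane) (u w : Plane) (θ : ℝ) : Prop :=
  ∃ p ∈ Subgrad f (ellipse u w θ), ∃ B ∈ 𝓑, p ⬝ᵥ (B *ᵥ ellipse u w θ) = 0 ∧
    angRate u w B (ellipse u w θ) ≤ 0

section Tangent

variable {𝓑 : Set Mat} {f : Seminorm ℝ Plane} {u w : Plane}

lemma IsBackward.isForward_neg {θ : ℝ} (h : IsBackward 𝓑 f u w (-θ)) : IsForward 𝓑 f u (-w) θ := by
  have e : ellipse u (-w) θ = ellipse u w (-θ) := by simp [ellipse]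
  obtain ⟨p, hp, B, hB, h1, h2⟩ := h
  refine ⟨p, by rwa [e], B, hB, by rwa [e], ?_⟩
  rw [e]
  have : area u (-w) = -area u w := by simp [area]; ring
  rw [angRate, this, div_neg, ← angRate]
  linarith

lemma isForward_or_isBackward
    (hext : ∀ x, ∃ B ∈ 𝓑, ∃ p ∈ Subgrad f x, p ⬝ᵥ (B *ᵥ x) = 0) (θ : ℝ) :
    IsForward 𝓑 f u w θ ∨ IsBackward 𝓑 f u w θ := by
  obtain ⟨B, hB, p, hp, h0⟩ := hext (ellipse u w θ)
  rcases le_total 0 (angRate u w B (ellipse u w θ)) with h | h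
  · exact Or.inl ⟨p, hp, B, hB, h0, h⟩
  · exact Or.inr ⟨p, hp, B, hB, h0, h⟩

/-- A radial tangent velocity is `r • x` with `r * f x = 0`, hence zero. So the weak signs in
`IsForward` and `IsBackward`, which make them closed conditions, are automatically strict. The hull
is allowed because `corner_lt` uses a convex combination. -/
lemma angRate_ne_zero (hdef : ∀ v, f v = 0 → v = 0) (h : area u w ≠ 0)
    (hne : ∀ B ∈ convexHull ℝ 𝓑, ∀ x, x ≠ 0 → B *ᵥ x ≠ 0) {θ : ℝ} {p : Plane}
    (hp : p ∈ Subgrad f (ellipse u w θ)) {B : Mat} (hB : B ∈ convexHull ℝ 𝓑)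
    (h0 : p ⬝ᵥ (B *ᵥ ellipse u w θ) = 0) : angRate u w B (ellipse u w θ) ≠ 0 := by
  intro ha
  obtain ⟨r, hr⟩ := mulVec_ellipse h B θ
  rw [ha, zero_smul, add_zero] at hr
  rw [hr, dotProduct_smul, hp.1, smul_eq_mul] at h0
  have hr0 : r = 0 := (mul_eq_zero.1 h0).resolve_right (seminorm_ellipse_pos hdef h θ).ne'
  rw [hr0, zero_smul] at hr
  exact hne B hB _ (ellipse_ne_zero h θ) hr

/-- A forward tangent velocity determines the greatest subgradient. -/
lemma forward_max (hinv : IsInvariantFor 𝓑 f) (h : area u w ≠ 0) {θ : ℝ} {p p₁ : Plane}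
    (hp : p ∈ Subgrad f (ellipse u w θ)) (hp₁ : p₁ ∈ Subgrad f (ellipse u w θ)) {B : Mat}
    (hB : B ∈ 𝓑) (h0 : p₁ ⬝ᵥ (B *ᵥ ellipse u w θ) = 0)
    (hpos : 0 < angRate u w B (ellipse u w θ)) :
    p ⬝ᵥ ellipse u w (θ + Real.pi / 2) ≤ p₁ ⬝ᵥ ellipse u w (θ + Real.pi / 2) := by
  obtain ⟨r, hr⟩ := mulVec_ellipse h B θ
  have h1 := hinv _ B hB p hp
  rw [hr, dotProduct_add, dotProduct_smul, dotProduct_smul, smul_eq_mul, smul_eq_mul] at h0 h1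
  rw [hp.1] at h1
  rw [hp₁.1] at h0
  exact le_of_mul_le_mul_left (by linarith) hpos

/-- A direction with tangent velocities of both orientations is a corner. -/
lemma corner_lt (hdef : ∀ v, f v = 0 → v = 0) (hinv : IsInvariantFor 𝓑 f) (h : area u w ≠ 0)
    (hne : ∀ B ∈ convexHull ℝ 𝓑, ∀ x, x ≠ 0 → B *ᵥ x ≠ 0) {θ : ℝ} {p₁ p₂ : Plane} {B₁ B₂ : Mat}
    (hp₁ : p₁ ∈ Subgrad f (ellipse u w θ)) (hB₁ : B₁ ∈ 𝓑)
    (h₁ : p₁ ⬝ᵥ (B₁ *ᵥ ellipse u w θ) = 0) (ha₁ : 0 ≤ angRate u w B₁ (ellipse u w θ))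
    (hp₂ : p₂ ∈ Subgrad f (ellipse u w θ)) (hB₂ : B₂ ∈ 𝓑)
    (h₂ : p₂ ⬝ᵥ (B₂ *ᵥ ellipse u w θ) = 0) (ha₂ : angRate u w B₂ (ellipse u w θ) ≤ 0) :
    p₂ ⬝ᵥ ellipse u w (θ + Real.pi / 2) < p₁ ⬝ᵥ ellipse u w (θ + Real.pi / 2) := by
  have hB₁' := subset_convexHull ℝ 𝓑 hB₁
  have hB₂' := subset_convexHull ℝ 𝓑 hB₂
  replace ha₁ := lt_of_le_of_ne ha₁ (angRate_ne_zero hdef h hne hp₁ hB₁' h₁).symm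
  replace ha₂ := lt_of_le_of_ne ha₂ (angRate_ne_zero hdef h hne hp₂ hB₂' h₂)
  refine lt_of_le_of_ne (forward_max hinv h hp₂ hp₁ hB₁ h₁ ha₁) fun heq => ?_
  have h₂' : p₁ ⬝ᵥ (B₂ *ᵥ ellipse u w θ) = 0 := by
    obtain ⟨r, hr⟩ := mulVec_ellipse h B₂ θ
    rw [hr, dotProduct_add, dotProduct_smul, dotProduct_smul] at h₂ ⊢
    rw [hp₁.1, ← heq, ← hp₂.1]
    exact h₂
  set a₁ := angRate u w B₁ (ellipse u w θ)
  set a₂ := angRate u w B₂ (ellipse u w θ)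
  have hd : 0 < a₁ - a₂ := by linarith
  -- Equality of the two pairings makes `B₂` tangent with respect to `p₁` as well. The weights
  -- cancel the angular rates, giving a tangent velocity of rate zero in the hull, which is
  -- impossible.
  have hB : (-a₂ / (a₁ - a₂)) • B₁ + (a₁ / (a₁ - a₂)) • B₂ ∈ convexHull ℝ 𝓑 := by
    refine convex_convexHull ℝ 𝓑 hB₁' hB₂' (div_nonneg (by linarith) hd.le)
      (div_nonneg ha₁.le hd.le) ?_
    field_simp; ring
  refine angRate_ne_zero hdef h hne hp₁ hB ?_ ?_
  · rw [pairing_combo, h₁, h₂']; ring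
  · rw [angRate_combo]
    change -a₂ / (a₁ - a₂) * a₁ + a₁ / (a₁ - a₂) * a₂ = 0
    field_simp; ring

/-- Monotonicity of subgradients, to the right. -/
lemma subgrad_mono_right {θ θ' : ℝ} (h1 : θ < θ') (h2 : θ' ≤ θ + Real.pi / 2) {p p' : Plane}
    (hp : p ∈ Subgrad f (ellipse u w θ)) (hp' : p' ∈ Subgrad f (ellipse u w θ')) :
    p ⬝ᵥ ellipse u w (θ + Real.pi / 2) ≤ p' ⬝ᵥ ellipse u w (θ + Real.pi / 2) := by
  have e : ellipse u w θ' = Real.cos (θ' - θ) • ellipse u w θ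
      + Real.sin (θ' - θ) • ellipse u w (θ + Real.pi / 2) := by
    rw [← ellipse_add, add_sub_cancel]
  have hs : 0 < Real.sin (θ' - θ) :=
    Real.sin_pos_of_pos_of_lt_pi (by linarith) (by linarith [Real.pi_pos])
  have hc : 0 ≤ Real.cos (θ' - θ) := Real.cos_nonneg_of_mem_Icc ⟨by linarith [Real.pi_pos], by linarith⟩
  have a1 := hp.2 (ellipse u w θ')
  have a2 := hp'.2 (ellipse u w θ)
  rw [← hp'.1, e, dotProduct_add, dotProduct_add, dotProduct_smul, dotProduct_smul, dotProduct_smul,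
    dotProduct_smul] at a1
  rw [← hp.1] at a2
  simp only [smul_eq_mul] at a1
  exact le_of_mul_le_mul_left (by nlinarith) hs

/-- Monotonicity of subgradients, to the left. -/
lemma subgrad_mono_left {θ θ' : ℝ} (h1 : θ' < θ) (h2 : θ - Real.pi / 2 ≤ θ') {p p' : Plane}
    (hp : p ∈ Subgrad f (ellipse u w θ)) (hp' : p' ∈ Subgrad f (ellipse u w θ')) :
    p' ⬝ᵥ ellipse u w (θ + Real.pi / 2) ≤ p ⬝ᵥ ellipse u w (θ + Real.pi / 2) := by
  have e : ellipse u w θ' = Real.cos (θ' - θ) • ellipse u w θ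
      + Real.sin (θ' - θ) • ellipse u w (θ + Real.pi / 2) := by
    rw [← ellipse_add, add_sub_cancel]
  have hs : Real.sin (θ' - θ) < 0 :=
    Real.sin_neg_of_neg_of_neg_pi_lt (by linarith) (by linarith [Real.pi_pos])
  have hc : 0 ≤ Real.cos (θ' - θ) := Real.cos_nonneg_of_mem_Icc ⟨by linarith, by linarith [Real.pi_pos]⟩
  have a1 := hp.2 (ellipse u w θ')
  have a2 := hp'.2 (ellipse u w θ)
  rw [← hp'.1, e, dotProduct_add, dotProduct_add, dotProduct_smul, dotProduct_smul, dotProduct_smul,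
    dotProduct_smul] at a1
  rw [← hp.1] at a2
  simp only [smul_eq_mul] at a1
  exact le_of_mul_le_mul_left (a := -Real.sin (θ' - θ)) (by nlinarith) (by linarith)

lemma isCompact_ellipse_graph (hc : IsCompact 𝓑) (a b : ℝ) :
    IsCompact {q : ℝ × Plane × Mat | q.1 ∈ Icc a b ∧ q.2.1 ∈ Subgrad f (ellipse u w q.1) ∧
      q.2.2 ∈ 𝓑} := by
  have h := (isCompact_Icc (a := a) (b := b)).prod
    ((isCompact_closedBall (0 : Plane) (subgradBound f)).prod hc)
  have h2 : IsClosed {q : ℝ × Plane × Mat | q.2.1 ∈ Subgrad f (ellipse u w q.1)} :=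
    (isClosed_subgrad f).preimage
      (show Continuous fun q : ℝ × Plane × Mat => (ellipse u w q.1, q.2.1) from
        ((ellipse_continuous u w).comp continuous_fst).prodMk (by fun_prop))
  convert h.inter_right h2 using 1
  ext ⟨x, p, B⟩
  simp only [mem_ofPred_eq, mem_inter_iff, mem_prod]
  constructor
  · rintro ⟨a, b, c⟩; exact ⟨⟨a, subgrad_norm_le b, c⟩, b⟩
  · rintro ⟨⟨a, -, c⟩, b⟩; exact ⟨a, b, c⟩

/-- The set is a projection of a compact set of triples `(θ, p, B)`, so every closed condition on
the triples defines a closed set of directions. -/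
lemma isClosed_exists_subgrad (hc : IsCompact 𝓑) (a b : ℝ) {C : Set (ℝ × Plane × Mat)}
    (hC : IsClosed C) : IsClosed {θ | θ ∈ Icc a b ∧
      ∃ p ∈ Subgrad f (ellipse u w θ), ∃ B ∈ 𝓑, (θ, p, B) ∈ C} := by
  convert (((isCompact_ellipse_graph (f := f) (u := u) (w := w) hc a b).inter_right hC).image
    continuous_fst).isClosed using 1
  ext θ
  constructor
  · rintro ⟨h1, p, hp, B, hB, hC⟩
    exact ⟨(θ, p, B), ⟨⟨h1, hp, hB⟩, hC⟩, rfl⟩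
  · rintro ⟨⟨θ, p, B⟩, ⟨⟨h1, hp, hB⟩, hC⟩, rfl⟩
    exact ⟨h1, p, hp, B, hB, hC⟩

lemma continuous_ellipse_pairing :
    Continuous fun q : ℝ × Plane × Mat => q.2.1 ⬝ᵥ (q.2.2 *ᵥ ellipse u w q.1) := by
  have h : Continuous fun q : ℝ × Plane × Mat => (ellipse u w q.1, q.2.1, q.2.2) :=
    ((ellipse_continuous u w).comp continuous_fst).prodMk (by fun_prop)
  exact continuous_pairing.comp h

lemma continuous_ellipse_angRate :
    Continuous fun q : ℝ × Plane × Mat => angRate u w q.2.2 (ellipse u w q.1) := by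
  have h : Continuous fun q : ℝ × Plane × Mat => (ellipse u w q.1, q.2.2) :=
    ((ellipse_continuous u w).comp continuous_fst).prodMk (by fun_prop)
  exact (angRate_continuous u w).comp h

lemma continuous_dot_const (v : Plane) : Continuous fun q : ℝ × Plane × Mat => q.2.1 ⬝ᵥ v := by
  simp only [dotProduct]; fun_prop

lemma isClosed_tangent : IsClosed {q : ℝ × Plane × Mat | q.2.1 ⬝ᵥ (q.2.2 *ᵥ ellipse u w q.1) = 0} :=
  isClosed_eq continuous_ellipse_pairing continuous_const

lemma isClosed_forward (hc : IsCompact 𝓑) (a b : ℝ) :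
    IsClosed {θ | θ ∈ Icc a b ∧ IsForward 𝓑 f u w θ} :=
  isClosed_exists_subgrad hc a b (isClosed_tangent.inter
    (isClosed_le continuous_const continuous_ellipse_angRate))

lemma isClosed_backward (hc : IsCompact 𝓑) (a b : ℝ) :
    IsClosed {θ | θ ∈ Icc a b ∧ IsBackward 𝓑 f u w θ} :=
  isClosed_exists_subgrad hc a b (isClosed_tangent.inter
    (isClosed_le continuous_ellipse_angRate continuous_const))

/-- To the right of a corner there are no backward tangent velocities. -/
lemma corner_right (hc : IsCompact 𝓑) (hdef : ∀ v, f v = 0 → v = 0) (hinv : IsInvariantFor 𝓑 f)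
    (h : area u w ≠ 0) (hne : ∀ B ∈ convexHull ℝ 𝓑, ∀ x, x ≠ 0 → B *ᵥ x ≠ 0) {θ : ℝ}
    (hf : IsForward 𝓑 f u w θ) : ∀ᶠ θ' in 𝓝[>] θ, ¬ IsBackward 𝓑 f u w θ' := by
  obtain ⟨p₁, hp₁, B₁, hB₁, h₁, ha₁⟩ := hf
  -- The closed set consists of directions with a backward tangent velocity whose subgradient pairs
  -- with the rotated vector at least as largely as `p₁`. By `corner_lt` it misses `θ`, while
  -- monotonicity of subgradients places every backward direction just to the right of `θ` in it.
  have hD := isClosed_exists_subgrad (f := f) (u := u) (w := w) hc (θ - 1) (θ + 1)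
    (((isClosed_tangent (u := u) (w := w)).inter (isClosed_le
      (continuous_ellipse_angRate (u := u) (w := w)) (continuous_const (y := (0 : ℝ))))).inter
    (isClosed_le (continuous_const (y := p₁ ⬝ᵥ ellipse u w (θ + Real.pi / 2)))
      (continuous_dot_const (ellipse u w (θ + Real.pi / 2)))))
  have h1 := hD.isOpen_compl.mem_nhds (show θ ∈ _ by
    rintro ⟨-, p, hp, B, hB, ⟨h0, ha⟩, hle⟩
    exact absurd (corner_lt hdef hinv h hne hp₁ hB₁ h₁ ha₁ hp hB h0 ha) (not_lt.2 hle))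
  filter_upwards [mem_nhdsWithin_of_mem_nhds h1,
    Ioc_mem_nhdsGT (show θ < θ + 1 by linarith)] with θ' h2 h3 h4
  obtain ⟨p, hp, B, hB, h0, ha⟩ := h4
  refine h2 ⟨⟨by linarith [h3.1], h3.2⟩, p, hp, B, hB, ⟨h0, ha⟩, ?_⟩
  exact subgrad_mono_right h3.1 (by linarith [h3.2, Real.pi_gt_three]) hp₁ hp

/-- To the left of a corner there are no forward tangent velocities. -/
lemma corner_left (hc : IsCompact 𝓑) (hdef : ∀ v, f v = 0 → v = 0) (hinv : IsInvariantFor 𝓑 f)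
    (h : area u w ≠ 0) (hne : ∀ B ∈ convexHull ℝ 𝓑, ∀ x, x ≠ 0 → B *ᵥ x ≠ 0) {θ : ℝ}
    (hf : IsBackward 𝓑 f u w θ) : ∀ᶠ θ' in 𝓝[<] θ, ¬ IsForward 𝓑 f u w θ' := by
  obtain ⟨p₁, hp₁, B₁, hB₁, h₁, ha₁⟩ := hf
  have hD := isClosed_exists_subgrad (f := f) (u := u) (w := w) hc (θ - 1) (θ + 1)
    (((isClosed_tangent (u := u) (w := w)).inter (isClosed_le
      (continuous_const (y := (0 : ℝ))) (continuous_ellipse_angRate (u := u) (w := w)))).inter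
    (isClosed_le (continuous_dot_const (ellipse u w (θ + Real.pi / 2)))
      (continuous_const (y := p₁ ⬝ᵥ ellipse u w (θ + Real.pi / 2)))))
  have h1 := hD.isOpen_compl.mem_nhds (show θ ∈ _ by
    rintro ⟨-, p, hp, B, hB, ⟨h0, ha⟩, hle⟩
    exact absurd (corner_lt hdef hinv h hne hp hB h0 ha hp₁ hB₁ h₁ ha₁) (not_lt.2 hle))
  filter_upwards [mem_nhdsWithin_of_mem_nhds h1,
    Ico_mem_nhdsLT (show θ - 1 < θ by linarith)] with θ' h2 h3 h4
  obtain ⟨p, hp, B, hB, h0, ha⟩ := h4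
  refine h2 ⟨⟨h3.1, by linarith [h3.2]⟩, p, hp, B, hB, ⟨h0, ha⟩, ?_⟩
  exact subgrad_mono_left h3.2 (by linarith [h3.1, Real.pi_gt_three]) hp₁ hp

/-- There are no corners. -/
lemma not_forward_and_backward (hc : IsCompact 𝓑) (hdef : ∀ v, f v = 0 → v = 0)
    (hinv : IsInvariantFor 𝓑 f) (hext : ∀ x, ∃ B ∈ 𝓑, ∃ p ∈ Subgrad f x, p ⬝ᵥ (B *ᵥ x) = 0)
    (h : area u w ≠ 0) (hne : ∀ B ∈ convexHull ℝ 𝓑, ∀ x, x ≠ 0 → B *ᵥ x ≠ 0) (θ : ℝ) :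
    ¬ (IsForward 𝓑 f u w θ ∧ IsBackward 𝓑 f u w θ) := by
  rintro ⟨hF, hB⟩
  set θ₁ := θ + 2 * Real.pi with hθ₁
  have hlt : θ < θ₁ := by linarith [Real.pi_pos]
  -- Forwardness spreads to the right: it is closed, and just right of a forward direction there are
  -- no backward ones. After a full turn it arrives from the left at the original direction, which
  -- is backward, contradicting `corner_left`.
  have hall : Icc θ θ₁ ⊆ {θ | IsForward 𝓑 f u w θ} := by
    refine IsClosed.Icc_subset_of_forall_mem_nhdsWithin ?_ hF ?_
    · convert isClosed_forward (f := f) (u := u) (w := w) hc θ θ₁ using 1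
      ext; simp [and_comm]
    · rintro θ' ⟨hF', -⟩
      have h1 : ∀ᶠ θ'' in 𝓝[>] θ', ¬ IsBackward 𝓑 f u w θ'' :=
        corner_right hc hdef hinv h hne hF'
      filter_upwards [h1] with θ'' h2
      exact (isForward_or_isBackward hext θ'').resolve_right h2
  have hB₁ : IsBackward 𝓑 f u w θ₁ := by
    have e := ellipse_periodic u w θ
    unfold IsBackward
    rw [hθ₁, e]
    exact hB
  have h1 := corner_left hc hdef hinv h hne hB₁
  obtain ⟨θ', h2, h3⟩ := (h1.and (Ico_mem_nhdsLT hlt)).exists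
  exact h2 (hall ⟨h3.1, h3.2.le⟩)

/-- Forward and backward directions form closed sets that cover each interval and are disjoint, so
connectedness leaves only one of them. -/
lemma all_forward_or_all_backward (hc : IsCompact 𝓑) (hdef : ∀ v, f v = 0 → v = 0)
    (hinv : IsInvariantFor 𝓑 f) (hext : ∀ x, ∃ B ∈ 𝓑, ∃ p ∈ Subgrad f x, p ⬝ᵥ (B *ᵥ x) = 0)
    (h : area u w ≠ 0) (hne : ∀ B ∈ convexHull ℝ 𝓑, ∀ x, x ≠ 0 → B *ᵥ x ≠ 0) :
    (∀ θ, ¬ IsBackward 𝓑 f u w θ) ∨ (∀ θ, ¬ IsForward 𝓑 f u w θ) := by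
  by_contra! hcon
  obtain ⟨⟨θ₁, h₁⟩, θ₂, h₂⟩ := hcon
  have hpre : IsPreconnected (Icc (min θ₁ θ₂) (max θ₁ θ₂)) := isPreconnected_Icc
  have m₁ : θ₁ ∈ Icc (min θ₁ θ₂) (max θ₁ θ₂) := ⟨min_le_left _ _, le_max_left _ _⟩
  have m₂ : θ₂ ∈ Icc (min θ₁ θ₂) (max θ₁ θ₂) := ⟨min_le_right _ _, le_max_right _ _⟩
  obtain ⟨θ, -, h3, h4⟩ := isPreconnected_closed_iff.1 hpre _ _
    (isClosed_forward (f := f) (u := u) (w := w) hc _ _)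
    (isClosed_backward (f := f) (u := u) (w := w) hc _ _)
    (fun θ hθ => (isForward_or_isBackward hext θ).imp (fun h => ⟨hθ, h⟩) fun h => ⟨hθ, h⟩)
    ⟨θ₂, m₂, m₂, h₂⟩ ⟨θ₁, m₁, m₁, h₁⟩
  exact not_forward_and_backward hc hdef hinv hext h hne θ ⟨h3.2, h4.2⟩

/-- Some orientation of the standard frame has no backward tangent velocities. -/
lemma exists_oriented_frame (hc : IsCompact 𝓑) (hdef : ∀ v, f v = 0 → v = 0)
    (hinv : IsInvariantFor 𝓑 f) (hext : ∀ x, ∃ B ∈ 𝓑, ∃ p ∈ Subgrad f x, p ⬝ᵥ (B *ᵥ x) = 0)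
    (hne : ∀ B ∈ convexHull ℝ 𝓑, ∀ x, x ≠ 0 → B *ᵥ x ≠ 0) :
    ∃ u w : Plane, area u w ≠ 0 ∧ ∀ θ, ¬ IsBackward 𝓑 f u w θ := by
  have h1 : area ![1, 0] ![0, 1] ≠ 0 := by simp [area]
  rcases all_forward_or_all_backward hc hdef hinv hext h1 hne with h | h
  · exact ⟨_, _, h1, h⟩
  · refine ⟨![1, 0], -![0, 1], by simp [area], fun θ hθ => h (-θ) ?_⟩
    have := IsBackward.isForward_neg (θ := -θ) (by rwa [neg_neg])
    rwa [neg_neg] at this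

end Tangent


/-! ### Smoothness of the unit sphere -/

/-- `f` is an invariant norm with tangent velocities in `𝓑` everywhere, all of which point forward
in the frame `(u, w)`. -/
structure IsOriented (𝓑 : Set Mat) (f : Seminorm ℝ Plane) (u w : Plane) : Prop where
  isCompact : IsCompact 𝓑
  definite : ∀ v, f v = 0 → v = 0
  invariant : IsInvariantFor 𝓑 f
  tangent : ∀ x, ∃ B ∈ 𝓑, ∃ p ∈ Subgrad f x, p ⬝ᵥ (B *ᵥ x) = 0
  frame : area u w ≠ 0
  not_backward : ∀ θ, ¬ IsBackward 𝓑 f u w θ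

/-- A subgradient of `f` at the point of the ellipse with parameter `θ`. -/
noncomputable def support (f : Seminorm ℝ Plane) (u w : Plane) (θ : ℝ) : Plane :=
  (subgrad_nonempty f (ellipse u w θ)).some

namespace IsOriented

variable {𝓑 : Set Mat} {f : Seminorm ℝ Plane} {u w : Plane} (h : IsOriented 𝓑 f u w)

lemma support_mem (f : Seminorm ℝ Plane) (u w : Plane) (θ : ℝ) :
    support f u w θ ∈ Subgrad f (ellipse u w θ) := (subgrad_nonempty f (ellipse u w θ)).some_mem

include h

lemma angRate_pos {θ : ℝ} {p : Plane} (hp : p ∈ Subgrad f (ellipse u w θ)) {B : Mat} (hB : B ∈ 𝓑)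
    (h0 : p ⬝ᵥ (B *ᵥ ellipse u w θ) = 0) : 0 < angRate u w B (ellipse u w θ) := by
  by_contra! hcon
  exact h.not_backward θ ⟨p, hp, B, hB, h0, hcon⟩

/-- Directions slightly to the left of `θ` carry tangent velocities whose subgradients pair with the
rotated vector at most as largely as `p'`. In the limit some tangent subgradient at `θ` does so;
being forward, it is the greatest one by `forward_max`, so it dominates `p`. -/
lemma subgrad_le {θ : ℝ} {p p' : Plane} (hp : p ∈ Subgrad f (ellipse u w θ))
    (hp' : p' ∈ Subgrad f (ellipse u w θ)) :
    p ⬝ᵥ ellipse u w (θ + Real.pi / 2) ≤ p' ⬝ᵥ ellipse u w (θ + Real.pi / 2) := by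
  by_contra! hlt
  have hD := isClosed_exists_subgrad (f := f) (u := u) (w := w) h.isCompact (θ - 1) (θ + 1)
    ((isClosed_tangent (u := u) (w := w)).inter
    (isClosed_le (continuous_dot_const (ellipse u w (θ + Real.pi / 2)))
      (continuous_const (y := p' ⬝ᵥ ellipse u w (θ + Real.pi / 2)))))
  have h1 := hD.isOpen_compl.mem_nhds (show θ ∈ _ by
    rintro ⟨-, q, hq, B, hB, h0, hle⟩
    exact absurd ((forward_max h.invariant h.frame hp hq hB h0 (h.angRate_pos hq hB h0)).trans hle)
      (not_le.2 hlt))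
  obtain ⟨θ', h2, h3⟩ := (𝓝[<] θ).nonempty_of_mem (inter_mem (mem_nhdsWithin_of_mem_nhds h1)
    (Ico_mem_nhdsLT (show θ - 1 < θ by linarith)))
  obtain ⟨B, hB, q, hq, h0⟩ := h.tangent (ellipse u w θ')
  refine h2 ⟨⟨h3.1, by linarith [h3.2]⟩, q, hq, B, hB, h0, ?_⟩
  exact subgrad_mono_left h3.2 (by linarith [h3.1, Real.pi_gt_three]) hp' hq

lemma subgrad_unique {θ : ℝ} {p p' : Plane} (hp : p ∈ Subgrad f (ellipse u w θ))
    (hp' : p' ∈ Subgrad f (ellipse u w θ)) : p = p' := by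
  have h1 := le_antisymm (h.subgrad_le hp hp') (h.subgrad_le hp' hp)
  have h2 := hp.1.trans hp'.1.symm
  have ha := area_ellipse u w θ
  set e := ellipse u w θ
  set e' := ellipse u w (θ + Real.pi / 2)
  have hne : e 0 * e' 1 - e 1 * e' 0 ≠ 0 := by
    have := h.frame
    rw [← ha] at this
    exact this
  simp only [dotProduct, Fin.sum_univ_two] at h1 h2
  ext i
  refine mul_right_cancel₀ hne ?_
  fin_cases i <;> simp only [Fin.zero_eta, Fin.mk_one]
  · linear_combination e' 1 * h2 - e 1 * h1
  · linear_combination e 0 * h1 - e' 0 * h2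

lemma exists_tangent (θ : ℝ) : ∃ B ∈ 𝓑, support f u w θ ⬝ᵥ (B *ᵥ ellipse u w θ) = 0 := by
  obtain ⟨B, hB, p, hp, h0⟩ := h.tangent (ellipse u w θ)
  exact ⟨B, hB, by rwa [h.subgrad_unique (support_mem f u w θ) hp]⟩

/-- A bounded relation with closed graph and unique values is a continuous function. -/
lemma support_continuous : Continuous (support f u w) := by
  refine continuous_iff_continuousAt.2 fun θ U hU => ?_
  obtain ⟨V, hVU, hV, hmem⟩ := mem_nhds_iff.1 hU
  have hD := isClosed_exists_subgrad (f := f) (u := u) (w := w) h.isCompact (θ - 1) (θ + 1)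
    (hV.isClosed_compl.preimage (show Continuous fun q : ℝ × Plane × Mat => q.2.1 by fun_prop))
  have h1 := hD.isOpen_compl.mem_nhds (show θ ∈ _ by
    rintro ⟨-, q, hq, B, hB, h0⟩
    refine h0 ?_
    change q ∈ V
    rwa [h.subgrad_unique hq (support_mem f u w θ)])
  refine mem_map.2 ?_
  filter_upwards [h1, Icc_mem_nhds (show θ - 1 < θ by linarith) (show θ < θ + 1 by linarith)]
    with θ' h2 h3
  obtain ⟨B, hB, -⟩ := h.exists_tangent θ'
  by_contra hcon
  exact h2 ⟨h3, _, support_mem f u w θ', B, hB, fun h4 => hcon (hVU h4)⟩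

/-- The subgradient inequalities at `θ` and `θ'` squeeze the difference quotient between the
pairings of `slope` with the two supports, which have a common limit. -/
lemma hasDerivAt_seminorm_ellipse (θ : ℝ) : HasDerivAt (fun θ => f (ellipse u w θ))
    (support f u w θ ⬝ᵥ ellipse u w (θ + Real.pi / 2)) θ := by
  rw [hasDerivAt_iff_tendsto_slope]
  have h1 := hasDerivAt_iff_tendsto_slope.1 (ellipse_hasDerivAt u w θ)
  have hcont : Continuous fun q : Plane × Plane => q.1 ⬝ᵥ q.2 := by
    simp only [dotProduct]; fun_prop
  have h2 : Tendsto (fun θ' => support f u w θ ⬝ᵥ slope (ellipse u w) θ θ') (𝓝[≠] θ)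
      (𝓝 (support f u w θ ⬝ᵥ ellipse u w (θ + Real.pi / 2))) :=
    (hcont.tendsto (_, _)).comp (tendsto_const_nhds.prodMk_nhds h1)
  have h3 : Tendsto (fun θ' => support f u w θ' ⬝ᵥ slope (ellipse u w) θ θ') (𝓝[≠] θ)
      (𝓝 (support f u w θ ⬝ᵥ ellipse u w (θ + Real.pi / 2))) :=
    (hcont.tendsto (_, _)).comp
      (((h.support_continuous.tendsto θ).mono_left nhdsWithin_le_nhds).prodMk_nhds h1)
  have h4 := h2.min h3
  have h5 := h2.max h3
  rw [min_self] at h4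
  rw [max_self] at h5
  have key : ∀ θ', support f u w θ ⬝ᵥ (ellipse u w θ' - ellipse u w θ) ≤
      f (ellipse u w θ') - f (ellipse u w θ) ∧ f (ellipse u w θ') - f (ellipse u w θ) ≤
      support f u w θ' ⬝ᵥ (ellipse u w θ' - ellipse u w θ) := by
    intro θ'
    have hp := support_mem f u w θ
    have hp' := support_mem f u w θ'
    have := hp.1
    have := hp'.1
    have := hp.2 (ellipse u w θ')
    have := hp'.2 (ellipse u w θ)
    rw [dotProduct_sub, dotProduct_sub]
    constructor <;> linarith
  refine tendsto_of_tendsto_of_tendsto_of_le_of_le' h4 h5 ?_ ?_ <;>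
  · filter_upwards [self_mem_nhdsWithin] with θ' hθ'
    obtain ⟨k1, k2⟩ := key θ'
    simp only [slope, vsub_eq_sub, dotProduct_smul, smul_eq_mul]
    rcases lt_or_gt_of_ne (show θ' ≠ θ from hθ') with hl | hl
    · have hi : (θ' - θ)⁻¹ ≤ 0 := inv_nonpos.2 (by linarith)
      have m1 := mul_le_mul_of_nonpos_left k1 hi
      have m2 := mul_le_mul_of_nonpos_left k2 hi
      first | exact (min_le_right _ _).trans m2 | exact m1.trans (le_max_left _ _)
    · have hi : 0 ≤ (θ' - θ)⁻¹ := inv_nonneg.2 (by linarith)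
      have m1 := mul_le_mul_of_nonneg_left k1 hi
      have m2 := mul_le_mul_of_nonneg_left k2 hi
      first | exact (min_le_left _ _).trans m1 | exact m2.trans (le_max_right _ _)

lemma contDiff_seminorm_ellipse : ContDiff ℝ 1 fun θ => f (ellipse u w θ) := by
  rw [contDiff_one_iff_deriv]
  refine ⟨fun θ => (h.hasDerivAt_seminorm_ellipse θ).differentiableAt, ?_⟩
  have : deriv (fun θ => f (ellipse u w θ)) =
      fun θ => support f u w θ ⬝ᵥ ellipse u w (θ + Real.pi / 2) :=
    funext fun θ => (h.hasDerivAt_seminorm_ellipse θ).deriv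
  rw [this]
  have h1 := h.support_continuous
  have h2 : Continuous fun θ => ellipse u w (θ + Real.pi / 2) :=
    (ellipse_continuous u w).comp (by fun_prop)
  simp only [dotProduct]
  fun_prop

/-- Tangency makes the derivative of the radial parametrization parallel to the velocity. Hence, if
the angle moves at the speed `angRate`, the curve solves `ẋ = B x`. -/
lemma sphereCurve_hasDerivAt {θ : ℝ} {B : Mat} 
    (h0 : support f u w θ ⬝ᵥ (B *ᵥ ellipse u w θ) = 0)
    (hω : angRate u w B (ellipse u w θ) ≠ 0) :
    HasDerivAt (sphereCurve f u w)
      ((angRate u w B (ellipse u w θ))⁻¹ • (B *ᵥ sphereCurve f u w θ)) θ := by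
  have hpos := seminorm_ellipse_pos h.definite h.frame θ
  have h1 := ((h.hasDerivAt_seminorm_ellipse θ).inv hpos.ne').smul (ellipse_hasDerivAt u w θ)
  obtain ⟨r, hr⟩ := mulVec_ellipse h.frame B θ
  set ω := angRate u w B (ellipse u w θ)
  have h2 : r * f (ellipse u w θ) + ω * (support f u w θ ⬝ᵥ ellipse u w (θ + Real.pi / 2)) = 0 := by
    rw [hr, dotProduct_add, dotProduct_smul, dotProduct_smul, (support_mem f u w θ).1] at h0
    exact h0
  have h3 : support f u w θ ⬝ᵥ ellipse u w (θ + Real.pi / 2) = -(r * f (ellipse u w θ)) / ω := by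
    rw [eq_div_iff hω]; linarith
  refine HasDerivAt.congr_deriv (f := sphereCurve f u w) h1 ?_
  rw [h3, sphereCurve, Matrix.mulVec_smul, hr]
  ext i
  simp only [Pi.add_apply, Pi.smul_apply, smul_eq_mul, Pi.inv_apply]
  field_simp
  ring

/-- On `𝓑` tangent velocities have positive rate, and for the others the term with `K` is negative,
so compactness yields uniform constants. The inequality is affine in `B` and thus extends to the
hull, where it bounds the rate of tangent velocities below by `c`. -/
lemma exists_angRate_lower : ∃ c > (0 : ℝ), ∃ K ≥ (0 : ℝ), ∀ θ, ∀ p ∈ Subgrad f (ellipse u w θ),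
    ∀ B ∈ convexHull ℝ 𝓑, c + K * (p ⬝ᵥ (B *ᵥ ellipse u w θ)) ≤ angRate u w B (ellipse u w θ) := by
  have hK := isCompact_ellipse_graph (f := f) (u := u) (w := w) h.isCompact 0 (2 * Real.pi)
  set U : ℕ → Set (ℝ × Plane × Mat) := fun n => {q | 1 / ((n : ℝ) + 1) <
    angRate u w q.2.2 (ellipse u w q.1) + n * |q.2.1 ⬝ᵥ (q.2.2 *ᵥ ellipse u w q.1)|} with hU
  have hopen : ∀ n, IsOpen (U n) := fun n => isOpen_lt continuous_const
    (continuous_ellipse_angRate.add (continuous_const.mul continuous_ellipse_pairing.abs))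
  have hmono : Monotone U := by
    intro m n hmn q hq
    have hmn' : (m : ℝ) ≤ n := by exact_mod_cast hmn
    have h1 : 1 / ((n : ℝ) + 1) ≤ 1 / ((m : ℝ) + 1) :=
      one_div_le_one_div_of_le (by positivity) (by linarith)
    have h2 := mul_le_mul_of_nonneg_right hmn' (abs_nonneg (q.2.1 ⬝ᵥ (q.2.2 *ᵥ ellipse u w q.1)))
    exact (h1.trans_lt hq).trans_le (by linarith)
  obtain ⟨n, hn⟩ := hK.elim_directed_cover U hopen (by
    rintro ⟨θ, p, B⟩ ⟨-, hp, hB⟩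
    simp only [mem_iUnion, hU, mem_ofPred_eq]
    dsimp only at hp hB
    rcases eq_or_ne (p ⬝ᵥ (B *ᵥ ellipse u w θ)) 0 with h0 | h0
    · obtain ⟨n, hn⟩ := exists_nat_one_div_lt (h.angRate_pos hp hB h0)
      exact ⟨n, by rw [h0]; simpa using hn⟩
    · obtain ⟨n, hn⟩ := exists_nat_gt
        ((1 - angRate u w B (ellipse u w θ)) / |p ⬝ᵥ (B *ᵥ ellipse u w θ)|)
      rw [div_lt_iff₀ (abs_pos.2 h0)] at hn
      have : 1 / ((n : ℝ) + 1) ≤ 1 := by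
        rw [div_le_one (by positivity)]; linarith [Nat.cast_nonneg (α := ℝ) n]
      exact ⟨n, by linarith⟩) hmono.directed_le
  refine ⟨1 / ((n : ℝ) + 1), by positivity, n, Nat.cast_nonneg n, fun θ p hp B hB => ?_⟩
  have hconv : Convex ℝ {B : Mat | 1 / ((n : ℝ) + 1) + n * (p ⬝ᵥ (B *ᵥ ellipse u w θ)) ≤
      angRate u w B (ellipse u w θ)} := by
    intro A hA B hB a b ha hb hab
    simp only [mem_ofPred_eq] at hA hB ⊢
    rw [angRate_combo, pairing_combo]
    have := mul_le_mul_of_nonneg_left hA ha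
    have := mul_le_mul_of_nonneg_left hB hb
    have e : 1 / ((n : ℝ) + 1) = a * (1 / ((n : ℝ) + 1)) + b * (1 / ((n : ℝ) + 1)) := by
      rw [← add_mul, hab, one_mul]
    linarith
  refine convexHull_min (fun B hB => ?_) hconv hB
  -- The compact graph covers one turn only, so the direction is reduced modulo `2π`.
  obtain ⟨θ', hθ', he⟩ := (ellipse_periodic u w).exists_mem_Ico₀ (by positivity) θ
  rw [he] at hp
  have h1 : (θ', p, B) ∈ U n := hn ⟨⟨hθ'.1, hθ'.2.le⟩, hp, hB⟩
  have h2 := h.invariant _ B hB p hp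
  simp only [hU, mem_ofPred_eq] at h1 ⊢
  rw [abs_of_nonpos h2] at h1
  rw [he]
  linarith

lemma exists_angRate_upper : ∃ C > (0 : ℝ), ∀ θ, ∀ B ∈ convexHull ℝ 𝓑,
    |angRate u w B (ellipse u w θ)| ≤ C := by
  have hK := isCompact_ellipse_graph (f := f) (u := u) (w := w) h.isCompact 0 (2 * Real.pi)
  obtain ⟨C, hC⟩ := (hK.image (continuous_ellipse_angRate (u := u) (w := w)).abs).bddAbove
  refine ⟨max C 1, by positivity, fun θ B hB => ?_⟩
  have hconv : Convex ℝ {B : Mat | |angRate u w B (ellipse u w θ)| ≤ max C 1} := by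
    intro A hA B hB a b ha hb hab
    simp only [mem_ofPred_eq] at hA hB ⊢
    rw [angRate_combo]
    rw [abs_le] at hA hB ⊢
    have := mul_le_mul_of_nonneg_left hA.1 ha
    have := mul_le_mul_of_nonneg_left hB.1 hb
    have := mul_le_mul_of_nonneg_left hA.2 ha
    have := mul_le_mul_of_nonneg_left hB.2 hb
    have e : max C 1 = a * max C 1 + b * max C 1 := by
      rw [← add_mul, hab, one_mul]
    constructor <;> linarith
  refine convexHull_min (fun B hB => ?_) hconv hB
  obtain ⟨θ', hθ', he⟩ := (ellipse_periodic u w).exists_mem_Ico₀ (by positivity) θ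
  have h1 := hC ⟨(θ', support f u w θ', B), ⟨⟨hθ'.1, hθ'.2.le⟩, support_mem f u w θ', hB⟩, rfl⟩
  simp only [mem_ofPred_eq]
  rw [he]
  exact le_max_of_le_left h1

end IsOriented


/-! ### Measurable selection from a closed relation -/

/-- The minimum of a continuous function over the fibres of a closed relation with compact target
is measurable. -/
lemma exists_measurable_min {Ω Y X : Type*} [MeasurableSpace Ω] [TopologicalSpace Y]
    [MeasurableSpace Y] [OpensMeasurableSpace Y] [TopologicalSpace X] [CompactSpace X] {φ : Ω → Y}
    (hφ : Measurable φ) {C : Set (Y × X)} (hC : IsClosed C) (hne : ∀ ω, ∃ x, (φ ω, x) ∈ C)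
    {g : X → ℝ} (hg : Continuous g) :
    ∃ m : Ω → ℝ, Measurable m ∧ ∀ ω, ∃ x, (φ ω, x) ∈ C ∧ g x = m ω := by
  have h1 : ∀ ω, ∃ x, (φ ω, x) ∈ C ∧ ∀ x', (φ ω, x') ∈ C → g x ≤ g x' := by
    intro ω
    have hcl : IsClosed {x | (φ ω, x) ∈ C} := hC.preimage (by fun_prop)
    obtain ⟨x, hx, hmin⟩ := hcl.isCompact.exists_isMinOn (hne ω) hg.continuousOn
    exact ⟨x, hx, fun x' hx' => hmin hx'⟩
  choose ξ hξ hmin using h1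
  refine ⟨fun ω => g (ξ ω), measurable_of_Iic fun a => ?_, fun ω => ⟨ξ ω, hξ ω, rfl⟩⟩
  -- The sublevel set of the minimum is the preimage of the projection of a closed set along the
  -- compact factor.
  have hcl : IsClosed (Prod.fst '' (C ∩ {q : Y × X | g q.2 ≤ a})) :=
    isClosedMap_fst_of_compactSpace _ (hC.inter (isClosed_le (by fun_prop) continuous_const))
  convert hφ hcl.measurableSet using 1
  ext ω
  simp only [mem_preimage, mem_Iic, mem_image, Prod.exists, exists_and_right, exists_eq_right]
  constructor
  · intro h; exact ⟨ξ ω, hξ ω, h⟩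
  · rintro ⟨x, hx, hxa⟩; exact (hmin ω x hx).trans hxa

/-- Adjoining the minimal value as a parameter keeps the relation closed, so that minimization can
be iterated. -/
lemma exists_measurable_min_graph {Ω Y X : Type*} [MeasurableSpace Ω] [TopologicalSpace Y]
    [MeasurableSpace Y] [OpensMeasurableSpace Y] [TopologicalSpace X] [CompactSpace X] {φ : Ω → Y}
    (hφ : Measurable φ) {C : Set (Y × X)} (hC : IsClosed C) (hne : ∀ ω, ∃ x, (φ ω, x) ∈ C)
    {g : X → ℝ} (hg : Continuous g) :
    ∃ m : Ω → ℝ, Measurable m ∧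
      IsClosed {q : (Y × ℝ) × X | (q.1.1, q.2) ∈ C ∧ g q.2 = q.1.2} ∧
      ∀ ω, ∃ x, ((φ ω, m ω), x) ∈ {q : (Y × ℝ) × X | (q.1.1, q.2) ∈ C ∧ g q.2 = q.1.2} := by
  obtain ⟨m, hm, h⟩ := exists_measurable_min hφ hC hne hg
  exact ⟨m, hm, (hC.preimage (by fun_prop)).inter
    (isClosed_eq (by fun_prop) (by fun_prop)), h⟩

/-- Measurable selection of matrices from a closed relation. -/
lemma exists_measurable_matrix {𝓑 : Set Mat} (hc : IsCompact 𝓑) {C : Set (ℝ × Mat)}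
    (hC : IsClosed C) (hne : ∀ θ, ∃ B ∈ 𝓑, (θ, B) ∈ C) :
    ∃ D : ℝ → Mat, (∀ i j, Measurable fun θ => D θ i j) ∧ ∀ θ, D θ ∈ 𝓑 ∧ (θ, D θ) ∈ C := by
  have : CompactSpace 𝓑 := isCompact_iff_compactSpace.1 hc
  have hC0 : IsClosed {q : ℝ × 𝓑 | (q.1, (q.2 : Mat)) ∈ C} := hC.preimage (by fun_prop)
  have hent : ∀ i j, Continuous fun B : 𝓑 => (B : Mat) i j := fun i j =>
    (continuous_apply_apply i j).comp continuous_subtype_val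
  -- Minimizing the four entries lexicographically determines the matrix, each entry being one of
  -- the measurable minima.
  obtain ⟨m₁, hm₁, hC₁, h₁⟩ := exists_measurable_min_graph measurable_id hC0
    (fun θ => by obtain ⟨B, hB, h⟩ := hne θ; exact ⟨⟨B, hB⟩, h⟩) (hent 0 0)
  have p₁ := measurable_id.prodMk hm₁
  obtain ⟨m₂, hm₂, hC₂, h₂⟩ := exists_measurable_min_graph p₁ hC₁ h₁ (hent 0 1)
  have p₂ := p₁.prodMk hm₂
  obtain ⟨m₃, hm₃, hC₃, h₃⟩ := exists_measurable_min_graph p₂ hC₂ h₂ (hent 1 0)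
  have p₃ := p₂.prodMk hm₃
  obtain ⟨m₄, hm₄, hC₄, h₄⟩ := exists_measurable_min_graph p₃ hC₃ h₃ (hent 1 1)
  choose B hB using h₄
  refine ⟨fun θ => B θ, fun i j => ?_, fun θ => ⟨(B θ).2, (hB θ).1.1.1.1⟩⟩
  fin_cases i <;> fin_cases j
  · convert hm₁ using 1; exact funext fun θ => (hB θ).1.1.1.2
  · convert hm₂ using 1; exact funext fun θ => (hB θ).1.1.2
  · convert hm₃ using 1; exact funext fun θ => (hB θ).1.2
  · convert hm₄ using 1; exact funext fun θ => (hB θ).2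

/-! ### Change of time -/

/-- The primitive of a periodic measurable function with values in `[a, b]`, `a > 0`, and its
inverse. -/
lemma exists_clock {ρ : ℝ → ℝ} (hm : Measurable ρ) {a b L : ℝ} (ha : 0 < a) (hlow : ∀ θ, a ≤ ρ θ)
    (hupp : ∀ θ, ρ θ ≤ b) (hper : Function.Periodic ρ L) :
    ∃ e : ℝ ≃o ℝ, e 0 = 0 ∧ (∀ θ, e (θ + L) = e θ + e L) ∧
      (∃ K : ℝ≥0, LipschitzWith K e.symm) ∧ ∀ᵐ t, HasDerivAt e.symm (ρ (e.symm t))⁻¹ t := by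
  have hb : 0 < b := ha.trans_le ((hlow 0).trans (hupp 0))
  have hloc : LocallyIntegrable ρ volume := by
    refine (locallyIntegrable_const b).mono hm.aestronglyMeasurable (Eventually.of_forall fun θ => ?_)
    rw [Real.norm_of_nonneg (ha.le.trans (hlow θ)), Real.norm_of_nonneg hb.le]
    exact hupp θ
  have hI : ∀ x y, IntervalIntegrable ρ volume x y := fun x y =>
    (hloc.integrableOn_isCompact isCompact_uIcc).intervalIntegrable
  set E : ℝ → ℝ := fun θ => ∫ s in (0 : ℝ)..θ, ρ s with hE
  have hsub : ∀ x y, E y - E x = ∫ s in x..y, ρ s := fun x y =>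
    intervalIntegral.integral_interval_sub_left (hI _ _) (hI _ _)
  have hl : ∀ x y, x ≤ y → a * (y - x) ≤ E y - E x := by
    intro x y hxy
    rw [hsub]
    have := intervalIntegral.integral_mono_on hxy (intervalIntegrable_const (c := a)) (hI x y)
      fun s _ => hlow s
    rwa [intervalIntegral.integral_const, smul_eq_mul, mul_comm] at this
  have hu : ∀ x y, x ≤ y → E y - E x ≤ b * (y - x) := by
    intro x y hxy
    rw [hsub]
    have := intervalIntegral.integral_mono_on hxy (hI x y) (intervalIntegrable_const (c := b))
      fun s _ => hupp s
    rwa [intervalIntegral.integral_const, smul_eq_mul, mul_comm b] at *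
  have hmono : StrictMono E := by
    intro x y hxy
    have := hl x y hxy.le
    have : 0 < a * (y - x) := mul_pos ha (by linarith)
    linarith
  have hlip : LipschitzWith (Real.toNNReal b) E := by
    refine LipschitzWith.of_dist_le_mul fun x y => ?_
    rw [Real.coe_toNNReal _ hb.le, Real.dist_eq, Real.dist_eq]
    rcases le_total x y with hxy | hxy
    · rw [abs_sub_comm, abs_sub_comm x, abs_of_nonneg (sub_nonneg.2 (hmono.monotone hxy)),
        abs_of_nonneg (sub_nonneg.2 hxy)]
      exact hu x y hxy
    · rw [abs_of_nonneg (sub_nonneg.2 (hmono.monotone hxy)), abs_of_nonneg (sub_nonneg.2 hxy)]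
      exact hu y x hxy
  have hE0 : E 0 = 0 := intervalIntegral.integral_same
  have htop : Tendsto E atTop atTop := by
    refine tendsto_atTop_mono' _ ?_ (tendsto_id.const_mul_atTop ha)
    filter_upwards [eventually_ge_atTop 0] with x hx
    have := hl 0 x hx
    rw [hE0] at this
    simpa using this
  have hbot : Tendsto E atBot atBot := by
    refine tendsto_atBot_mono' _ ?_ (tendsto_id.const_mul_atBot ha)
    filter_upwards [eventually_le_atBot 0] with x hx
    have := hl x 0 hx
    rw [hE0] at this
    simp only [id]
    linarith
  set e : ℝ ≃o ℝ := hmono.orderIsoOfSurjective E (hlip.continuous.surjective htop hbot) with he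
  have hee : ∀ θ, e θ = E θ := fun θ => rfl
  have hsl : LipschitzWith (Real.toNNReal a⁻¹) e.symm := by
    have key : ∀ s t, s ≤ t → e.symm t - e.symm s ≤ a⁻¹ * (t - s) := by
      intro s t hst
      have h1 := hl _ _ (e.symm.monotone hst)
      rw [← hee, ← hee, e.apply_symm_apply, e.apply_symm_apply] at h1
      rw [inv_mul_eq_div, le_div_iff₀ ha]
      linarith
    refine LipschitzWith.of_dist_le_mul fun x y => ?_
    rw [Real.coe_toNNReal _ (inv_pos.2 ha).le, Real.dist_eq, Real.dist_eq]
    rcases le_total x y with hxy | hxy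
    · rw [abs_sub_comm, abs_sub_comm x, abs_of_nonneg (sub_nonneg.2 (e.symm.monotone hxy)),
        abs_of_nonneg (sub_nonneg.2 hxy)]
      exact key x y hxy
    · rw [abs_of_nonneg (sub_nonneg.2 (e.symm.monotone hxy)), abs_of_nonneg (sub_nonneg.2 hxy)]
      exact key y x hxy
  refine ⟨e, hE0, fun θ => ?_, ⟨_, hsl⟩, ?_⟩
  · rw [hee, hee, hee, ← sub_eq_iff_eq_add', hsub]
    have := hper.intervalIntegral_add_eq θ 0
    rwa [zero_add] at this
  · have hN : volume {θ | ¬ HasDerivAt E (ρ θ) θ} = 0 := by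
      have := _root_.LocallyIntegrable.ae_hasDerivAt_integral hloc
      refine measure_mono_null (fun θ hθ => ?_) (ae_iff.1 this)
      intro hall
      exact hθ (hall 0)
    -- The exceptional times for the inverse are images of exceptional angles, and the Lipschitz map
    -- `E` sends null sets to null sets.
    have hN' : volume (E '' {θ | ¬ HasDerivAt E (ρ θ) θ}) = 0 := by
      rw [← hausdorffMeasure_real] at hN ⊢
      have := hlip.hausdorffMeasure_image_le zero_le_one {θ | ¬ HasDerivAt E (ρ θ) θ}
      rw [hN, mul_zero] at this
      exact le_antisymm this bot_le
    refine ae_iff.2 (measure_mono_null (fun t ht => ?_) hN')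
    refine ⟨e.symm t, fun hd => ht ?_, e.apply_symm_apply t⟩
    exact HasDerivAt.of_local_left_inverse hsl.continuous.continuousAt hd
      (ha.trans_le (hlow _)).ne' (Eventually.of_forall fun s => e.apply_symm_apply s)


/-! ### The periodic flow along the unit sphere -/

lemma ellipse_add_int_mul_pi (u w : Plane) (θ : ℝ) (n : ℤ) :
    ellipse u w (θ + n * Real.pi) = ellipse u w θ ∨
      ellipse u w (θ + n * Real.pi) = -ellipse u w θ := by
  simp only [ellipse, Real.cos_add_int_mul_pi, Real.sin_add_int_mul_pi]
  rcases Int.even_or_odd n with h | h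
  · left; simp [h.neg_one_zpow]
  · right; rw [h.neg_one_zpow]; module

namespace IsOriented

variable {𝓑 : Set Mat} {f : Seminorm ℝ Plane} {u w : Plane} (h : IsOriented 𝓑 f u w)

include h

/-- The selection is made on `[0, π)` and repeated: by central symmetry a matrix tangent at `x` is
tangent at `-x`. The period `π` instead of `2π` is why the law has period `T` while the curve closes
after `2T`. -/
lemma exists_selection : ∃ D : ℝ → Mat, (∀ i j, Measurable fun θ => D θ i j) ∧ (∀ θ, D θ ∈ 𝓑) ∧
    Function.Periodic D Real.pi ∧
    ∀ θ, support f u w θ ⬝ᵥ (D θ *ᵥ ellipse u w θ) = 0 := by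
  have hC : IsClosed {q : ℝ × Mat | support f u w q.1 ⬝ᵥ (q.2 *ᵥ ellipse u w q.1) = 0} := by
    refine isClosed_eq ?_ continuous_const
    have : Continuous fun q : ℝ × Mat => (ellipse u w q.1, support f u w q.1, q.2) :=
      ((ellipse_continuous u w).comp continuous_fst).prodMk
        ((h.support_continuous.comp continuous_fst).prodMk continuous_snd)
    exact continuous_pairing.comp this
  obtain ⟨D, hm, hD⟩ := exists_measurable_matrix h.isCompact hC h.exists_tangent
  have hr : Measurable fun θ : ℝ => Int.fract (θ / Real.pi) * Real.pi :=
    (measurable_fract.comp (measurable_id.div_const _)).mul_const _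
  refine ⟨fun θ => D (Int.fract (θ / Real.pi) * Real.pi), fun i j => (hm i j).comp hr,
    fun θ => (hD _).1, fun θ => ?_, fun θ => ?_⟩
  · have : (θ + Real.pi) / Real.pi = θ / Real.pi + 1 := by
      rw [add_div, div_self Real.pi_ne_zero]
    simp only [this, Int.fract_add_one]
  · set s := Int.fract (θ / Real.pi) * Real.pi with hs
    have hθ : θ = s + ⌊θ / Real.pi⌋ * Real.pi := by
      rw [hs, ← add_mul, Int.fract_add_floor, div_mul_cancel₀ _ Real.pi_ne_zero]
    have h0 : support f u w s ⬝ᵥ (D s *ᵥ ellipse u w s) = 0 := (hD s).2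
    have hp := support_mem f u w θ
    rcases ellipse_add_int_mul_pi u w s ⌊θ / Real.pi⌋ with he | he
    · rw [← hθ] at he
      rw [he] at hp ⊢
      rwa [h.subgrad_unique hp (support_mem f u w s)]
    · rw [← hθ] at he
      rw [he] at hp ⊢
      have hp' := subgrad_neg hp
      rw [neg_neg] at hp'
      rw [← h.subgrad_unique hp' (support_mem f u w s), neg_dotProduct, neg_eq_zero] at h0
      rw [Matrix.mulVec_neg, dotProduct_neg, h0, neg_zero]

/-- There is a periodic law with values in `𝓑` that moves the points along the unit sphere. -/
lemma exists_motion : ∃ (D : ℝ → Mat) (Θ : ℝ ≃o ℝ) (T : ℝ), 0 < T ∧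
    (∀ i j, Measurable fun t => D t i j) ∧ (∀ t, D t ∈ 𝓑) ∧ (∀ t, D (t + T) = D t) ∧ Θ 0 = 0 ∧
    (∀ t, Θ (t + T) = Θ t + Real.pi) ∧
    ∀ t₀, IsFlow (fun t => D (t₀ + t)) (fun t => sphereCurve f u w (Θ (t₀ + t))) := by
  obtain ⟨D, hm, hD, hper, h0⟩ := h.exists_selection
  obtain ⟨c, hc, K, -, hlow⟩ := h.exists_angRate_lower
  obtain ⟨C, hC, hupp⟩ := h.exists_angRate_upper
  set ω : ℝ → ℝ := fun θ => angRate u w (D θ) (ellipse u w θ) with hω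
  have hωc : ∀ θ, c ≤ ω θ := by
    intro θ
    have := hlow θ _ (support_mem f u w θ) (D θ) (subset_convexHull ℝ 𝓑 (hD θ))
    rwa [h0, mul_zero, add_zero] at this
  have hωC : ∀ θ, ω θ ≤ C := fun θ =>
    (le_abs_self _).trans (hupp θ (D θ) (subset_convexHull ℝ 𝓑 (hD θ)))
  have hωm : Measurable ω := by
    have he : ∀ i, Measurable fun θ => ellipse u w θ i := fun i =>
      ((continuous_apply i).comp (ellipse_continuous u w)).measurable
    have h00 := hm 0 0
    have h01 := hm 0 1
    have h10 := hm 1 0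
    have h11 := hm 1 1
    have he0 := he 0
    have he1 := he 1
    simp only [hω, angRate, area, Matrix.mulVec, dotProduct, Fin.sum_univ_two]
    fun_prop
  have hωper : Function.Periodic ω Real.pi := by
    intro θ
    simp only [hω, hper θ, ellipse_add_pi]
    simp only [angRate, area, Matrix.mulVec_neg, Pi.neg_apply]
    ring
  -- The density `1 / ω` is time per angle. The inverse of its primitive is the angle as a function
  -- of time, and `e π` is the duration of a half turn.
  obtain ⟨e, he0, heper, ⟨Ke, hKe⟩, hder⟩ := exists_clock (ρ := fun θ => (ω θ)⁻¹) hωm.inv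
    (a := C⁻¹) (b := c⁻¹) (inv_pos.2 hC)
    (fun θ => inv_anti₀ (hc.trans_le (hωc θ)) (hωC θ)) (fun θ => inv_anti₀ hc (hωc θ))
    (L := Real.pi) (fun θ => by simp only [hωper θ])
  have hΘ : ∀ t, e.symm (t + e Real.pi) = e.symm t + Real.pi := by
    intro t
    rw [e.symm_apply_eq, heper, e.apply_symm_apply]
  refine ⟨fun t => D (e.symm t), e.symm, e Real.pi, ?_, fun i j =>
    (hm i j).comp hKe.continuous.measurable, fun t => hD _, fun t => ?_, ?_, hΘ, fun t₀ => ⟨?_, ?_⟩⟩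
  · rw [← he0]; exact e.strictMono Real.pi_pos
  · simp only [hΘ]; exact hper _
  · rw [e.symm_apply_eq, he0]
  · intro T
    obtain ⟨K', hK'⟩ := (sphereCurve_contDiff h.definite h.frame
      h.contDiff_seminorm_ellipse).contDiffOn.exists_lipschitzOnWith (by decide)
      (convex_Icc (e.symm (t₀ + 0)) (e.symm (t₀ + T))) isCompact_Icc
    refine ⟨K' * (Ke * 1), hK'.comp (hKe.comp (isometry_add_left t₀).lipschitz).lipschitzOnWith ?_⟩
    intro t ht
    exact ⟨e.symm.monotone (by linarith [ht.1]), e.symm.monotone (by linarith [ht.2])⟩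
  · have := (measurePreserving_add_left volume t₀).quasiMeasurePreserving.ae hder
    filter_upwards [this] with t ht _
    have h1 := h.sphereCurve_hasDerivAt (h0 (e.symm (t₀ + t))) (hc.trans_le (hωc _)).ne'
    have h2 := ht.comp_const_add t₀ t
    have h3 := h1.scomp t h2
    refine h3.congr_deriv ?_
    rw [inv_inv, smul_smul]
    change (ω _ * (ω _)⁻¹) • _ = _
    rw [mul_inv_cancel₀ (hc.trans_le (hωc _)).ne', one_smul]

end IsOriented

/-! ### Absolutely continuous functions with a linear differential inequality -/

/-- The function `g ^ 2 * exp (-2 * κ * t)` does not increase; squares make the sign of `g`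
irrelevant. It yields both the decay of areas and, from `g 0 = 0`, the vanishing of `g`. -/
lemma sq_le_of_ae_deriv {g : ℝ → ℝ} {κ T : ℝ} (hT : 0 ≤ T)
    (hac : AbsolutelyContinuousOnInterval g 0 T)
    (hd : ∀ᵐ t : ℝ, t ∈ Ioc 0 T → ∃ g', HasDerivAt g g' t ∧ g t * g' ≤ κ * g t ^ 2) :
    g T ^ 2 ≤ g 0 ^ 2 * Real.exp (2 * κ * T) := by
  have hexp : ContDiff ℝ 1 fun t : ℝ => Real.exp (-(2 * κ) * t) := by fun_prop
  have hac' := (hac.mul hac).mul hexp.contDiffOn.absolutelyContinuousOnInterval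
  have h1 := hac'.integral_deriv_eq_sub
  have h2 : ∫ s in (0 : ℝ)..T, deriv (g * g * fun t : ℝ => Real.exp (-(2 * κ) * t)) s ≤
      ∫ _ in (0 : ℝ)..T, (0 : ℝ) := by
    apply intervalIntegral.integral_mono_ae_restrict hT hac'.intervalIntegrable_deriv (by simp)
    rw [EventuallyLE, ae_restrict_iff' measurableSet_Icc]
    have hne : ∀ᵐ t : ℝ, t ≠ 0 := by simp [ae_iff]
    filter_upwards [hd, hne] with t ht hne ht'
    obtain ⟨g', hg, hle⟩ := ht ⟨lt_of_le_of_ne ht'.1 hne.symm, ht'.2⟩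
    have he : HasDerivAt (fun t : ℝ => Real.exp (-(2 * κ) * t))
        (Real.exp (-(2 * κ) * t) * (-(2 * κ))) t := by
      simpa using ((hasDerivAt_id t).const_mul (-(2 * κ))).exp
    rw [((hg.mul hg).mul he).deriv]
    simp only [Pi.mul_apply]
    have := Real.exp_pos (-(2 * κ) * t)
    nlinarith
  rw [h1, intervalIntegral.integral_zero] at h2
  simp only [Pi.mul_apply, mul_zero, Real.exp_zero, mul_one, sub_nonpos] at h2
  have h3 := mul_le_mul_of_nonneg_right h2 (Real.exp_pos (2 * κ * T)).le
  rw [mul_assoc, ← Real.exp_add] at h3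
  have e : -(2 * κ) * T + 2 * κ * T = 0 := by ring
  rw [e, Real.exp_zero, mul_one] at h3
  rw [sq, sq]; exact h3

lemma absolutelyContinuousOnInterval_area {x y : ℝ → Plane} {a b : ℝ}
    (hx : ∀ i, AbsolutelyContinuousOnInterval (fun t => x t i) a b)
    (hy : ∀ i, AbsolutelyContinuousOnInterval (fun t => y t i) a b) :
    AbsolutelyContinuousOnInterval (fun t => area (x t) (y t)) a b :=
  ((hx 0).mul (hy 1)).sub ((hx 1).mul (hy 0))

lemma IsFlow.absolutelyContinuous {B : ℝ → Mat} {z : ℝ → Plane} (h : IsFlow B z) {T : ℝ}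
    (hT : 0 ≤ T) (i : Fin 2) : AbsolutelyContinuousOnInterval (fun t => z t i) 0 T := by
  obtain ⟨K, hK⟩ := h.1 T
  apply LipschitzOnWith.absolutelyContinuousOnInterval (K := K)
  rw [uIcc_of_le hT]
  exact LipschitzOnWith.coord hK i

lemma hasDerivAt_area {x y : ℝ → Plane} {x' y' : Plane} {t : ℝ} (hx : HasDerivAt x x' t)
    (hy : HasDerivAt y y' t) : HasDerivAt (fun t => area (x t) (y t))
      (area x' (y t) + area (x t) y') t := by
  have hx' := hasDerivAt_pi.1 hx
  have hy' := hasDerivAt_pi.1 hy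
  refine (((hx' 0).mul (hy' 1)).sub ((hx' 1).mul (hy' 0))).congr_deriv ?_
  simp only [area]
  ring

/-- The area spanned by two solutions decays if the traces are negative. -/
lemma IsFlow.area_sq_le {B : ℝ → Mat} {x y : ℝ → Plane} (hx : IsFlow B x) (hy : IsFlow B y) {δ : ℝ}
    (hB : ∀ t, 0 ≤ t → (B t).trace ≤ -δ) {T : ℝ} (hT : 0 ≤ T) :
    area (x T) (y T) ^ 2 ≤ area (x 0) (y 0) ^ 2 * Real.exp (2 * (-δ) * T) := by
  refine sq_le_of_ae_deriv (g := fun t => area (x t) (y t)) hT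
    (absolutelyContinuousOnInterval_area (hx.absolutelyContinuous hT)
      (hy.absolutelyContinuous hT)) ?_
  filter_upwards [hx.2, hy.2] with t h1 h2 ht
  refine ⟨_, hasDerivAt_area (h1 ht.1) (h2 ht.1), ?_⟩
  have e : area (B t *ᵥ x t) (y t) + area (x t) (B t *ᵥ y t) = (B t).trace * area (x t) (y t) := by
    simp only [area, Matrix.mulVec, dotProduct, Fin.sum_univ_two, Matrix.trace_fin_two]
    ring
  rw [e]
  have := hB t ht.1.le
  nlinarith [sq_nonneg (area (x t) (y t))]


/-! ### Polar angle along extremal flows -/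

lemma area_ellipse_ellipse (u w : Plane) (φ ψ : ℝ) :
    area (ellipse u w φ) (ellipse u w ψ) = area u w * Real.sin (ψ - φ) := by
  rw [Real.sin_sub]
  simp only [area, ellipse, Pi.add_apply, Pi.smul_apply, smul_eq_mul]
  ring

lemma area_smul_right (a : ℝ) (x y : Plane) : area x (a • y) = a * area x y := by
  simp only [area, Pi.smul_apply, smul_eq_mul]; ring

lemma area_smul_left (a : ℝ) (x y : Plane) : area (a • x) y = a * area x y := by
  simp only [area, Pi.smul_apply, smul_eq_mul]; ring

lemma area_add_right (x y y' : Plane) : area x (y + y') = area x y + area x y' := by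
  simp only [area, Pi.add_apply]; ring

lemma area_self (x : Plane) : area x x = 0 := by
  simp only [area]; ring

lemma abs_area_le (x y : Plane) : |area x y| ≤ 2 * (‖x‖ * ‖y‖) := by
  have h : ∀ i j, |x i * y j| ≤ ‖x‖ * ‖y‖ := fun i j => by
    rw [abs_mul]
    exact mul_le_mul (norm_le_pi_norm x i) (norm_le_pi_norm y j) (abs_nonneg _) (norm_nonneg _)
  have := abs_sub (x 0 * y 1) (x 1 * y 0)
  have := h 0 1
  have := h 1 0
  unfold area
  linarith

lemma norm_ellipse_le (u w : Plane) (θ : ℝ) : ‖ellipse u w θ‖ ≤ ‖u‖ + ‖w‖ := by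
  refine (norm_add_le _ _).trans (add_le_add ?_ ?_) <;> rw [norm_smul]
  · exact mul_le_of_le_one_left (norm_nonneg _) (Real.abs_cos_le_one θ)
  · exact mul_le_of_le_one_left (norm_nonneg _) (Real.abs_sin_le_one θ)

/-- The squared radius in the frame `(u, w)`, up to a constant factor. -/
noncomputable def radiusSq (u w x : Plane) : ℝ := (area x w ^ 2 + area u x ^ 2) / area u w

lemma radiusSq_smul_ellipse (u w : Plane) (R θ : ℝ) :
    radiusSq u w (R • ellipse u w θ) = R ^ 2 * area u w := by
  rcases eq_or_ne (area u w) 0 with h | h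
  · simp [radiusSq, h]
  rw [radiusSq, div_eq_iff h]
  have := Real.cos_sq_add_sin_sq θ
  simp only [area, ellipse, Pi.add_apply, Pi.smul_apply, smul_eq_mul]
  linear_combination (R ^ 2 * (u 0 * w 1 - u 1 * w 0) ^ 2) * this

/-- The radial rate of a velocity is bounded. -/
lemma exists_radial_bound {𝓑 : Set Mat} (hc : IsCompact 𝓑) {u w : Plane} (h : area u w ≠ 0) :
    ∃ κ : ℝ, ∀ θ, ∀ B ∈ convexHull ℝ 𝓑, ∃ s ≤ κ, B *ᵥ ellipse u w θ =
      s • ellipse u w θ + angRate u w B (ellipse u w θ) • ellipse u w (θ + Real.pi / 2) := by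
  obtain ⟨M, hM0, hM⟩ := isBounded_entries hc
  refine ⟨2 * (2 * M * (‖u‖ + ‖w‖) * (‖u‖ + ‖w‖)) / |area u w|, fun θ B hB => ?_⟩
  obtain ⟨s, hs⟩ := mulVec_ellipse h B θ
  refine ⟨s, ?_, hs⟩
  have h1 : area (ellipse u w (θ + Real.pi / 2)) (B *ᵥ ellipse u w θ) = -(s * area u w) := by
    rw [hs, area_add_right, area_smul_right, area_smul_right, area_self, area_ellipse_ellipse]
    rw [show θ - (θ + Real.pi / 2) = -(Real.pi / 2) by ring, Real.sin_neg, Real.sin_pi_div_two]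
    ring
  have h2 := abs_area_le (ellipse u w (θ + Real.pi / 2)) (B *ᵥ ellipse u w θ)
  rw [h1, abs_neg, abs_mul] at h2
  rw [le_div_iff₀ (abs_pos.2 h)]
  refine (mul_le_mul_of_nonneg_right (le_abs_self s) (abs_nonneg _)).trans (h2.trans ?_)
  have h3 := norm_ellipse_le u w (θ + Real.pi / 2)
  have h4 := (norm_mulVec_le (hM B hB) (ellipse u w θ)).trans
    (mul_le_mul_of_nonneg_left (norm_ellipse_le u w θ) (by positivity))
  have h5 := mul_le_mul h3 h4 (norm_nonneg _) (by positivity)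
  linarith

lemma LipschitzWith.ellipse_comp {φ : ℝ → ℝ} {K : ℝ≥0} (hφ : LipschitzWith K φ) (u w : Plane)
    (a b : ℝ) (i : Fin 2) :
    AbsolutelyContinuousOnInterval (fun t => ellipse u w (φ t) i) a b := by
  have hcos := (Real.lipschitzWith_cos.comp hφ).lipschitzOnWith (s := uIcc a b)
  have hsin := (Real.lipschitzWith_sin.comp hφ).lipschitzOnWith (s := uIcc a b)
  have h := (hcos.absolutelyContinuousOnInterval.const_mul (u i)).add
    (hsin.absolutelyContinuousOnInterval.const_mul (w i))
  refine (congrArg (AbsolutelyContinuousOnInterval · a b) (funext fun t => ?_)).mpr h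
  change Real.cos (φ t) * u i + Real.sin (φ t) * w i = u i * Real.cos (φ t) + w i * Real.sin (φ t)
  ring

/-- A bounded measurable rate which is bounded below for positive times has a Lipschitz primitive
which tends to infinity. -/
lemma exists_primitive {r : ℝ → ℝ} (hm : Measurable r) {c C : ℝ} (hc : 0 < c)
    (hC : ∀ᵐ t, |r t| ≤ C) (hlow : ∀ᵐ t : ℝ, 0 < t → c ≤ r t) (φ₀ : ℝ) :
    ∃ φ : ℝ → ℝ, φ 0 = φ₀ ∧ (∃ K, LipschitzWith K φ) ∧ StrictMonoOn φ (Ici 0) ∧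
      Tendsto φ atTop atTop ∧ ∀ᵐ t, HasDerivAt φ (r t) t := by
  have hloc : LocallyIntegrable r volume := by
    refine (locallyIntegrable_const C).mono hm.aestronglyMeasurable ?_
    filter_upwards [hC] with t ht
    exact ht.trans (le_abs_self C)
  have hI : ∀ x y, IntervalIntegrable r volume x y := fun x y =>
    (hloc.integrableOn_isCompact isCompact_uIcc).intervalIntegrable
  set φ : ℝ → ℝ := fun t => φ₀ + ∫ s in (0 : ℝ)..t, r s with hφ
  have hsub : ∀ x y, φ y - φ x = ∫ s in x..y, r s := fun x y => by
    simp only [hφ, add_sub_add_left_eq_sub]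
    exact intervalIntegral.integral_interval_sub_left (hI _ _) (hI _ _)
  have hφ0 : φ 0 = φ₀ := by simp [hφ]
  have hl : ∀ x y, 0 ≤ x → x ≤ y → c * (y - x) ≤ φ y - φ x := by
    intro x y hx hxy
    rw [hsub]
    have h1 : ∫ _ in x..y, c ≤ ∫ s in x..y, r s := by
      apply intervalIntegral.integral_mono_ae_restrict hxy (by simp) (hI x y)
      rw [EventuallyLE, ae_restrict_iff' measurableSet_Icc]
      have hne : ∀ᵐ t : ℝ, t ≠ 0 := by simp [ae_iff]
      filter_upwards [hlow, hne] with t ht hne ht'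
      exact ht (lt_of_le_of_ne (hx.trans ht'.1) hne.symm)
    rwa [intervalIntegral.integral_const, smul_eq_mul, mul_comm] at h1
  refine ⟨φ, hφ0, ⟨Real.toNNReal C, LipschitzWith.of_dist_le_mul fun x y => ?_⟩, ?_, ?_, ?_⟩
  · have hC0 : 0 ≤ C := by
      obtain ⟨t, ht⟩ := hC.exists
      exact (abs_nonneg _).trans ht
    rw [Real.coe_toNNReal _ hC0, Real.dist_eq, Real.dist_eq, hsub]
    refine intervalIntegral.norm_integral_le_of_norm_le_const_ae (f := r) ?_
    filter_upwards [hC] with t ht _ using ht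
  · intro x hx y _ hxy
    have := hl x y hx hxy.le
    have : 0 < c * (y - x) := mul_pos hc (by linarith)
    linarith
  · refine tendsto_atTop_mono' _ ?_ (tendsto_atTop_add_const_left _ φ₀
      (tendsto_id.const_mul_atTop hc))
    filter_upwards [eventually_ge_atTop 0] with x hx
    have := hl 0 x le_rfl hx
    rw [hφ0] at this
    simp only [id, sub_zero] at this ⊢
    linarith
  · filter_upwards [_root_.LocallyIntegrable.ae_hasDerivAt_integral hloc] with t ht
    exact (ht 0).const_add φ₀

lemma pos_of_ne_zero {g : ℝ → ℝ} (hg : ContinuousOn g (Ici 0)) (hne : ∀ t, 0 ≤ t → g t ≠ 0)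
    (h0 : 0 < g 0) {t : ℝ} (ht : 0 ≤ t) : 0 < g t := by
  by_contra! hcon
  obtain ⟨s, hs, hs0⟩ := intermediate_value_Icc' ht (hg.mono Icc_subset_Ici_self) ⟨hcon, h0.le⟩
  exact hne s hs.1 hs0

namespace IsOriented

variable {𝓑 : Set Mat} {f : Seminorm ℝ Plane} {u w : Plane} (h : IsOriented 𝓑 f u w)

include h

/-- A flow along a sphere of `f` has a strictly increasing polar angle. -/
lemma exists_polar_angle {B : ℝ → Mat} {z : ℝ → Plane} (hz : IsFlow B z)
    (hB : ∀ t, 0 ≤ t → B t ∈ convexHull ℝ 𝓑) (hf : ∀ t, 0 ≤ t → f (z t) = f (z 0))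
    (hz0 : z 0 ≠ 0) : ∃ φ : ℝ → ℝ, 0 ≤ φ 0 ∧ Continuous φ ∧ StrictMonoOn φ (Ici 0) ∧
      Tendsto φ atTop atTop ∧ ∀ t, 0 ≤ t → z t = f (z 0) • sphereCurve f u w (φ t) := by
  obtain ⟨c, hc, K, -, hlow⟩ := h.exists_angRate_lower
  obtain ⟨C, hC, hupp⟩ := h.exists_angRate_upper
  obtain ⟨κ, hκ⟩ := exists_radial_bound h.isCompact h.frame
  have hpos : 0 < f (z 0) := seminorm_pos h.definite hz0
  have hne : ∀ t, 0 ≤ t → z t ≠ 0 := by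
    intro t ht h0
    have := hf t ht
    rw [h0, map_zero] at this
    exact hpos.ne this
  have hA := h.frame
  have hcont := hz.continuousOn
  -- Freezing `z` at negative times gives a continuous function on the line. The angular rate is
  -- then written with `deriv y`, which is measurable without any measurability of `B`.
  set y : ℝ → Plane := fun t => z (max t 0) with hy
  have hyc : Continuous y :=
    hcont.comp_continuous (by fun_prop) fun t => le_max_right t 0
  set r : ℝ → ℝ := fun t => area (y t) (deriv y t) / radiusSq u w (y t) with hr
  have hrm : Measurable r := by
    have h1 : ∀ i, Measurable fun t => y t i := fun i =>
      ((continuous_apply i).comp hyc).measurable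
    have h2 : ∀ i, Measurable fun t => deriv y t i := fun i =>
      (measurable_pi_apply i).comp (measurable_deriv y)
    have h10 := h1 0
    have h11 := h1 1
    have h20 := h2 0
    have h21 := h2 1
    simp only [hr, radiusSq, area]
    fun_prop
  have hgood : ∀ t, 0 < t → HasDerivAt z (B t *ᵥ z t) t → ∃ R > (0 : ℝ), ∃ θ,
      z t = R • ellipse u w θ ∧ r t = angRate u w (B t) (ellipse u w θ) ∧ c ≤ r t ∧ |r t| ≤ C := by
    intro t ht hd
    obtain ⟨R, hR, θ, -, hRθ⟩ := exists_ellipse_polar h.frame (hne t ht.le)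
    have hyz : y =ᶠ[𝓝 t] z := by
      filter_upwards [Ioi_mem_nhds ht] with s hs
      simp only [hy, max_eq_left (le_of_lt (mem_Ioi.1 hs))]
    have hrt : r t = angRate u w (B t) (ellipse u w θ) := by
      simp only [hr, hyz.deriv_eq, hd.deriv, hyz.eq_of_nhds]
      rw [hRθ, radiusSq_smul_ellipse, Matrix.mulVec_smul, area_smul_right, area_smul_left, angRate]
      field_simp
    refine ⟨R, hR, θ, hRθ, hrt, ?_, ?_⟩
    · obtain ⟨p, hp⟩ := subgrad_nonempty f (ellipse u w θ)
      have hp' : p ∈ Subgrad f (z t) := by rw [hRθ]; exact subgrad_smul hR.le hp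
      have h0 := dot_eq_zero_of_const hd (by
        filter_upwards [Ioi_mem_nhds ht] with s hs
        rw [hf s (le_of_lt hs), hf t ht.le]) hp'
      rw [hRθ, Matrix.mulVec_smul, dotProduct_smul, smul_eq_mul] at h0
      have h1 := hlow θ p hp (B t) (hB t ht.le)
      rw [(mul_eq_zero.1 h0).resolve_left hR.ne', mul_zero, add_zero] at h1
      rwa [hrt]
    · rw [hrt]; exact hupp θ _ (hB t ht.le)
  have hneg : ∀ t < 0, r t = 0 := by
    intro t ht
    have : y =ᶠ[𝓝 t] fun _ => z 0 := by
      filter_upwards [Iio_mem_nhds ht] with s hs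
      simp only [hy, max_eq_right (le_of_lt (mem_Iio.1 hs))]
    simp [hr, this.deriv_eq, area]
  have hrC : ∀ᵐ t, |r t| ≤ C := by
    have h0 : ∀ᵐ t : ℝ, t ≠ 0 := by simp [ae_iff]
    filter_upwards [hz.2, h0] with t ht hne
    rcases lt_or_gt_of_ne hne with hlt | hgt
    · rw [hneg t hlt, abs_zero]; exact hC.le
    · obtain ⟨_, _, _, _, _, _, h1⟩ := hgood t hgt (ht hgt)
      exact h1
  have hrc : ∀ᵐ t : ℝ, 0 < t → c ≤ r t := by
    filter_upwards [hz.2] with t ht hgt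
    obtain ⟨_, _, _, _, _, h1, _⟩ := hgood t hgt (ht hgt)
    exact h1
  obtain ⟨φ₀, hφ₀, hzφ₀⟩ := exists_eq_smul_sphereCurve h.definite h.frame hz0
  obtain ⟨φ, hφ0, ⟨L, hL⟩, hmono, htop, hder⟩ := exists_primitive hrm hc hrC hrc φ₀
  refine ⟨φ, by rw [hφ0]; exact hφ₀.1, hL.continuous, hmono, htop, ?_⟩
  have hq0 : area (ellipse u w (φ 0)) (z 0) = 0 := by
    rw [hφ0, hzφ₀, sphereCurve, area_smul_right, area_smul_right, area_self, mul_zero, mul_zero]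
  -- This area measures the deviation of the angle `φ` from the direction of `z`. As both turn at
  -- the same rate, it satisfies `q' = s * q` with `s ≤ κ`, and it starts at zero.
  have hq : ∀ t, 0 ≤ t → area (ellipse u w (φ t)) (z t) = 0 := by
    intro T hT
    have := sq_le_of_ae_deriv (g := fun t => area (ellipse u w (φ t)) (z t)) (κ := κ) hT
      (absolutelyContinuousOnInterval_area (LipschitzWith.ellipse_comp hL u w 0 T)
        (hz.absolutelyContinuous hT)) (by
      filter_upwards [hz.2, hder] with t ht hφt ht'
      obtain ⟨R, hR, θ, hRθ, hrt, -, -⟩ := hgood t ht'.1 (ht ht'.1)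
      obtain ⟨s, hs, hBs⟩ := hκ θ (B t) (hB t ht'.1.le)
      refine ⟨_, hasDerivAt_area ((ellipse_hasDerivAt u w (φ t)).scomp t hφt) (ht ht'.1), ?_⟩
      have e : area (r t • ellipse u w (φ t + Real.pi / 2)) (z t) +
          area (ellipse u w (φ t)) (B t *ᵥ z t) = s * area (ellipse u w (φ t)) (z t) := by
        rw [hRθ, Matrix.mulVec_smul, hBs, ← hrt]
        simp only [area_smul_right, area_smul_left, area_add_right, area_ellipse_ellipse]
        rw [show θ - (φ t + Real.pi / 2) = θ - φ t - Real.pi / 2 by ring,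
          show θ + Real.pi / 2 - φ t = θ - φ t + Real.pi / 2 by ring, Real.sin_sub_pi_div_two,
          Real.sin_add_pi_div_two]
        ring
      change _ * (area (r t • ellipse u w (φ t + Real.pi / 2)) (z t) +
          area (ellipse u w (φ t)) (B t *ᵥ z t)) ≤ _
      rw [e]
      nlinarith [sq_nonneg (area (ellipse u w (φ t)) (z t))])
    simp only [hq0] at this
    have h2 : area (ellipse u w (φ T)) (z T) ^ 2 ≤ 0 := by simpa using this
    exact pow_eq_zero_iff (two_ne_zero) |>.1 (le_antisymm h2 (sq_nonneg _))
  -- `g` is the signed radius; being continuous, never zero and positive at time `0`, it keeps `z`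
  -- off the opposite ray.
  set g : ℝ → ℝ := fun t => area (z t) (ellipse u w (φ t + Real.pi / 2)) / area u w with hg
  have hzg : ∀ t, 0 ≤ t → z t = g t • ellipse u w (φ t) := by
    intro t ht
    have hA' := area_ellipse u w (φ t)
    obtain ⟨a, b, hab⟩ := frame_coord (u := ellipse u w (φ t))
      (w := ellipse u w (φ t + Real.pi / 2)) (by rwa [hA']) (z t)
    have h1 := hq t ht
    rw [hab, area_add_right, area_smul_right, area_smul_right, area_self, hA', mul_zero,
      zero_add] at h1
    have hb : b = 0 := (mul_eq_zero.1 h1).resolve_right hA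
    rw [hb, zero_smul, add_zero] at hab
    simp only [hg]
    rw [hab, area_smul_left, hA', mul_div_cancel_right₀ _ hA]
  have hgc : ContinuousOn g (Ici 0) := by
    have h1 : ∀ i, ContinuousOn (fun t => z t i) (Ici 0) := fun i =>
      (continuous_apply i).comp_continuousOn hcont
    have h2 : ∀ i, Continuous fun t => ellipse u w (φ t + Real.pi / 2) i := fun i =>
      (continuous_apply i).comp ((ellipse_continuous u w).comp (hL.continuous.add_const _))
    exact (((h1 0).mul (h2 1).continuousOn).sub ((h1 1).mul (h2 0).continuousOn)).div_const _
  have hg0 : 0 < g 0 := by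
    have he := seminorm_ellipse_pos h.definite h.frame φ₀
    have : g 0 = f (z 0) * (f (ellipse u w φ₀))⁻¹ := by
      simp only [hg, hφ0]
      conv_lhs => rw [hzφ₀]
      rw [sphereCurve, area_smul_left, area_smul_left, area_ellipse]
      field_simp
    rw [this]
    positivity
  intro t ht
  have hgt := pos_of_ne_zero hgc (fun t ht h0 => hne t ht (by rw [hzg t ht, h0, zero_smul])) hg0 ht
  have h1 : f (z 0) = g t * f (ellipse u w (φ t)) := by
    rw [← hf t ht, hzg t ht, map_smul_eq_mul, Real.norm_of_nonneg hgt.le]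
  rw [h1, sphereCurve, smul_smul, mul_assoc,
    mul_inv_cancel₀ (seminorm_ellipse_pos h.definite h.frame _).ne', mul_one]
  exact hzg t ht

end IsOriented


/-! ### The Barabanov norm and its extremal trajectory -/

lemma IsFlow.const_smul {B : ℝ → Mat} {z : ℝ → Plane} (h : IsFlow B z) (a : ℝ) :
    IsFlow B (fun t => a • z t) := by
  refine ⟨fun T => ?_, ?_⟩
  · obtain ⟨K, hK⟩ := h.1 T
    exact ⟨_, (lipschitzWith_smul a).comp_lipschitzOnWith hK⟩
  · filter_upwards [h.2] with t ht htp
    rw [Matrix.mulVec_smul]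
    exact (ht htp).const_smul a

lemma IsFlow.congr_law {B B' : ℝ → Mat} {z : ℝ → Plane} (h : IsFlow B z)
    (hB : ∀ t, 0 ≤ t → B t = B' t) : IsFlow B' z := by
  refine ⟨h.1, ?_⟩
  filter_upwards [h.2] with t ht htp
  rw [← hB t htp.le]
  exact ht htp

lemma smul_subgrad {f g : Seminorm ℝ Plane} {c : ℝ} (hc : 0 ≤ c) (hg : ∀ v, g v = c * f v)
    {x p : Plane} (hp : p ∈ Subgrad f x) : c • p ∈ Subgrad g x := by
  refine ⟨by rw [smul_dotProduct, hp.1, hg, smul_eq_mul], fun v => ?_⟩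
  rw [smul_dotProduct, hg, smul_eq_mul]
  exact mul_le_mul_of_nonneg_left (hp.2 v) hc

namespace IsOriented

variable {𝒜 𝓑 : Set Mat} {f g : Seminorm ℝ Plane} {u w : Plane}

/-- The claims on extremal trajectories concern an arbitrary Barabanov norm, which by uniqueness is
a multiple of the adapted one. -/
lemma of_eq_mul (h : IsOriented 𝓑 f u w) {c : ℝ} (hc : 0 < c) (hg : ∀ v, g v = c * f v) :
    IsOriented 𝓑 g u w := by
  have hf : ∀ v, f v = c⁻¹ * g v := fun v => by rw [hg, inv_mul_cancel_left₀ hc.ne']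
  refine ⟨h.isCompact, fun v hv => h.definite v (by rw [hf, hv, mul_zero]), ?_, ?_, h.frame, ?_⟩
  · intro x B hB p hp
    have := h.invariant x B hB _ (smul_subgrad (inv_pos.2 hc).le hf hp)
    rw [smul_dotProduct, smul_eq_mul] at this
    exact nonpos_of_mul_nonpos_right this (inv_pos.2 hc)
  · intro x
    obtain ⟨B, hB, p, hp, h0⟩ := h.tangent x
    exact ⟨B, hB, _, smul_subgrad hc.le hg hp, by rw [smul_dotProduct, h0, smul_zero]⟩
  · rintro θ ⟨p, hp, B, hB, h0, ha⟩
    exact h.not_backward θ ⟨_, smul_subgrad (inv_pos.2 hc).le hf hp, B, hB,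
      by rw [smul_dotProduct, h0, smul_zero], ha⟩

lemma seminorm_smul_sphereCurve (h : IsOriented 𝓑 f u w) {a : ℝ} (ha : 0 ≤ a) (θ : ℝ) :
    f (a • sphereCurve f u w θ) = a := by
  rw [map_smul_eq_mul, seminorm_sphereCurve h.definite h.frame, Real.norm_of_nonneg ha, mul_one]

/-- The motion of `exists_motion`, started at the right phase and rescaled, is extremal through any
given point. It closes after `2 * T` and covers the sphere, so `unique_of_periodic` applies. -/
theorem barabanov (hc : IsCompact 𝒜) (h : IsOriented (shiftSet 𝒜 (lyapunovExponent 𝒜)) f u w) :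
    IsBarabanovNorm 𝒜 f ∧
      (∀ g : Seminorm ℝ Plane, IsBarabanovNorm 𝒜 g → ∃ c : ℝ, 0 < c ∧ ∀ v, g v = c * f v) ∧
      IsC1ClosedCurve (unitSphere f) := by
  obtain ⟨D, Θ, T, hT, hm, hD, -, hΘ0, hΘ, hflow⟩ := h.exists_motion
  have hD' : ∀ t, D t ∈ convexHull ℝ (shiftSet 𝒜 (lyapunovExponent 𝒜)) := fun t =>
    subset_convexHull ℝ _ (hD t)
  refine ⟨⟨h.definite, fun x hx t ht => h.invariant.growth hc hx.mono ht, fun v => ?_⟩, ?_,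
    isC1ClosedCurve_unitSphere h.definite h.frame h.contDiff_seminorm_ellipse⟩
  · obtain ⟨θ, hθ⟩ : ∃ θ, v = f v • sphereCurve f u w θ := by
      rcases eq_or_ne v 0 with rfl | hv
      · exact ⟨0, by rw [map_zero, zero_smul]⟩
      · obtain ⟨θ, -, hθ⟩ := exists_eq_smul_sphereCurve h.definite h.frame hv
        exact ⟨θ, hθ⟩
    refine ⟨_, isExtremalTrajectory_of_flow hc (B := fun t => D (Θ.symm θ + t)) (fun i j =>
      (hm i j).comp (measurable_const_add _)) (fun t _ => hD' _)
      ((hflow (Θ.symm θ)).const_smul (f v)) fun t _ => ?_, ?_⟩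
    · simp only [h.seminorm_smul_sphereCurve (apply_nonneg f v)]
    · simp only [mul_zero, Real.exp_zero, one_smul, add_zero, Θ.apply_symm_apply]
      exact hθ.symm
  · intro g hg
    refine unique_of_periodic (hflow 0) (fun t _ => hD' _) (show 0 < 2 * T by positivity)
      (fun t _ => ?_) (fun v hv => ?_) hg
    · rw [show 0 + (t + 2 * T) = 0 + t + T + T by ring, hΘ, hΘ, sphereCurve_add_pi,
        sphereCurve_add_pi, neg_neg]
    · obtain ⟨θ, hθ, he⟩ := exists_eq_smul_sphereCurve h.definite h.frame hv
      refine ⟨Θ.symm θ, ?_, ?_⟩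
      · rw [Θ.le_symm_apply, hΘ0]
        exact hθ.1
      · rw [zero_add, Θ.apply_symm_apply]
        exact he

/-- The law of a motion has no period shorter than half a turn if the traces are negative. -/
lemma not_period (h : IsOriented 𝓑 f u w) (htr : ∀ B ∈ 𝓑, B.trace < 0) {D : ℝ → Mat} {Θ : ℝ ≃o ℝ}
    {T P : ℝ} (hT : 0 < T) (hD : ∀ t, D t ∈ 𝓑) (hΘ0 : Θ 0 = 0)
    (hΘ : ∀ t, Θ (t + T) = Θ t + Real.pi)
    (hflow : ∀ t₀, IsFlow (fun t => D (t₀ + t)) (fun t => sphereCurve f u w (Θ (t₀ + t))))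
    (hP : 0 < P) (hPT : P < T) : ¬ ∀ t, 0 ≤ t → D (t + P) = D t := by
  intro hper
  obtain ⟨B₀, hB₀, hmax⟩ := h.isCompact.exists_isMaxOn ⟨D 0, hD 0⟩
    (f := fun B : Mat => B.trace) (by
      simp only [Matrix.trace_fin_two]
      fun_prop)
  have hx := hflow 0
  -- If `P` is a period of the law, the motion delayed by `P` solves the same equation as the motion
  -- itself.
  have hy : IsFlow (fun t => D (0 + t)) (fun t => sphereCurve f u w (Θ (P + t))) :=
    (hflow P).congr_law fun t ht => by rw [add_comm P, hper t ht, zero_add]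
  have h1 := hx.area_sq_le hy (δ := -B₀.trace)
    (fun t _ => by rw [neg_neg]; exact hmax (hD _)) hT.le
  have hΘT : Θ (0 + T) = Θ 0 + Real.pi := hΘ 0
  simp only [add_zero, hΘ, sphereCurve_add_pi, neg_neg] at h1
  set S := area (sphereCurve f u w (Θ 0)) (sphereCurve f u w (Θ P)) with hS
  have e : area (-sphereCurve f u w (Θ 0)) (-sphereCurve f u w (Θ P)) = S := by
    simp only [hS, area, Pi.neg_apply]; ring
  -- After time `T` both solutions have changed sign and span the same area, while negative traces
  -- shrink its square by a factor below `1`. So the area is zero, although `Θ P` lies strictly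
  -- between `0` and `π`.
  rw [e] at h1
  have hexp : Real.exp (2 * B₀.trace * T) < 1 := by
    rw [Real.exp_lt_one_iff]
    have := mul_neg_of_neg_of_pos (htr B₀ hB₀) hT
    linarith
  have hS0 : S = 0 := by
    by_contra hne
    have : 0 < S ^ 2 := by positivity
    nlinarith
  rw [hS, sphereCurve, sphereCurve, area_smul_left, area_smul_right, area_ellipse_ellipse, hΘ0,
    sub_zero] at hS0
  have hsin : 0 < Real.sin (Θ P) := by
    refine Real.sin_pos_of_pos_of_lt_pi ?_ ?_
    · rw [← hΘ0]; exact Θ.strictMono hP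
    · have := Θ.strictMono hPT
      have h2 := hΘ 0
      rw [zero_add, hΘ0, zero_add] at h2
      rwa [h2] at this
  have p1 := seminorm_ellipse_pos h.definite h.frame 0
  have p2 := seminorm_ellipse_pos h.definite h.frame (Θ P)
  have := h.frame
  exact absurd hS0 (by positivity)

theorem exists_periodic_extremal (hc : IsCompact 𝒜)
    (h : IsOriented (shiftSet 𝒜 (lyapunovExponent 𝒜)) f u w)
    (htr : ∀ B ∈ shiftSet 𝒜 (lyapunovExponent 𝒜), B.trace < 0) :
    ∃ (A : ℝ → Mat) (x : ℝ → Plane) (T : ℝ), IsExtremalTrajectory 𝒜 f x ∧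
      (∀ y : ℝ → Plane, IsExtremalTrajectory 𝒜 f y → y 0 ≠ 0 →
        SameTrajectory (lyapunovExponent 𝒜) y x) ∧
      IsSwitchingLaw 𝒜 A ∧ IsSolution A x ∧ IsMinimalPeriod A T ∧
      BijOn (fun t => Real.exp (-lyapunovExponent 𝒜 * t) • x t) (Ico 0 (2 * T)) (unitSphere f) := by
  obtain ⟨D, Θ, T, hT, hm, hD, hDT, hΘ0, hΘ, hflow⟩ := h.exists_motion
  set σ := lyapunovExponent 𝒜 with hσ
  have hD' : ∀ t, 0 ≤ t → D t ∈ convexHull ℝ (shiftSet 𝒜 σ) := fun t _ =>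
    subset_convexHull ℝ _ (hD t)
  have hz : IsFlow D (fun t => sphereCurve f u w (Θ t)) := by simpa only [zero_add] using hflow 0
  have hcancel : ∀ t, Real.exp (-σ * t) • (Real.exp (σ * t) • sphereCurve f u w (Θ t)) =
      sphereCurve f u w (Θ t) := fun t => by rw [neg_mul, exp_neg_smul_exp_smul]
  refine ⟨fun t => D t + σ • (1 : Mat), fun t => Real.exp (σ * t) • sphereCurve f u w (Θ t), T,
    ?_, ?_, ?_, (hz.unshift hc hm hD').2, ⟨⟨hT, fun t _ => by simp only [hDT]⟩, ?_⟩, ?_⟩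
  · refine isExtremalTrajectory_of_flow hc hm hD' hz fun t _ => ?_
    rw [seminorm_sphereCurve h.definite h.frame, seminorm_sphereCurve h.definite h.frame]
  · intro y hy hy0
    obtain ⟨B, hB, hzy⟩ := hy.1.shift_flow hc σ
    obtain ⟨φ, hφ0, hφc, hφm, hφt, hφ⟩ := h.exists_polar_angle hzy hB (fun t ht => by
      simp only [seminorm_exp_smul, hy.2 t ht, mul_zero, Real.exp_zero, one_smul]
      rw [← mul_assoc, ← Real.exp_add, ← hσ, neg_mul, neg_add_cancel, Real.exp_zero, one_mul])
      (by simpa using hy0)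
    -- The angle of `y` is converted into the time at which the periodic motion has that angle.
    refine ⟨f (y 0), fun t => Θ.symm (φ t), seminorm_pos h.definite hy0, ?_, ?_, ?_, ?_, ?_⟩
    · rw [Θ.le_symm_apply, hΘ0]; exact hφ0
    · exact (Θ.symm.continuous.comp hφc).continuousOn
    · exact Θ.symm.strictMono.comp_strictMonoOn hφm
    · exact Θ.symm.tendsto_atTop.comp hφt
    · intro t ht
      have := hφ t ht
      rw [hcancel, Θ.apply_symm_apply]
      simpa using this
  · refine ⟨fun i j => ?_, fun t _ => mem_shiftSet.1 (hD t)⟩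
    simp only [Matrix.add_apply]
    exact (hm i j).add_const _
  · rintro P ⟨hP, hper⟩
    by_contra! hPT
    exact h.not_period htr hT hD hΘ0 hΘ hflow hP hPT fun t ht => add_right_cancel (hper t ht)
  · simp only [hcancel]
    refine (sphereCurve_bijOn h.definite h.frame).comp ⟨fun t ht => ?_, Θ.injective.injOn, ?_⟩
    all_goals
      have h2 : Θ (2 * T) = 2 * Real.pi := by
        rw [show 2 * T = 0 + T + T by ring, hΘ, hΘ, hΘ0]; ring
    · rw [← hΘ0, ← h2]
      exact ⟨Θ.monotone ht.1, Θ.strictMono ht.2⟩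
    · intro θ hθ
      refine ⟨Θ.symm θ, ⟨?_, ?_⟩, Θ.apply_symm_apply θ⟩
      · rw [Θ.le_symm_apply, hΘ0]; exact hθ.1
      · rw [Θ.symm_apply_lt, h2]; exact hθ.2

end IsOriented

end PlanarSwitching

/-! ### The theorem, by cases on complex dominance -/

theorem corollaryc10 (𝒜 : Set PlanarSwitching.Mat) (hcompact : IsCompact 𝒜)
    (hirr : PlanarSwitching.IsIrreducible 𝒜)
    (hscalar : PlanarSwitching.lyapunovExponent 𝒜 • (1 : PlanarSwitching.Mat) ∉ 𝒜)
    (hreal : ¬ PlanarSwitching.HasRealDominance 𝒜) :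
    (∃ f : Seminorm ℝ PlanarSwitching.Plane,
      PlanarSwitching.IsBarabanovNorm 𝒜 f ∧
      (∀ g : Seminorm ℝ PlanarSwitching.Plane, PlanarSwitching.IsBarabanovNorm 𝒜 g →
        ∃ c : ℝ, 0 < c ∧ ∀ v, g v = c * f v) ∧
      PlanarSwitching.IsC1ClosedCurve (PlanarSwitching.unitSphere f)) ∧
    (¬ PlanarSwitching.HasComplexDominance 𝒜 →
      ∀ f : Seminorm ℝ PlanarSwitching.Plane, PlanarSwitching.IsBarabanovNorm 𝒜 f →
        ∃ (A : ℝ → PlanarSwitching.Mat) (x : ℝ → PlanarSwitching.Plane) (T : ℝ),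
          PlanarSwitching.IsExtremalTrajectory 𝒜 f x ∧
          (∀ y : ℝ → PlanarSwitching.Plane, PlanarSwitching.IsExtremalTrajectory 𝒜 f y →
            y 0 ≠ 0 →
              PlanarSwitching.SameTrajectory (PlanarSwitching.lyapunovExponent 𝒜) y x) ∧
          PlanarSwitching.IsSwitchingLaw 𝒜 A ∧
          PlanarSwitching.IsSolution A x ∧
          PlanarSwitching.IsMinimalPeriod A T ∧
          Set.BijOn (fun t => Real.exp (-PlanarSwitching.lyapunovExponent 𝒜 * t) • x t)
            (Set.Ico 0 (2 * T)) (PlanarSwitching.unitSphere f)) := by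
  obtain ⟨f, hdef, hinv, hext⟩ := PlanarSwitching.exists_adapted_norm hcompact hirr
  by_cases hcomplex : PlanarSwitching.HasComplexDominance 𝒜
  · exact ⟨⟨f, PlanarSwitching.barabanov_of_complexDominance hcompact hcomplex hdef hinv⟩,
      fun h => absurd hcomplex h⟩
  · have hcpt := PlanarSwitching.isCompact_shiftSet hcompact
      (PlanarSwitching.lyapunovExponent 𝒜)
    obtain ⟨u, w, hframe, hnb⟩ := PlanarSwitching.exists_oriented_frame hcpt hdef hinv hext
      (PlanarSwitching.hull_mulVec_ne_zero hscalar hreal hcomplex hdef hinv)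
    have h : PlanarSwitching.IsOriented _ f u w := ⟨hcpt, hdef, hinv, hext, hframe, hnb⟩
    have hpart := h.barabanov hcompact
    refine ⟨⟨f, hpart⟩, fun _ g hg => ?_⟩
    obtain ⟨c, hc, hgf⟩ := hpart.2.1 g hg
    exact (h.of_eq_mul hc hgf).exists_periodic_extremal hcompact fun B hB =>
      PlanarSwitching.hull_trace_neg hscalar hreal hcomplex hdef hinv B
        (subset_convexHull ℝ _ hB)
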